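/- Let $\Omega\subset\mathbb{R}^2$ be a bounded polygonal domain, let $\zeta\in[W^{1,\infty}(\Omega)]^2$ (identified with its continuous representative on $\bar\Omega$), let $\gamma\in W^{1,\infty}(\Omega)$ with $\gamma\ge 0$, and put $\mathcal{L}y=-\Delta y+\zeta\cdot\nabla y+\gamma y$ and $E(\Delta;L_2(\Omega))=\{y\in H^1(\Omega):\mathcal{L}y\in L_2(\Omega)\}$. For a conforming simplicial triangulation $\mathcal{T}_h$ of $\Omega$ let $\mathcal{E}_h=\mathcal{E}_h^i\cup\mathcal{E}_h^b$ be the set of its (interior and boundary) edges, $h_T$ the diameter of $T$, $h_e$ the length of $e$, and $V_h=\{v\in L_2(\Omega): v|_T\in\mathbb{P}_1(T)\ \forall T\in\mathcal{T}_h\}$. Each edge carries a fixed unit normal $\mathbf{n}$; $T^+$ is the element of $e$ for which $\mathbf{n}$ is outward, $T^-$ is the other one, $v^\pm=v|_{T^\pm}$. On interior edges $[v]=v^+-v^-$ and $\{v\}=\frac12(v^++v^-)$; on boundary edges $\mathbf{n}$ is outward and $[v]=\{v\}=v$. Let $\mathcal{E}_h^{b,-}$ be the set of boundary edges in whose relative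 interior $\zeta\cdot\mathbf{n}<0$. For $\sigma>0$ let $a_h=a_h^{\rm sip}+a_h^{\rm ar}$, where $$a_h^{\rm sip}(w,v)=\sum_{T\in\mathcal{T}_h}\int_T\nabla w\cdot\nabla v\,dx-\sum_{e\in\mathcal{E}_h}\int_e\{\mathbf{n}\cdot\nabla w\}[v]\,ds-\sum_{e\in\mathcal{E}_h}\int_e\{\mathbf{n}\cdot\nabla v\}[w]\,ds+\sigma\sum_{e\in\mathcal{E}_h}h_e^{-1}\int_e[w][v]\,ds,$$ $$a_h^{\rm ar}(w,v)=\sum_{T\in\mathcal{T}_h}\int_T(\zeta\cdot\nabla w+\gamma w)v\,dx-\sum_{e\in\mathcal{E}_h^i\cup\mathcal{E}_h^{b,-}}\int_e(\mathbf{n}\cdot\zeta)[w]\{v\}\,ds,$$ and let $$|||v|||_h^2=\sum_{T\in\mathcal{T}_h}\Big[\|\nabla v\|^2_{L_2(T)}+\sum_{e\subset\partial T}\frac{\sigma}{h_e}\|[v]\|^2_{L_2(e)}+\sum_{e\subset\partial T}\frac{h_e}{\sigma}\|\{\mathbf{n}\cdot\nabla v\}\|^2_{L_2(e)}\Big].$$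 Here the normal derivatives on the edges of each element $T$ are understood in the sense of Green's formula on $T$, and $|||v|||_h=\infty$ if the traces or the normal derivatives of $v$ on the element boundaries are not in $L_2$. Then for every $\kappa$ there are constants $\sigma_0,C,c>0$, depending only on $\Omega,\zeta,\gamma,\kappa$, such that for every $\sigma\ge\sigma_0$ and every triangulation $\mathcal{T}_h$ of $\Omega$ which is shape regular with constant $\kappa$ (that is, $h_T\le\kappa\rho_T$ for all $T\in\mathcal{T}_h$, where $\rho_T$ is the diameter of the largest disc in $T$), the following hold. 1. (Boundedness) For all $w,v\in E(\Delta;L_2(\Omega))+V_h$, $$|a_h(w,v)|\le C\,|||w|||_h\,|||v|||_h ,$$ with the convention $0\cdot\infty=0$. 2. (Coercivity) If there is $\gamma_0>0$ with $\gamma-\frac12\nabla\cdot\zeta\ge\gamma_0$ almost everywhere in $\Omega$, then for all $v\in V_h$ the norm $|||v|||_h$ is finite and $$a_h(v,v)\ge c\,|||v|||_h^2 .$$ -/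

import Mathlib

open MeasureTheory Filter Topology
open scoped ENNReal ContDiff

noncomputable section

namespace DG

/-- The Euclidean plane. -/
abbrev Plane : Type := EuclideanSpace ℝ (Fin 2)

/-! ### Polygonal domains and weak derivatives -/

/-- A bounded polygonal domain: a bounded, connected, nonempty open set which is the interior of its
closure and whose boundary is contained in a finite union of line segments. -/
def IsPolygonalDomain (Ω : Set Plane) : Prop :=
  IsOpen Ω ∧ IsConnected Ω ∧ Bornology.IsBounded Ω ∧ interior (closure Ω) = Ω ∧
    ∃ S : Finset (Plane × Plane), frontier Ω ⊆ ⋃ p ∈ S, segment ℝ p.1 p.2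

/-- `φ ∈ C_c^∞(U)`. -/
def IsTestFunction (U : Set Plane) (φ : Plane → ℝ) : Prop :=
  ContDiff ℝ ∞ φ ∧ HasCompactSupport φ ∧ tsupport φ ⊆ U

/-- `G` is the weak (distributional) gradient of `u` in the open set `U`. -/
def IsWeakGrad (U : Set Plane) (u : Plane → ℝ) (G : Plane → Plane) : Prop :=
  LocallyIntegrableOn u U ∧ LocallyIntegrableOn G U ∧
    ∀ φ : Plane → ℝ, IsTestFunction U φ →
      ∫ x in U, u x • gradient φ x = -∫ x in U, φ x • G x

open scoped Classical in
/-- The weak gradient of `u` in `U` (unique up to a null set of `U`), `0` if there is none. -/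
def wgrad (U : Set Plane) (u : Plane → ℝ) : Plane → Plane :=
  if h : ∃ G, IsWeakGrad U u G then h.choose else 0

/-- The weak divergence of a vector field with weakly differentiable components. -/
def wdiv (U : Set Plane) (ζ : Plane → Plane) (x : Plane) : ℝ :=
  ∑ i : Fin 2, wgrad U (fun y => ζ y i) x i

/-- `u ∈ W^{1,p}(U)`. -/
def MemW1 (p : ℝ≥0∞) (U : Set Plane) (u : Plane → ℝ) : Prop :=
  MemLp u p (volume.restrict U) ∧
    ∃ G, IsWeakGrad U u G ∧ MemLp G p (volume.restrict U)

/-- `y ∈ E(Δ; L²(Ω))`: `y ∈ H¹(Ω)` and the distribution `𝓛 y = -Δy + ζ·∇y + γ y` belongs to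
`L²(Ω)`. -/
def MemE (Ω : Set Plane) (ζ : Plane → Plane) (γ : Plane → ℝ) (y : Plane → ℝ) : Prop :=
  MemW1 2 Ω y ∧ ∃ f : Plane → ℝ, MemLp f 2 (volume.restrict Ω) ∧
    ∀ φ : Plane → ℝ, IsTestFunction Ω φ →
      ∫ x in Ω, (inner ℝ (wgrad Ω y x) (gradient φ x)
          + inner ℝ (ζ x) (wgrad Ω y x) * φ x + γ x * y x * φ x)
        = ∫ x in Ω, f x * φ x

/-! ### Single triangles and edges

A triangle (an edge) is given by the set of its three (two) vertices. -/

/-- The closed set spanned by a vertex set. -/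
def cell (s : Finset Plane) : Set Plane := convexHull ℝ (s : Set Plane)

/-- The diameter `h_T` of a triangle, and the length `h_e` of an edge. -/
def size (s : Finset Plane) : ℝ := Metric.diam (cell s)

/-- The arc length measure on an edge. -/
def edgeMeasure (e : Finset Plane) : Measure Plane := (μH[1] : Measure Plane).restrict (cell e)

/-- The area measure on a triangle. -/
def triMeasure (t : Finset Plane) : Measure Plane := volume.restrict (cell t)

/-- The three edges of a triangle. -/
def edgesOf (t : Finset Plane) : Finset (Finset Plane) := t.powersetCard 2

/-- The gradient of `u` on the triangle `t` (only the restriction of `u` to `t` matters). -/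
def tgrad (t : Finset Plane) (u : Plane → ℝ) : Plane → Plane := wgrad (interior (cell t)) u

/-- `q ∈ L²(∂T)` is the trace on `∂T` of `u ∈ H¹(T)`: there are smooth functions which converge to
`u` in `H¹(T)` and whose boundary values converge to `q` in `L²(∂T)`. -/
def IsTrace (t : Finset Plane) (u q : Plane → ℝ) : Prop :=
  (∀ e ∈ edgesOf t, MemLp q 2 (edgeMeasure e)) ∧
    ∃ φ : ℕ → Plane → ℝ, (∀ n, ContDiff ℝ ∞ (φ n)) ∧
      Tendsto (fun n => eLpNorm (fun x => φ n x - u x) 2 (triMeasure t)) atTop (𝓝 0) ∧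
      Tendsto (fun n => eLpNorm (fun x => gradient (φ n) x - tgrad t u x) 2 (triMeasure t))
        atTop (𝓝 0) ∧
      ∀ e ∈ edgesOf t,
        Tendsto (fun n => eLpNorm (fun x => φ n x - q x) 2 (edgeMeasure e)) atTop (𝓝 0)

/-- `q ∈ L²(∂T)` is the outward normal derivative on `∂T` of `u ∈ H¹(T)` with `Δu ∈ L²(T)`, in the
sense of Green's formula: `∫_T ∇u·∇φ + ∫_T (Δu) φ = ∫_{∂T} q φ` for all smooth `φ`. (The test
functions supported inside `T` force `f = Δu`.) -/
def IsNormalDeriv (t : Finset Plane) (u q : Plane → ℝ) : Prop :=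
  (∀ e ∈ edgesOf t, MemLp q 2 (edgeMeasure e)) ∧
    ∃ f : Plane → ℝ, MemLp f 2 (triMeasure t) ∧
      ∀ φ : Plane → ℝ, ContDiff ℝ ∞ φ →
        ∫ x, inner ℝ (tgrad t u x) (gradient φ x) ∂(triMeasure t) + ∫ x, f x * φ x ∂(triMeasure t)
          = ∑ e ∈ edgesOf t, ∫ x, q x * φ x ∂(edgeMeasure e)

open scoped Classical in
/-- The trace of `u|_T` on `∂T`. -/
def trace (t : Finset Plane) (u : Plane → ℝ) : Plane → ℝ :=
  if h : ∃ q, IsTrace t u q then h.choose else 0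

open scoped Classical in
/-- The outward normal derivative of `u|_T` on `∂T`. -/
def normalDeriv (t : Finset Plane) (u : Plane → ℝ) : Plane → ℝ :=
  if h : ∃ q, IsNormalDeriv t u q then h.choose else 0

/-! ### Triangulations -/

/-- A (conforming) simplicial triangulation of `Ω`, together with a choice of a unit normal on each
edge: a finite simplicial complex in the plane, every simplex of which belongs to a triangle, whose
underlying set is the closure of `Ω`. For an edge `e`, `normal e` is the fixed unit normal and
`plus e` is the triangle `T⁺` for which it is the outward normal. -/
structure Triangulation (Ω : Set Plane) where
  /-- the simplicial complex -/
  complex : Geometry.SimplicialComplex ℝ Plane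
  finite_faces : complex.faces.Finite
  pure : ∀ s ∈ complex.faces, ∃ t ∈ complex.faces, s ⊆ t ∧ t.card = 3
  space_eq : complex.space = closure Ω
  /-- the fixed unit normal `n` on each edge -/
  normal : Finset Plane → Plane
  /-- the element `T⁺` of each edge -/
  plus : Finset Plane → Finset Plane
  plus_mem : ∀ e ∈ complex.faces, e.card = 2 →
    plus e ∈ complex.faces ∧ (plus e).card = 3 ∧ e ⊆ plus e
  norm_normal : ∀ e ∈ complex.faces, e.card = 2 → ‖normal e‖ = 1
  normal_orthogonal : ∀ e ∈ complex.faces, e.card = 2 →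
    ∀ p ∈ e, ∀ q ∈ e, inner ℝ (normal e) (p - q) = 0
  normal_outward : ∀ e ∈ complex.faces, e.card = 2 →
    ∀ p ∈ e, ∀ r ∈ plus e, r ∉ e → inner ℝ (normal e) (r - p) < 0

namespace Triangulation

variable {Ω : Set Plane} (𝓣 : Triangulation Ω)

/-- The set `𝓣_h` of triangles. -/
def triangles : Finset (Finset Plane) := 𝓣.finite_faces.toFinset.filter (fun s => s.card = 3)

/-- The set `ℰ_h` of edges. -/
def edges : Finset (Finset Plane) := 𝓣.finite_faces.toFinset.filter (fun s => s.card = 2)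

open scoped Classical in
/-- The triangles that contain the edge `e`: two for an interior edge, one for a boundary edge. -/
def adjacent (e : Finset Plane) : Finset (Finset Plane) := 𝓣.triangles.filter (fun t => e ⊆ t)

/-- The set `ℰ_h^i` of interior edges, those which are shared by two triangles. -/
def interiorEdges : Finset (Finset Plane) := 𝓣.edges.filter (fun e => (𝓣.adjacent e).card = 2)

/-- The set `ℰ_h^b` of boundary edges, those which belong to one triangle only. -/
def boundaryEdges : Finset (Finset Plane) := 𝓣.edges.filter (fun e => (𝓣.adjacent e).card = 1)

open scoped Classical in
/-- The set `ℰ_h^{b,-}` of inflow edges: the boundary edges on which `ζ·n < 0` (at all points but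
the two end points, where the normal of `∂Ω` need not exist). -/
def inflowEdges (ζ : Plane → Plane) : Finset (Finset Plane) :=
  𝓣.boundaryEdges.filter (fun e => ∀ x ∈ cell e, x ∉ e → inner ℝ (ζ x) (𝓣.normal e) < 0)

/-- Shape regularity with constant `κ`: `h_T ≤ κ ρ_T`, with `ρ_T` the diameter of a disc inscribed
in `T`. -/
def ShapeRegular (κ : ℝ) : Prop :=
  ∀ t ∈ 𝓣.triangles, ∃ (x : Plane) (r : ℝ), 0 < r ∧ Metric.ball x r ⊆ cell t ∧ size t ≤ κ * (2 * r)

open scoped Classical in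
/-- `1` if `n` is the outward normal of `t` on `e` (that is, `t = T⁺`), otherwise `-1`. -/
def sgn (e t : Finset Plane) : ℝ := if t = 𝓣.plus e then 1 else -1

/-- The jump `[v] = v⁺ - v⁻` on an interior edge and `[v] = v` on a boundary edge. -/
def jump (e : Finset Plane) (v : Plane → ℝ) (x : Plane) : ℝ :=
  ∑ t ∈ 𝓣.adjacent e, 𝓣.sgn e t * trace t v x

/-- The average `{v} = (v⁺ + v⁻)/2` on an interior edge and `{v} = v` on a boundary edge. -/
def avg (e : Finset Plane) (v : Plane → ℝ) (x : Plane) : ℝ :=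
  (∑ t ∈ 𝓣.adjacent e, trace t v x) / (𝓣.adjacent e).card

/-- The average `{n·∇v}` on an edge: on `T⁻` the outward normal is `-n`. -/
def avgNormal (e : Finset Plane) (v : Plane → ℝ) (x : Plane) : ℝ :=
  (∑ t ∈ 𝓣.adjacent e, 𝓣.sgn e t * normalDeriv t v x) / (𝓣.adjacent e).card

/-- `v ∈ V_h`: on each triangle, `v` is a polynomial of degree at most one. -/
def MemVh (v : Plane → ℝ) : Prop :=
  ∀ t ∈ 𝓣.triangles, ∃ l : Plane →ᵃ[ℝ] ℝ, v =ᵐ[triMeasure t] l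

/-- `w ∈ E(Δ; L²(Ω)) + V_h`. -/
def MemSum (ζ : Plane → Plane) (γ : Plane → ℝ) (w : Plane → ℝ) : Prop :=
  ∃ y v : Plane → ℝ, MemE Ω ζ γ y ∧ 𝓣.MemVh v ∧ w =ᵐ[volume.restrict Ω] fun x => y x + v x

/-- The bilinear form `a_h^{sip}`. -/
def aSip (σ : ℝ) (w v : Plane → ℝ) : ℝ :=
  (∑ t ∈ 𝓣.triangles, ∫ x, inner ℝ (tgrad t w x) (tgrad t v x) ∂(triMeasure t))
  - (∑ e ∈ 𝓣.edges, ∫ x, 𝓣.avgNormal e w x * 𝓣.jump e v x ∂(edgeMeasure e))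
  - (∑ e ∈ 𝓣.edges, ∫ x, 𝓣.avgNormal e v x * 𝓣.jump e w x ∂(edgeMeasure e))
  + σ * ∑ e ∈ 𝓣.edges, (size e)⁻¹ * ∫ x, 𝓣.jump e w x * 𝓣.jump e v x ∂(edgeMeasure e)

open scoped Classical in
/-- The bilinear form `a_h^{ar}`. -/
def aAr (ζ : Plane → Plane) (γ : Plane → ℝ) (w v : Plane → ℝ) : ℝ :=
  (∑ t ∈ 𝓣.triangles,
    ∫ x, (inner ℝ (ζ x) (tgrad t w x) + γ x * w x) * v x ∂(triMeasure t))
  - ∑ e ∈ 𝓣.interiorEdges ∪ 𝓣.inflowEdges ζ,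
      ∫ x, inner ℝ (𝓣.normal e) (ζ x) * 𝓣.jump e w x * 𝓣.avg e v x ∂(edgeMeasure e)

/-- The bilinear form `a_h = a_h^{sip} + a_h^{ar}`. -/
def aForm (σ : ℝ) (ζ : Plane → Plane) (γ : Plane → ℝ) (w v : Plane → ℝ) : ℝ :=
  𝓣.aSip σ w v + 𝓣.aAr ζ γ w v

/-- On every triangle `v` has a trace and a normal derivative in `L²(∂T)`. -/
def HasL2Traces (v : Plane → ℝ) : Prop :=
  ∀ t ∈ 𝓣.triangles, (∃ q, IsTrace t v q) ∧ ∃ q, IsNormalDeriv t v q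

open scoped Classical in
/-- The mesh-dependent energy norm `|||v|||_h`, with the value `∞` if the traces that enter it are
not in `L²`. -/
def energyNorm (σ : ℝ) (v : Plane → ℝ) : ℝ≥0∞ :=
  if 𝓣.HasL2Traces v then
    (∑ t ∈ 𝓣.triangles,
      (eLpNorm (tgrad t v) 2 (triMeasure t) ^ 2
        + (∑ e ∈ edgesOf t,
            ENNReal.ofReal (σ / size e) * eLpNorm (𝓣.jump e v) 2 (edgeMeasure e) ^ 2)
        + ∑ e ∈ edgesOf t,
            ENNReal.ofReal (size e / σ) * eLpNorm (𝓣.avgNormal e v) 2 (edgeMeasure e) ^ 2))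
      ^ (1 / 2 : ℝ)
  else ⊤

end Triangulation

end DG

end

/-!
The sums over triangles and edges are estimated by the Cauchy–Schwarz inequality, after two facts
which are uniform over the shape regular triangulations have been established.

* The trace inequality `HasTraceGrad.trace_inequality` on one triangle. Green's formula for the
  radial field `x - p` from a vertex `p` sees only the opposite edge, where the factor `n · (x - p)`
  is the height of the triangle, which is at least the inscribed diameter
  (`HasTraceGrad.green_radial`, `two_mul_radius_le_height`).
* The broken Poincaré inequality `Triangulation.Regular.l2Sq_le`, which bounds `∑_T ‖v‖²` by
  `∑_T ‖∇v‖² + ∑_e h_e⁻¹ ‖[v]‖²`. Green's formula for `v²` and the field `x₀ e₀`, of divergence one,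
  gives `∑_T ‖v‖²` up to a volume term with `v ∇v` and edge terms with `[v²] = 2 [v] {v}`; the
  trace inequality controls `{v}`, and Young's inequality absorbs what depends on `v`.

Boundedness (`Triangulation.ofReal_abs_aForm_le`) follows. If a function has infinite energy, the
right-hand side is infinite unless the other function has energy zero; then the other function, its
gradients, its jumps, averages and normal averages vanish almost everywhere by the two facts, and
so does the form (`Triangulation.Regular.aForm_eq_zero`).

For coercivity, the gradient of a function of `V_h` is constant on each triangle, so the trace
inequality bounds `∑_e h_e ‖{n·∇v}‖²` by `∑_T ‖∇v‖²`, and the penalty dominates the cross terms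
(`Triangulation.IsPiecewiseAffine.le_aSip`). In the convection form, Green's formula for `v² ζ`
on each triangle leaves the integral of `(γ - ∇·ζ / 2) v² ≥ 0`; the interior edges cancel exactly
against the upwind terms because `[v²] = 2 [v] {v}`, and on boundary edges, where `{v} = [v]`, the
remaining terms are bounded by `h_e⁻¹ ‖[v]‖²` whatever the sign of `ζ·n`, and absorbed by the
penalty (`Triangulation.IsPiecewiseAffine.le_aAr`).

Since `ζ` has only an integrable weak gradient on the interior of a triangle and boundary values by
continuity, Green's formula for it, `IsWeakGrad.green`, uses cutoff functions of the triangle.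
Their gradients are bounded in `L¹` because each factor is monotone in a fixed direction. The
traces and normal derivatives enter the definitions through a choice, and are identified by their
uniqueness (`HasTraceGrad.trace_unique`, `IsNormalDeriv.unique`). Everything rests on Green's
formula for smooth functions on a triangle, `green_triangle`, which follows from Fubini's theorem
on the reference triangle.
-/

open MeasureTheory Filter Topology
open scoped ENNReal ContDiff

noncomputable section

namespace DG

/-! ### Green's formula for smooth functions on a triangle -/

/-- The unit speed parametrization of an edge is an isometry, so it transports the length of an
interval to the Hausdorff measure. -/
theorem edgeMeasure_eq_map {e : Finset Plane} {p q : Plane} (he : (e : Set Plane) = {p, q})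
    (hpq : p ≠ q) :
    edgeMeasure e = Measure.map (fun s : ℝ => p + s • (‖q - p‖⁻¹ • (q - p)))
      (volume.restrict (Set.Icc 0 ‖q - p‖)) := by
  have hL : 0 < ‖q - p‖ := norm_pos_iff.2 (sub_ne_zero.2 hpq.symm)
  set u : Plane := ‖q - p‖⁻¹ • (q - p) with hu
  have hu1 : ‖u‖ = 1 := by rw [hu, norm_smul, norm_inv, norm_norm, inv_mul_cancel₀ hL.ne']
  have hiso : Isometry (fun s : ℝ => p + s • u) := by
    refine Isometry.of_dist_eq fun x y => ?_
    rw [dist_add_left, dist_eq_norm, ← sub_smul, norm_smul, hu1, mul_one, Real.dist_eq,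
      Real.norm_eq_abs]
  have hpre : (fun s : ℝ => p + s • u) ⁻¹' (cell e) = Set.Icc 0 ‖q - p‖ := by
    rw [cell, he, convexHull_pair, segment_eq_image']
    ext s
    simp only [Set.mem_preimage, Set.mem_image, Set.mem_Icc, add_right_inj]
    constructor
    · rintro ⟨θ, ⟨h0, h1⟩, h⟩
      have hs : (θ * ‖q - p‖) • u = s • u := by
        rw [← h, hu, smul_smul, mul_assoc, mul_inv_cancel₀ hL.ne', mul_one]
      have hu0 : u ≠ 0 := by rw [← norm_pos_iff, hu1]; exact one_pos
      have := smul_left_injective ℝ hu0 hs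
      rw [← this]
      exact ⟨by positivity, by nlinarith⟩
    · rintro ⟨h0, h1⟩
      refine ⟨s / ‖q - p‖, ⟨by positivity, (div_le_one hL).2 h1⟩, ?_⟩
      rw [hu, smul_smul, div_eq_mul_inv]
  have hm := hiso.map_hausdorffMeasure (d := 1) (Or.inl zero_le_one)
  rw [hausdorffMeasure_real] at hm
  have hmeas : Measurable (fun s : ℝ => p + s • u) := hiso.continuous.measurable
  have hcell : MeasurableSet (cell e) :=
    (e.finite_toSet.isCompact_convexHull (𝕜 := ℝ)).isClosed.measurableSet
  have hsub : cell e ⊆ Set.range (fun s : ℝ => p + s • u) := by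
    rw [cell, he, convexHull_pair, segment_eq_image']
    rintro _ ⟨θ, -, rfl⟩
    refine ⟨θ * ‖q - p‖, ?_⟩
    simp only [hu, smul_smul, mul_assoc, mul_inv_cancel₀ hL.ne', mul_one]
  rw [← hpre, ← Measure.restrict_map hmeas hcell, hm,
    Measure.restrict_restrict_of_subset hsub]
  rfl

theorem integral_edge {e : Finset Plane} {p q : Plane} (he : (e : Set Plane) = {p, q})
    (hpq : p ≠ q) (f : Plane → ℝ) :
    ∫ x, f x ∂(edgeMeasure e) = ‖q - p‖ * ∫ θ in (0 : ℝ)..1, f (p + θ • (q - p)) := by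
  have hL : 0 < ‖q - p‖ := norm_pos_iff.2 (sub_ne_zero.2 hpq.symm)
  have hemb : MeasurableEmbedding (fun s : ℝ => p + s • (‖q - p‖⁻¹ • (q - p))) := by
    refine (Isometry.isClosedEmbedding ?_).measurableEmbedding
    refine Isometry.of_dist_eq fun x y => ?_
    rw [dist_add_left, dist_eq_norm, ← sub_smul, norm_smul, norm_smul, norm_inv, norm_norm,
      inv_mul_cancel₀ hL.ne', mul_one, Real.dist_eq, Real.norm_eq_abs]
  rw [edgeMeasure_eq_map he hpq, hemb.integral_map, integral_Icc_eq_integral_Ioc,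
    ← intervalIntegral.integral_of_le hL.le]
  have := intervalIntegral.mul_integral_comp_mul_right (a := 0) (b := 1)
    (f := fun s : ℝ => f (p + s • (‖q - p‖⁻¹ • (q - p)))) ‖q - p‖
  rw [zero_mul, one_mul] at this
  rw [← this]
  congr 1
  refine intervalIntegral.integral_congr fun s _ => ?_
  simp only [smul_smul, mul_assoc, mul_inv_cancel₀ hL.ne', mul_one]

instance (e : Finset Plane) : IsFiniteMeasure (triMeasure e) :=
  ⟨by
    rw [triMeasure, Measure.restrict_apply_univ]
    exact (e.finite_toSet.isCompact_convexHull (𝕜 := ℝ)).measure_lt_top⟩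

/-- The determinant of a pair of vectors of the plane. -/
def det2 (u v : Plane) : ℝ := u 0 * v 1 - u 1 * v 0

/-- The linear map that sends the standard basis to `u, v`. -/
def frameMap (u v : Plane) : Plane →L[ℝ] Plane :=
  LinearMap.toContinuousLinearMap
    { toFun := fun x => x 0 • u + x 1 • v
      map_add' := fun x y => by simp [add_smul]; abel
      map_smul' := fun r x => by simp [mul_smul] }

theorem frameMap_apply (u v x : Plane) : frameMap u v x = x 0 • u + x 1 • v := rfl

theorem det_frameMap (u v : Plane) : (frameMap u v).det = det2 u v := by
  rw [ContinuousLinearMap.det, ← LinearMap.det_toMatrix (EuclideanSpace.basisFun (Fin 2) ℝ).toBasis,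
    Matrix.det_fin_two]
  simp [LinearMap.toMatrix_apply, frameMap, det2]
  ring

theorem frameMap_injective {u v : Plane} (h : det2 u v ≠ 0) :
    Function.Injective (frameMap u v) := by
  refine (injective_iff_map_eq_zero _).2 fun x hx => ?_
  have h0 := congrArg (fun y : Plane => y 0) hx
  have h1 := congrArg (fun y : Plane => y 1) hx
  simp [frameMap_apply] at h0 h1
  ext i
  fin_cases i
  · have : x 0 * det2 u v = 0 := by unfold det2; linear_combination v 1 * h0 - v 0 * h1
    simpa [h] using this
  · have : x 1 * det2 u v = 0 := by unfold det2; linear_combination u 0 * h1 - u 1 * h0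
    simpa [h] using this

/-- The reference triangle. -/
def refTri : Set Plane := {x | 0 ≤ x 0 ∧ 0 ≤ x 1 ∧ x 0 + x 1 ≤ 1}

theorem convexHull_triple_eq_image (a b c : Plane) :
    convexHull ℝ {a, b, c} = (fun x => a + frameMap (b - a) (c - a) x) '' refTri := by
  apply Set.Subset.antisymm
  · refine convexHull_min ?_ ?_
    · rintro x (rfl | rfl | rfl)
      · exact ⟨0, by simp [refTri], by simp⟩
      · exact ⟨!₂[1, 0], by simp [refTri], by simp [frameMap_apply]⟩
      · exact ⟨!₂[0, 1], by simp [refTri], by simp [frameMap_apply]⟩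
    · have hconv : Convex ℝ refTri := by
        rintro x ⟨h0, h1, h2⟩ y ⟨k0, k1, k2⟩ α β hα hβ hαβ
        refine ⟨?_, ?_, ?_⟩ <;> simp
        · positivity
        · positivity
        · nlinarith
      have := (hconv.linear_image (frameMap (b - a) (c - a)).toLinearMap).vadd a
      convert this using 1
      rw [← Set.image_vadd, Set.image_image]
      rfl
  · rintro _ ⟨x, ⟨h0, h1, h2⟩, rfl⟩
    have ha : a ∈ convexHull ℝ {a, b, c} := subset_convexHull _ _ (by simp)
    have hb : b ∈ convexHull ℝ {a, b, c} := subset_convexHull _ _ (by simp)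
    have hc : c ∈ convexHull ℝ {a, b, c} := subset_convexHull _ _ (by simp)
    have := (convex_convexHull ℝ {a, b, c}).sum_mem (t := Finset.univ)
      (w := ![1 - x 0 - x 1, x 0, x 1]) (z := ![a, b, c])
      (by intro i _; fin_cases i <;> simp <;> linarith) (by simp [Fin.sum_univ_three]; ring)
      (by intro i _; fin_cases i <;> simpa)
    convert this using 1
    simp [Fin.sum_univ_three, frameMap_apply]
    module

theorem isClosed_refTri : IsClosed refTri :=
  (isClosed_le (f := fun _ : Plane => (0 : ℝ)) (g := fun x : Plane => x 0)
    continuous_const (by fun_prop)).inter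
  ((isClosed_le (f := fun _ : Plane => (0 : ℝ)) (g := fun x : Plane => x 1)
    continuous_const (by fun_prop)).inter
  (isClosed_le (f := fun x : Plane => x 0 + x 1) (g := fun _ : Plane => (1 : ℝ))
    (by fun_prop) continuous_const))

theorem integral_refTri {g : Plane → ℝ} (hg : Continuous g) :
    ∫ x in refTri, g x = ∫ t in (0 : ℝ)..1, ∫ s in (0 : ℝ)..(1 - t), g !₂[s, t] := by
  have hmp : MeasurePreserving (fun z : ℝ × ℝ => (!₂[z.1, z.2] : Plane)) := by
    have h1 := (volume_preserving_finTwoArrow ℝ).symm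
    have h2 := PiLp.volume_preserving_toLp (Fin 2)
    have he : (fun z : ℝ × ℝ => (!₂[z.1, z.2] : Plane))
        = WithLp.toLp 2 ∘ (MeasurableEquiv.finTwoArrow (α := ℝ)).symm := by
      funext z
      ext i
      fin_cases i <;> rfl
    rw [he]
    exact h2.comp h1
  have hemb : MeasurableEmbedding (fun z : ℝ × ℝ => (!₂[z.1, z.2] : Plane)) :=
    (MeasurableEquiv.toLp 2 (Fin 2 → ℝ)).measurableEmbedding.comp
      (MeasurableEquiv.finTwoArrow (α := ℝ)).symm.measurableEmbedding
  rw [← hmp.setIntegral_preimage_emb hemb]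
  set S : Set (ℝ × ℝ) := (fun z : ℝ × ℝ => (!₂[z.1, z.2] : Plane)) ⁻¹' refTri with hS
  have hSm : MeasurableSet S := hmp.measurable isClosed_refTri.measurableSet
  have hmem : ∀ s t : ℝ, (s, t) ∈ S ↔ t ∈ Set.Icc (0 : ℝ) 1 ∧ s ∈ Set.Icc 0 (1 - t) := by
    intro s t
    simp only [hS, refTri, Set.mem_preimage, Set.mem_ofPred_eq, Set.mem_Icc]
    simp
    constructor
    · rintro ⟨h0, h1, h2⟩
      exact ⟨⟨h1, by linarith⟩, h0, by linarith⟩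
    · rintro ⟨⟨h0, h1⟩, h2, h3⟩
      exact ⟨h2, h0, by linarith⟩
  have hg' : Continuous fun z : ℝ × ℝ => g !₂[z.1, z.2] := by
    apply hg.comp
    fun_prop
  have hint : Integrable (S.indicator fun z : ℝ × ℝ => g !₂[z.1, z.2])
      ((volume : Measure ℝ).prod volume) := by
    rw [integrable_indicator_iff hSm]
    refine (hg'.continuousOn.integrableOn_compact
      (isCompact_Icc.prod isCompact_Icc :
        IsCompact (Set.Icc (0 : ℝ) 1 ×ˢ Set.Icc (0 : ℝ) 1))).mono_set ?_
    rintro ⟨s, t⟩ h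
    obtain ⟨⟨h0, h1⟩, h2, h3⟩ := (hmem s t).1 h
    exact ⟨⟨h2, by linarith⟩, h0, h1⟩
  rw [← integral_indicator hSm, Measure.volume_eq_prod, integral_prod_symm _ hint,
    intervalIntegral.integral_of_le zero_le_one, ← integral_Icc_eq_integral_Ioc,
    ← integral_indicator measurableSet_Icc]
  refine integral_congr_ae (ae_of_all _ fun t => ?_)
  by_cases ht : t ∈ Set.Icc (0 : ℝ) 1
  · simp only [Set.indicator_of_mem ht]
    rw [intervalIntegral.integral_of_le (by linarith [ht.2]), ← integral_Icc_eq_integral_Ioc,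
      ← integral_indicator measurableSet_Icc]
    refine integral_congr_ae (ae_of_all _ fun s => ?_)
    by_cases hs : s ∈ Set.Icc 0 (1 - t)
    · simp only [Set.indicator_of_mem hs, Set.indicator_of_mem ((hmem s t).2 ⟨ht, hs⟩)]
    · simp only [Set.indicator_of_notMem hs,
        Set.indicator_of_notMem (fun h => hs ((hmem s t).1 h).2)]
  · simp only [Set.indicator_of_notMem ht,
      Set.indicator_of_notMem (fun h => ht ((hmem _ t).1 h).1), integral_zero]

theorem integral_triangle {t : Finset Plane} {a b c : Plane} (ht : (t : Set Plane) = {a, b, c})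
    (hD : det2 (b - a) (c - a) ≠ 0) {g : Plane → ℝ} (hg : Continuous g) :
    ∫ x, g x ∂(triMeasure t) = |det2 (b - a) (c - a)| *
      ∫ τ in (0 : ℝ)..1, ∫ s in (0 : ℝ)..(1 - τ), g (a + s • (b - a) + τ • (c - a)) := by
  rw [triMeasure, cell, ht, convexHull_triple_eq_image,
    integral_image_eq_integral_abs_det_fderiv_smul volume isClosed_refTri.measurableSet
      (f' := fun _ => frameMap (b - a) (c - a))
      (fun x _ => ((frameMap (b - a) (c - a)).hasFDerivAt.const_add a).hasFDerivWithinAt)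
      (fun x _ y _ h => frameMap_injective hD (add_left_cancel h))]
  simp only [det_frameMap, smul_eq_mul]
  rw [integral_const_mul, integral_refTri (by fun_prop)]
  simp [frameMap_apply, add_assoc]

/-- Green's formula in the direction of the edge from `a` to `b`: the inner integral over the
parameter of this direction is evaluated by the fundamental theorem of calculus. -/
theorem integral_fderiv_triangle {t : Finset Plane} {a b c : Plane}
    (ht : (t : Set Plane) = {a, b, c}) (hD : det2 (b - a) (c - a) ≠ 0)
    {φ : Plane → ℝ} (hφ : ContDiff ℝ 1 φ) :
    ∫ x, fderiv ℝ φ x (b - a) ∂(triMeasure t) = |det2 (b - a) (c - a)| *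
      ((∫ θ in (0 : ℝ)..1, φ (b + θ • (c - b))) - ∫ θ in (0 : ℝ)..1, φ (a + θ • (c - a))) := by
  have hφ' : Continuous fun x => fderiv ℝ φ x (b - a) :=
    (hφ.continuous_fderiv one_ne_zero).clm_apply continuous_const
  have hφc := hφ.continuous
  rw [integral_triangle ht hD hφ', ← intervalIntegral.integral_sub]
  · congr 1
    refine intervalIntegral.integral_congr fun τ _ => ?_
    have hder : ∀ s : ℝ, HasDerivAt (fun s : ℝ => φ (a + s • (b - a) + τ • (c - a)))
        (fderiv ℝ φ (a + s • (b - a) + τ • (c - a)) (b - a)) s := by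
      intro s
      have h1 : HasDerivAt (fun s : ℝ => a + s • (b - a) + τ • (c - a)) (b - a) s := by
        simpa using (((hasDerivAt_id s).smul_const (b - a)).const_add a).add_const (τ • (c - a))
      exact ((hφ.differentiable one_ne_zero _).hasFDerivAt).comp_hasDerivAt s h1
    beta_reduce
    rw [intervalIntegral.integral_eq_sub_of_hasDerivAt (fun s _ => hder s)]
    · congr 2
      · module
      · module
    · exact (Continuous.intervalIntegrable (by fun_prop) _ _)
  · exact (Continuous.intervalIntegrable (by fun_prop) _ _)
  · exact (Continuous.intervalIntegrable (by fun_prop) _ _)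

theorem det2_ne_zero {t : Finset Plane} {a b c : Plane} (ht : (t : Set Plane) = {a, b, c})
    (hab : a ≠ b) (hac : a ≠ c) (hbc : b ≠ c)
    (hind : AffineIndependent ℝ ((↑) : t → Plane)) : det2 (b - a) (c - a) ≠ 0 := by
  intro hD
  have h3 : AffineIndependent ℝ ![a, b, c] := by
    have hmem : ∀ i, ![a, b, c] i ∈ t := by
      intro i
      rw [← Finset.mem_coe, ht]
      fin_cases i <;> simp
    have hinj : Function.Injective (fun i => (⟨![a, b, c] i, hmem i⟩ : t)) := by
      intro i j hij
      have : ![a, b, c] i = ![a, b, c] j := congrArg Subtype.val hij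
      fin_cases i <;> fin_cases j <;> simp_all
    exact hind.comp_embedding ⟨_, hinj⟩
  rw [affineIndependent_iff_not_collinear_set] at h3
  apply h3
  rw [collinear_iff_of_mem (p₀ := a) (by simp)]
  refine ⟨b - a, ?_⟩
  have hN : (b 0 - a 0) ^ 2 + (b 1 - a 1) ^ 2 ≠ 0 := by
    intro h
    apply hab
    ext i
    fin_cases i
    · show a 0 = b 0
      nlinarith [sq_nonneg (b 0 - a 0), sq_nonneg (b 1 - a 1)]
    · show a 1 = b 1
      nlinarith [sq_nonneg (b 0 - a 0), sq_nonneg (b 1 - a 1)]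
  rintro x (rfl | rfl | rfl)
  · exact ⟨0, by simp⟩
  · exact ⟨1, by simp⟩
  · refine ⟨((b 0 - a 0) * (x 0 - a 0) + (b 1 - a 1) * (x 1 - a 1)) /
      ((b 0 - a 0) ^ 2 + (b 1 - a 1) ^ 2), ?_⟩
    simp only [det2, PiLp.sub_apply] at hD
    ext i
    fin_cases i
    · simp
      field_simp
      linear_combination (-(b 1 - a 1)) * hD
    · simp
      field_simp
      linear_combination (b 0 - a 0) * hD

/-- `n` is the outward unit normal of the triangle `t` on its edge `e`. -/
structure IsOutward (t e : Finset Plane) (n : Plane) : Prop where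
  norm_eq : ‖n‖ = 1
  orth : ∀ p ∈ e, ∀ q ∈ e, inner ℝ n (p - q) = 0
  neg : ∀ p ∈ e, ∀ r ∈ t, r ∉ e → inner ℝ n (r - p) < 0

/-- Base times height: if `n` is a unit normal of the base `u`, then `|⟪n, w⟫|` is the height of the
parallelogram spanned by `u` and `w`. -/
theorem abs_inner_mul_norm {n u w : Plane} (hn : ‖n‖ = 1) (hu : inner ℝ n u = 0) :
    |inner ℝ n w| * ‖u‖ = |det2 u w| := by
  have h1 : n 0 ^ 2 + n 1 ^ 2 = 1 := by
    have := EuclideanSpace.real_norm_sq_eq n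
    rw [hn, Fin.sum_univ_two] at this
    linarith
  have h2 : ‖u‖ ^ 2 = u 0 ^ 2 + u 1 ^ 2 := by
    rw [EuclideanSpace.real_norm_sq_eq, Fin.sum_univ_two]
  simp [PiLp.inner_apply, Fin.sum_univ_two] at hu
  have h3 : inner ℝ n w = n 0 * w 0 + n 1 * w 1 := by
    simp [PiLp.inner_apply, Fin.sum_univ_two]; ring
  rw [← abs_norm u, ← abs_mul, ← sq_eq_sq_iff_abs_eq_abs, mul_pow, h2, h3]
  -- `u` is a multiple `k` of the rotated normal
  obtain ⟨k, hk⟩ : ∃ k, k = -(n 1) * u 0 + n 0 * u 1 := ⟨_, rfl⟩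
  have hu0 : u 0 = -k * n 1 := by
    rw [hk]; linear_combination n 0 * hu - u 0 * h1
  have hu1 : u 1 = k * n 0 := by
    rw [hk]; linear_combination n 1 * hu - u 1 * h1
  simp only [det2, hu0, hu1]
  linear_combination k ^ 2 * (n 0 * w 0 + n 1 * w 1) ^ 2 * h1

theorem exists_triangle_vertices {t : Finset Plane} (ht : t.card = 3)
    (hind : AffineIndependent ℝ ((↑) : t → Plane)) {p : Plane} (hp : p ∈ t) :
    ∃ b c : Plane, (t : Set Plane) = {p, b, c} ∧ p ≠ b ∧ p ≠ c ∧ b ≠ c ∧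
      det2 (b - p) (c - p) ≠ 0 := by
  classical
  have h2 : (t.erase p).card = 2 := by rw [Finset.card_erase_of_mem hp, ht]
  obtain ⟨b, c, hbc, h⟩ := Finset.card_eq_two.1 h2
  have hb : b ∈ t.erase p := by simp [h]
  have hc : c ∈ t.erase p := by simp [h]
  have hset : (t : Set Plane) = {p, b, c} := by
    rw [← Finset.insert_erase hp, h]; simp
  have hpb := (Finset.ne_of_mem_erase hb).symm
  have hpc := (Finset.ne_of_mem_erase hc).symm
  exact ⟨b, c, hset, hpb, hpc, hbc, det2_ne_zero hset hpb hpc hbc hind⟩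

/-- The edges of a triangle, listed as opposite to `a`, `b` and `c`. -/
theorem sum_edgesOf {t : Finset Plane} {a b c : Plane} (ht : (t : Set Plane) = {a, b, c})
    (hab : a ≠ b) (hac : a ≠ c) (hbc : b ≠ c) :
    ∃ e₁ e₂ e₃ : Finset Plane, (e₁ : Set Plane) = {b, c} ∧ (e₂ : Set Plane) = {a, c} ∧
      (e₃ : Set Plane) = {a, b} ∧ e₁ ∈ edgesOf t ∧ e₂ ∈ edgesOf t ∧ e₃ ∈ edgesOf t ∧
      ∀ f : Finset Plane → ℝ, ∑ e ∈ edgesOf t, f e = f e₁ + f e₂ + f e₃ := by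
  classical
  have ht' : t = {a, b, c} := by
    apply Finset.coe_injective
    rw [ht]; simp
  have hE : edgesOf t = {{b, c}, {a, c}, {a, b}} := by
    ext e
    rw [edgesOf, Finset.mem_powersetCard, ht']
    constructor
    · rintro ⟨hsub, hcard⟩
      obtain ⟨x, y, hxy, rfl⟩ := Finset.card_eq_two.1 hcard
      have hx : x ∈ ({a, b, c} : Finset Plane) := hsub (by simp)
      have hy : y ∈ ({a, b, c} : Finset Plane) := hsub (by simp)
      simp only [Finset.mem_insert, Finset.mem_singleton] at hx hy ⊢
      rcases hx with rfl | rfl | rfl <;> rcases hy with rfl | rfl | rfl <;>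
        simp_all [Finset.pair_comm]
    · intro h
      simp only [Finset.mem_insert, Finset.mem_singleton] at h
      rcases h with rfl | rfl | rfl
      · exact ⟨by intro x; simp; tauto, Finset.card_pair hbc⟩
      · exact ⟨by intro x; simp; tauto, Finset.card_pair hac⟩
      · exact ⟨by intro x; simp; tauto, Finset.card_pair hab⟩
  have h12 : ({b, c} : Finset Plane) ≠ {a, c} := by
    intro h
    have : a ∈ ({b, c} : Finset Plane) := by rw [h]; simp
    simp [hab, hac] at this
  have h13 : ({b, c} : Finset Plane) ≠ {a, b} := by
    intro h
    have : a ∈ ({b, c} : Finset Plane) := by rw [h]; simp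
    simp [hab, hac] at this
  have h23 : ({a, c} : Finset Plane) ≠ {a, b} := by
    intro h
    have : b ∈ ({a, c} : Finset Plane) := by rw [h]; simp
    simp [hab.symm, hbc] at this
  refine ⟨{b, c}, {a, c}, {a, b}, by simp, by simp, by simp, by simp [hE], by simp [hE],
    by simp [hE], fun f => ?_⟩
  rw [hE, Finset.sum_insert (by simp [h12, h13]), Finset.sum_insert (by simp [h23]),
    Finset.sum_singleton, add_assoc]

theorem det2_sub_sub (a b c : Plane) : det2 (c - b) (a - b) = det2 (b - a) (c - a) := by
  simp [det2]; ring

theorem det2_swap (u v : Plane) : det2 u v = -det2 v u := by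
  simp [det2]; ring

/-- The value of Green's formula on a triangle in the direction `b - a`, with the edge measures. -/
theorem integral_fderiv_edge_direction {t e₁ e₂ e₃ : Finset Plane} {a b c n₁ n₂ n₃ : Plane}
    (ht : (t : Set Plane) = {a, b, c}) (hab : a ≠ b) (hac : a ≠ c) (hbc : b ≠ c)
    (hD : det2 (b - a) (c - a) ≠ 0)
    (h₁ : (e₁ : Set Plane) = {b, c}) (h₂ : (e₂ : Set Plane) = {a, c})
    (h₃ : (e₃ : Set Plane) = {a, b})
    (hn₁ : IsOutward t e₁ n₁) (hn₂ : IsOutward t e₂ n₂) (hn₃ : IsOutward t e₃ n₃)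
    {φ : Plane → ℝ} (hφ : ContDiff ℝ 1 φ) :
    ∫ x, fderiv ℝ φ x (b - a) ∂(triMeasure t) =
      inner ℝ n₁ (b - a) * ∫ x, φ x ∂(edgeMeasure e₁)
      + inner ℝ n₂ (b - a) * ∫ x, φ x ∂(edgeMeasure e₂)
      + inner ℝ n₃ (b - a) * ∫ x, φ x ∂(edgeMeasure e₃) := by
  have ha : a ∈ t := by rw [← Finset.mem_coe, ht]; simp
  have hb : b ∈ t := by rw [← Finset.mem_coe, ht]; simp
  have ha₁ : a ∉ e₁ := by rw [← Finset.mem_coe, h₁]; simp [hab, hac]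
  have hb₁ : b ∈ e₁ := by rw [← Finset.mem_coe, h₁]; simp
  have hc₁ : c ∈ e₁ := by rw [← Finset.mem_coe, h₁]; simp
  have ha₂ : a ∈ e₂ := by rw [← Finset.mem_coe, h₂]; simp
  have hb₂ : b ∉ e₂ := by rw [← Finset.mem_coe, h₂]; simp [hab.symm, hbc]
  have hc₂ : c ∈ e₂ := by rw [← Finset.mem_coe, h₂]; simp
  have ha₃ : a ∈ e₃ := by rw [← Finset.mem_coe, h₃]; simp
  have hb₃ : b ∈ e₃ := by rw [← Finset.mem_coe, h₃]; simp
  have hs₁ : 0 < inner ℝ n₁ (b - a) := by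
    have := hn₁.neg b hb₁ a ha ha₁
    rw [← neg_sub, inner_neg_right] at this
    linarith
  have hs₂ : inner ℝ n₂ (b - a) < 0 := hn₂.neg a ha₂ b hb hb₂
  have hs₃ : inner ℝ n₃ (b - a) = 0 := hn₃.orth b hb₃ a ha₃
  have hk₁ : inner ℝ n₁ (b - a) * ‖c - b‖ = |det2 (b - a) (c - a)| := by
    rw [← abs_of_pos hs₁, abs_inner_mul_norm hn₁.norm_eq (hn₁.orth c hc₁ b hb₁),
      ← det2_sub_sub a b c, ← neg_sub b a]
    simp only [det2, PiLp.neg_apply]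
    rw [← abs_neg]
    congr 1; ring
  have hk₂ : inner ℝ n₂ (b - a) * ‖c - a‖ = -|det2 (b - a) (c - a)| := by
    have := abs_inner_mul_norm (w := b - a) hn₂.norm_eq (hn₂.orth c hc₂ a ha₂)
    rw [abs_of_neg hs₂, det2_swap, abs_neg] at this
    linarith
  rw [integral_fderiv_triangle ht hD hφ, integral_edge h₁ hbc, integral_edge h₂ hac, hs₃,
    zero_mul, add_zero, ← mul_assoc, ← mul_assoc, hk₁, hk₂]
  ring

/-- Green's formula on a triangle, for smooth functions. Both sides are linear in `d`, and the
directions of two edges span the plane. -/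
theorem green_triangle {t : Finset Plane} (ht : t.card = 3)
    (hind : AffineIndependent ℝ ((↑) : t → Plane)) {N : Finset Plane → Plane}
    (hN : ∀ e ∈ edgesOf t, IsOutward t e (N e)) {φ : Plane → ℝ} (hφ : ContDiff ℝ 1 φ)
    (d : Plane) :
    ∫ x, fderiv ℝ φ x d ∂(triMeasure t)
      = ∑ e ∈ edgesOf t, inner ℝ (N e) d * ∫ x, φ x ∂(edgeMeasure e) := by
  obtain ⟨a, ha⟩ : t.Nonempty := Finset.card_pos.1 (by omega)
  obtain ⟨b, c, hset, hab, hac, hbc, hD⟩ := exists_triangle_vertices ht hind ha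
  obtain ⟨e₁, e₂, e₃, h₁, h₂, h₃, m₁, m₂, m₃, hsum⟩ := sum_edgesOf hset hab hac hbc
  have hset' : (t : Set Plane) = {a, c, b} := by rw [hset, Set.pair_comm b c]
  have hb := integral_fderiv_edge_direction hset hab hac hbc hD h₁ h₂ h₃ (hN _ m₁) (hN _ m₂)
    (hN _ m₃) hφ
  have hc := integral_fderiv_edge_direction hset' hac hab hbc.symm
    (by rwa [det2_swap, neg_ne_zero]) (by rw [h₁, Set.pair_comm]) h₃ h₂ (hN _ m₁) (hN _ m₃)
    (hN _ m₂) hφ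
  obtain ⟨α, β, hd⟩ : ∃ α β : ℝ, d = α • (b - a) + β • (c - a) := by
    refine ⟨det2 d (c - a) / det2 (b - a) (c - a), det2 (b - a) d / det2 (b - a) (c - a), ?_⟩
    have e1 : det2 (b - a) (c - a) • d
        = det2 d (c - a) • (b - a) + det2 (b - a) d • (c - a) := by
      ext i
      fin_cases i <;> simp [det2] <;> ring
    rw [div_eq_inv_mul, div_eq_inv_mul, mul_smul, mul_smul, ← smul_add, ← e1, smul_smul,
      inv_mul_cancel₀ hD, one_smul]
  have hi : ∀ v : Plane, Integrable (fun x => fderiv ℝ φ x v) (triMeasure t) := fun v =>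
    (((hφ.continuous_fderiv one_ne_zero).clm_apply
      continuous_const).continuousOn).integrableOn_compact
      (t.finite_toSet.isCompact_convexHull (𝕜 := ℝ))
  rw [hsum, hd]
  simp only [map_add, map_smul, inner_add_right, inner_smul_right, smul_eq_mul]
  rw [integral_add ((hi _).const_mul _) ((hi _).const_mul _), integral_const_mul,
    integral_const_mul, hb, hc]
  ring

/-! ### Square integrable functions -/

theorem abs_integral_le_sqrt_mul_sqrt {α E F : Type*} [MeasurableSpace α] {μ : Measure α}
    [NormedAddCommGroup E] [NormedAddCommGroup F] {f : α → E} {g : α → F} {h : α → ℝ} {K : ℝ}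
    (hK : 0 ≤ K) (hf : MemLp f 2 μ) (hg : MemLp g 2 μ)
    (hfg : ∀ᵐ x ∂μ, |h x| ≤ K * (‖f x‖ * ‖g x‖)) :
    |∫ x, h x ∂μ| ≤ K * (√(∫ x, ‖f x‖ ^ 2 ∂μ) * √(∫ x, ‖g x‖ ^ 2 ∂μ)) := by
  have hint : Integrable (fun x => ‖f x‖ * ‖g x‖) μ := hf.norm.integrable_mul hg.norm
  have h1 : |∫ x, h x ∂μ| ≤ ∫ x, K * (‖f x‖ * ‖g x‖) ∂μ := by
    rw [← Real.norm_eq_abs]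
    exact norm_integral_le_of_norm_le (hint.const_mul K) hfg
  rw [integral_const_mul] at h1
  refine h1.trans (mul_le_mul_of_nonneg_left ?_ hK)
  have := integral_mul_le_Lp_mul_Lq_of_nonneg (μ := μ) (f := fun x => ‖f x‖)
    (g := fun x => ‖g x‖) Real.HolderConjugate.two_two
    (ae_of_all _ fun x => norm_nonneg _) (ae_of_all _ fun x => norm_nonneg _)
    (by simpa using hf.norm) (by simpa using hg.norm)
  simpa [Real.sqrt_eq_rpow] using this

/-- The Cauchy–Schwarz inequality for a sum of integrals, with weights `a i`. -/
theorem abs_sum_integral_le {ι α E F : Type*} [MeasurableSpace α]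
    [NormedAddCommGroup E] [NormedAddCommGroup F] (s : Finset ι) {μ : ι → Measure α}
    {f : ι → α → E} {g : ι → α → F} {h : ι → α → ℝ} {K : ℝ} {a : ι → ℝ} (ha : ∀ i ∈ s, 0 < a i)
    (hK : 0 ≤ K) (hf : ∀ i ∈ s, MemLp (f i) 2 (μ i)) (hg : ∀ i ∈ s, MemLp (g i) 2 (μ i))
    (hfg : ∀ i ∈ s, ∀ᵐ x ∂(μ i), |h i x| ≤ K * (‖f i x‖ * ‖g i x‖)) :
    |∑ i ∈ s, ∫ x, h i x ∂(μ i)|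
      ≤ K * (√(∑ i ∈ s, a i * ∫ x, ‖f i x‖ ^ 2 ∂(μ i))
        * √(∑ i ∈ s, (a i)⁻¹ * ∫ x, ‖g i x‖ ^ 2 ∂(μ i))) := by
  have hF : ∀ i, 0 ≤ ∫ x, ‖f i x‖ ^ 2 ∂(μ i) := fun i => integral_nonneg fun x => by positivity
  have hG : ∀ i, 0 ≤ ∫ x, ‖g i x‖ ^ 2 ∂(μ i) := fun i => integral_nonneg fun x => by positivity
  calc |∑ i ∈ s, ∫ x, h i x ∂(μ i)| ≤ ∑ i ∈ s, |∫ x, h i x ∂(μ i)| :=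
        Finset.abs_sum_le_sum_abs _ _
    _ ≤ ∑ i ∈ s, K * (√(|a i| * ∫ x, ‖f i x‖ ^ 2 ∂(μ i))
          * √(|a i|⁻¹ * ∫ x, ‖g i x‖ ^ 2 ∂(μ i))) := by
        refine Finset.sum_le_sum fun i hi => ?_
        refine (abs_integral_le_sqrt_mul_sqrt hK (hf i hi) (hg i hi) (hfg i hi)).trans_eq ?_
        rw [abs_of_pos (ha i hi), ← Real.sqrt_mul (hF i),
          ← Real.sqrt_mul (mul_nonneg (ha i hi).le (hF i))]
        congr 2
        have := (ha i hi).ne'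
        field_simp
    _ ≤ K * (√(∑ i ∈ s, |a i| * ∫ x, ‖f i x‖ ^ 2 ∂(μ i))
        * √(∑ i ∈ s, |a i|⁻¹ * ∫ x, ‖g i x‖ ^ 2 ∂(μ i))) := by
        rw [← Finset.mul_sum]
        refine mul_le_mul_of_nonneg_left (Real.sum_sqrt_mul_sqrt_le s
          (fun i => mul_nonneg (abs_nonneg _) (hF i))
          fun i => mul_nonneg (inv_nonneg.2 (abs_nonneg _)) (hG i)) hK
    _ = _ := by
        rw [Finset.sum_congr rfl fun i hi => by rw [abs_of_pos (ha i hi)],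
          Finset.sum_congr (f := fun i => |a i|⁻¹ * ∫ x, ‖g i x‖ ^ 2 ∂(μ i)) rfl
            fun i hi => by rw [abs_of_pos (ha i hi)]]

theorem tendsto_integral_mul_of_L2 {α : Type*} [MeasurableSpace α] {μ : Measure α}
    {f g : ℕ → α → ℝ} {F G : α → ℝ} (hf : ∀ n, MemLp (f n) 2 μ) (hg : ∀ n, MemLp (g n) 2 μ)
    (hF : MemLp F 2 μ) (hG : MemLp G 2 μ)
    (hfF : Tendsto (fun n => eLpNorm (fun x => f n x - F x) 2 μ) atTop (𝓝 0))
    (hgG : Tendsto (fun n => eLpNorm (fun x => g n x - G x) 2 μ) atTop (𝓝 0)) :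
    Tendsto (fun n => ∫ x, f n x * g n x ∂μ) atTop (𝓝 (∫ x, F x * G x ∂μ)) := by
  have h1 := (Lp.tendsto_Lp_iff_tendsto_eLpNorm'' f hf F hF).2 hfF
  have h2 := (Lp.tendsto_Lp_iff_tendsto_eLpNorm'' g hg G hG).2 hgG
  have key : ∀ {u v : α → ℝ} (hu : MemLp u 2 μ) (hv : MemLp v 2 μ),
      inner ℝ (hv.toLp v) (hu.toLp u) = ∫ x, u x * v x ∂μ := by
    intro u v hu hv
    rw [L2.inner_def]
    refine integral_congr_ae ?_
    filter_upwards [hu.coeFn_toLp, hv.coeFn_toLp] with x hx hy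
    rw [hx, hy]
    simp
  have := h2.inner h1 (𝕜 := ℝ)
  simpa only [key] using this

theorem tendsto_eLpNorm_of_le_mul {α E F : Type*} [MeasurableSpace α] {μ : Measure α}
    [NormedAddCommGroup E] [NormedAddCommGroup F] {f : ℕ → α → E} {g : ℕ → α → F} {K : ℝ}
    (hfg : ∀ n, ∀ᵐ x ∂μ, ‖f n x‖ ≤ K * ‖g n x‖)
    (hg : Tendsto (fun n => eLpNorm (g n) 2 μ) atTop (𝓝 0)) :
    Tendsto (fun n => eLpNorm (f n) 2 μ) atTop (𝓝 0) := by
  refine tendsto_of_tendsto_of_tendsto_of_le_of_le tendsto_const_nhds ?_ (fun _ => zero_le)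
    (fun n => eLpNorm_le_mul_eLpNorm_of_ae_le_mul (hfg n) 2)
  simpa using ENNReal.Tendsto.const_mul hg (Or.inr ENNReal.ofReal_ne_top)

/-! ### Traces on the boundary of a triangle -/

theorem isCompact_cell (s : Finset Plane) : IsCompact (cell s) :=
  s.finite_toSet.isCompact_convexHull (𝕜 := ℝ)

theorem measurableSet_cell (s : Finset Plane) : MeasurableSet (cell s) :=
  (isCompact_cell s).isClosed.measurableSet

theorem ae_edgeMeasure_mem (e : Finset Plane) : ∀ᵐ x ∂(edgeMeasure e), x ∈ cell e :=
  ae_restrict_mem (measurableSet_cell e)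

theorem ae_triMeasure_mem (t : Finset Plane) : ∀ᵐ x ∂(triMeasure t), x ∈ cell t :=
  ae_restrict_mem (measurableSet_cell t)

theorem isFiniteMeasure_edgeMeasure {e : Finset Plane} (he : e.card = 2) :
    IsFiniteMeasure (edgeMeasure e) := by
  classical
  obtain ⟨p, q, hpq, rfl⟩ := Finset.card_eq_two.1 he
  refine ⟨?_⟩
  rw [edgeMeasure, Measure.restrict_apply_univ, cell, Finset.coe_pair, convexHull_pair,
    hausdorffMeasure_segment]
  exact edist_lt_top _ _

theorem card_of_mem_edgesOf {t e : Finset Plane} (he : e ∈ edgesOf t) : e.card = 2 :=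
  (Finset.mem_powersetCard.1 he).2

theorem subset_of_mem_edgesOf {t e : Finset Plane} (he : e ∈ edgesOf t) : e ⊆ t :=
  (Finset.mem_powersetCard.1 he).1

theorem cell_mono {s t : Finset Plane} (h : s ⊆ t) : cell s ⊆ cell t :=
  convexHull_mono (Finset.coe_subset.2 h)

theorem memLp_restrict_of_continuousOn {E : Type*} [NormedAddCommGroup E] {K : Set Plane}
    {ν : Measure Plane} (hK : IsCompact K) [IsFiniteMeasure (ν.restrict K)] {f : Plane → E}
    (hf : ContinuousOn f K) {p : ℝ≥0∞} : MemLp f p (ν.restrict K) := by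
  obtain ⟨C, hC⟩ := hK.exists_bound_of_continuousOn hf
  refine MemLp.of_bound (hf.aestronglyMeasurable_of_isCompact hK hK.isClosed.measurableSet) C ?_
  filter_upwards [ae_restrict_mem hK.isClosed.measurableSet] with x hx using hC x hx

theorem memLp_triMeasure {E : Type*} [NormedAddCommGroup E] (t : Finset Plane) {f : Plane → E}
    (hf : Continuous f) : MemLp f 2 (triMeasure t) :=
  haveI : IsFiniteMeasure (volume.restrict (cell t)) :=
    inferInstanceAs (IsFiniteMeasure (triMeasure t))
  memLp_restrict_of_continuousOn (isCompact_cell t) hf.continuousOn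

theorem memLp_edgeMeasure {e : Finset Plane} (he : e.card = 2) {f : Plane → ℝ}
    (hf : Continuous f) : MemLp f 2 (edgeMeasure e) :=
  haveI : IsFiniteMeasure ((μH[1] : Measure Plane).restrict (cell e)) :=
    isFiniteMeasure_edgeMeasure he
  memLp_restrict_of_continuousOn (isCompact_cell e) hf.continuousOn

theorem continuous_gradient {φ : Plane → ℝ} (hφ : ContDiff ℝ ∞ φ) : Continuous (gradient φ) :=
  (InnerProductSpace.toDual ℝ Plane).symm.continuous.comp (hφ.continuous_fderiv (by simp))

theorem inner_gradient (φ : Plane → ℝ) (x d : Plane) :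
    inner ℝ (gradient φ x) d = fderiv ℝ φ x d := by
  simp [gradient]

theorem inner_gradient' (φ : Plane → ℝ) (x d : Plane) :
    inner ℝ d (gradient φ x) = fderiv ℝ φ x d := by
  rw [real_inner_comm, inner_gradient]

/-- `u` has the gradient `G` on `t` and the boundary values `q` on the edges of `t`, all of them
square integrable, in the sense of approximation by smooth functions. -/
structure HasTraceGrad (t : Finset Plane) (u : Plane → ℝ) (G : Plane → Plane)
    (q : Plane → ℝ) : Prop where
  memLp : MemLp u 2 (triMeasure t)
  memLp_grad : MemLp G 2 (triMeasure t)
  memLp_trace : ∀ e ∈ edgesOf t, MemLp q 2 (edgeMeasure e)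
  exists_approx : ∃ φ : ℕ → Plane → ℝ, (∀ n, ContDiff ℝ ∞ (φ n)) ∧
      Tendsto (fun n => eLpNorm (fun x => φ n x - u x) 2 (triMeasure t)) atTop (𝓝 0) ∧
      Tendsto (fun n => eLpNorm (fun x => gradient (φ n) x - G x) 2 (triMeasure t))
        atTop (𝓝 0) ∧
      ∀ e ∈ edgesOf t,
        Tendsto (fun n => eLpNorm (fun x => φ n x - q x) 2 (edgeMeasure e)) atTop (𝓝 0)

theorem HasTraceGrad.sub {t : Finset Plane} {u u' : Plane → ℝ} {G G' : Plane → Plane}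
    {q q' : Plane → ℝ} (h : HasTraceGrad t u G q) (h' : HasTraceGrad t u' G' q') :
    HasTraceGrad t (fun x => u x - u' x) (fun x => G x - G' x) (fun x => q x - q' x) := by
  obtain ⟨φ, hφ, h1, h2, h3⟩ := h.exists_approx
  obtain ⟨φ', hφ', h1', h2', h3'⟩ := h'.exists_approx
  have key : ∀ {E : Type} [NormedAddCommGroup E] {μ : Measure Plane} {f f' : ℕ → Plane → E}
      {F F' : Plane → E}, (∀ n, AEStronglyMeasurable (fun x => f n x - F x) μ) →
      (∀ n, AEStronglyMeasurable (fun x => f' n x - F' x) μ) →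
      Tendsto (fun n => eLpNorm (fun x => f n x - F x) 2 μ) atTop (𝓝 0) →
      Tendsto (fun n => eLpNorm (fun x => f' n x - F' x) 2 μ) atTop (𝓝 0) →
      Tendsto (fun n => eLpNorm (fun x => f n x - f' n x - (F x - F' x)) 2 μ) atTop (𝓝 0) := by
    intro E _ μ f f' F F' hm hm' ht ht'
    refine tendsto_of_tendsto_of_tendsto_of_le_of_le tendsto_const_nhds
      (by simpa using ht.add ht') (fun _ => zero_le) (fun n => ?_)
    refine le_trans (le_of_eq ?_) (eLpNorm_sub_le (hm n) (hm' n) (by norm_num))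
    congr 1
    funext x
    simp only [Pi.sub_apply]
    abel
  have cφ := fun n => (hφ n).continuous
  have cφ' := fun n => (hφ' n).continuous
  refine ⟨h.memLp.sub h'.memLp, h.memLp_grad.sub h'.memLp_grad,
    fun e he => (h.memLp_trace e he).sub (h'.memLp_trace e he),
    fun n x => φ n x - φ' n x, fun n => (hφ n).sub (hφ' n), ?_, ?_, fun e he => ?_⟩
  · exact key (fun n => (cφ n).aestronglyMeasurable.sub h.memLp.1)
      (fun n => (cφ' n).aestronglyMeasurable.sub h'.memLp.1) h1 h1'
  · have hg : ∀ n x, gradient (fun x => φ n x - φ' n x) x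
        = gradient (φ n) x - gradient (φ' n) x := by
      intro n x
      rw [gradient, gradient, gradient, ← map_sub]
      congr 1
      exact fderiv_sub ((hφ n).differentiable (by simp) x) ((hφ' n).differentiable (by simp) x)
    simp only [hg]
    exact key (fun n => (continuous_gradient (hφ n)).aestronglyMeasurable.sub h.memLp_grad.1)
      (fun n => (continuous_gradient (hφ' n)).aestronglyMeasurable.sub h'.memLp_grad.1) h2 h2'
  · exact key (fun n => (cφ n).aestronglyMeasurable.sub (h.memLp_trace e he).1)
      (fun n => (cφ' n).aestronglyMeasurable.sub (h'.memLp_trace e he).1) (h3 e he) (h3' e he)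

/-- Green's formula for `g u ^ 2`, where `g` is smooth and `u` is a Sobolev function with a
square integrable trace. -/
theorem HasTraceGrad.green {t : Finset Plane} (ht : t.card = 3)
    (hind : AffineIndependent ℝ ((↑) : t → Plane)) {N : Finset Plane → Plane}
    (hN : ∀ e ∈ edgesOf t, IsOutward t e (N e)) {u : Plane → ℝ} {G : Plane → Plane}
    {q : Plane → ℝ} (h : HasTraceGrad t u G q) {g : Plane → ℝ} (hg : ContDiff ℝ ∞ g)
    (d : Plane) :
    ∫ x, fderiv ℝ g x d * u x * u x ∂(triMeasure t)
        + ∫ x, 2 * g x * u x * inner ℝ (G x) d ∂(triMeasure t)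
      = ∑ e ∈ edgesOf t, inner ℝ (N e) d * ∫ x, g x * q x * q x ∂(edgeMeasure e) := by
  obtain ⟨φ, hφ, h1, h2, h3⟩ := h.exists_approx
  have cφ := fun n => (hφ n).continuous
  have hmul : ∀ {B : Plane → ℝ} {s : Finset Plane} {μ : Measure Plane} (hB : Continuous B)
      (hμ : ∀ᵐ x ∂μ, x ∈ cell s) {f : ℕ → Plane → ℝ} {F : Plane → ℝ},
      Tendsto (fun n => eLpNorm (fun x => f n x - F x) 2 μ) atTop (𝓝 0) →
      Tendsto (fun n => eLpNorm (fun x => B x * f n x - B x * F x) 2 μ) atTop (𝓝 0) := by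
    intro B s μ hB hμ f F ht
    obtain ⟨C, hC⟩ := (isCompact_cell s).exists_bound_of_continuousOn hB.continuousOn
    refine tendsto_eLpNorm_of_le_mul (K := C) (fun n => ?_) ht
    filter_upwards [hμ] with x hx
    rw [← mul_sub, norm_mul]
    exact mul_le_mul_of_nonneg_right (hC x hx) (norm_nonneg _)
  have hmulL : ∀ {B : Plane → ℝ} {s : Finset Plane} {μ : Measure Plane} (hB : Continuous B)
      (hμ : ∀ᵐ x ∂μ, x ∈ cell s) {F : Plane → ℝ},
      MemLp F 2 μ → MemLp (fun x => B x * F x) 2 μ := by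
    intro B s μ hB hμ F hF
    obtain ⟨C, hC⟩ := (isCompact_cell s).exists_bound_of_continuousOn hB.continuousOn
    refine hF.of_le_mul (c := C) (hB.aestronglyMeasurable.mul hF.1) ?_
    filter_upwards [hμ] with x hx
    rw [norm_mul]
    exact mul_le_mul_of_nonneg_right (hC x hx) (norm_nonneg _)
  have hg' : Continuous fun x => fderiv ℝ g x d :=
    (hg.continuous_fderiv (by simp)).clm_apply continuous_const
  have hg2 : Continuous fun x => 2 * g x := continuous_const.mul hg.continuous
  have mt := ae_triMeasure_mem t
  have mφ := fun n => memLp_triMeasure t (cφ n)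
  have hGd : MemLp (fun x => inner ℝ (G x) d) 2 (triMeasure t) := h.memLp_grad.inner_const d
  have mGφ := fun n => memLp_triMeasure t (f := fun x => inner ℝ (gradient (φ n) x) d)
    ((continuous_gradient (hφ n)).inner continuous_const)
  have hGt : Tendsto (fun n => eLpNorm (fun x => inner ℝ (gradient (φ n) x) d - inner ℝ (G x) d) 2
      (triMeasure t)) atTop (𝓝 0) := by
    refine tendsto_eLpNorm_of_le_mul (K := ‖d‖) (fun n => ae_of_all _ fun x => ?_) h2
    rw [← inner_sub_left, mul_comm]
    exact norm_inner_le_norm _ _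
  have T1 := tendsto_integral_mul_of_L2 (fun n => hmulL hg' mt (mφ n)) mφ (hmulL hg' mt h.memLp)
    h.memLp (hmul hg' mt h1) h1
  have T2 := tendsto_integral_mul_of_L2 (fun n => hmulL hg2 mt (mφ n)) mGφ (hmulL hg2 mt h.memLp)
    hGd (hmul hg2 mt h1) hGt
  have T3 : Tendsto (fun n => ∑ e ∈ edgesOf t,
      inner ℝ (N e) d * ∫ x, g x * φ n x * φ n x ∂(edgeMeasure e)) atTop
      (𝓝 (∑ e ∈ edgesOf t, inner ℝ (N e) d * ∫ x, g x * q x * q x ∂(edgeMeasure e))) := by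
    refine tendsto_finsetSum _ fun e he => Tendsto.const_mul _ ?_
    have mφe := fun n => memLp_edgeMeasure (card_of_mem_edgesOf he) (cφ n)
    have me := ae_edgeMeasure_mem e
    exact tendsto_integral_mul_of_L2 (fun n => hmulL hg.continuous me (mφe n)) mφe
      (hmulL hg.continuous me (h.memLp_trace e he)) (h.memLp_trace e he)
      (hmul hg.continuous me (h3 e he)) (h3 e he)
  refine tendsto_nhds_unique (T1.add T2) (T3.congr fun n => ?_)
  have hsm : ContDiff ℝ ∞ (fun x => g x * φ n x * φ n x) := (hg.mul (hφ n)).mul (hφ n)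
  have := green_triangle ht hind hN (hsm.of_le (by simp)) d
  have I1 : Integrable (fun x => fderiv ℝ g x d * φ n x * φ n x) (triMeasure t) :=
    (hmulL hg' mt (mφ n)).integrable_mul (mφ n)
  have I2 : Integrable (fun x => 2 * g x * φ n x * inner ℝ (gradient (φ n) x) d) (triMeasure t) :=
    (hmulL hg2 mt (mφ n)).integrable_mul (mGφ n)
  rw [← this, ← integral_add I1 I2]
  refine integral_congr_ae (ae_of_all _ fun x => ?_)
  have dg := (hg.differentiable (by simp) x).hasFDerivAt
  have dφ := ((hφ n).differentiable (by simp) x).hasFDerivAt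
  have := ((dg.mul dφ).mul dφ).fderiv
  beta_reduce
  rw [show (fun x => g x * φ n x * φ n x) = (g * φ n) * φ n from rfl, this, inner_gradient]
  simp
  ring

/-! ### The trace inequality -/

theorem IsOutward.inner_eq_zero {t e : Finset Plane} {n : Plane} (h : IsOutward t e n)
    {p x : Plane} (hp : p ∈ e) (hx : x ∈ cell e) : inner ℝ n (x - p) = 0 := by
  have hsub : cell e ⊆ {x | inner ℝ n (x - p) = 0} := by
    refine convexHull_min (fun r hr => h.orth r hr p hp) ?_
    intro y hy z hz α β _ _ hαβ
    have : α • y + β • z - p = α • (y - p) + β • (z - p) := by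
      rw [smul_sub, smul_sub, sub_add_sub_comm, ← add_smul, hαβ, one_smul]
    rw [Set.mem_ofPred_eq] at hy hz ⊢
    rw [this, inner_add_right, inner_smul_right, inner_smul_right, hy, hz]
    simp
  exact hsub hx

theorem IsOutward.inner_nonpos {t e : Finset Plane} {n : Plane} (h : IsOutward t e n)
    {p x : Plane} (hp : p ∈ e) (hx : x ∈ cell t) : inner ℝ n (x - p) ≤ 0 := by
  have hsub : cell t ⊆ {x | inner ℝ n (x - p) ≤ 0} := by
    refine convexHull_min (fun r hr => ?_) ?_
    · by_cases hre : r ∈ e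
      · exact (h.orth r hre p hp).le
      · exact (h.neg p hp r hr hre).le
    · intro y hy z hz α β hα hβ hαβ
      have : α • y + β • z - p = α • (y - p) + β • (z - p) := by
        rw [smul_sub, smul_sub, sub_add_sub_comm, ← add_smul, hαβ, one_smul]
      rw [Set.mem_ofPred_eq] at hy hz ⊢
      rw [this, inner_add_right, inner_smul_right, inner_smul_right]
      exact add_nonpos (mul_nonpos_of_nonneg_of_nonpos hα hy)
        (mul_nonpos_of_nonneg_of_nonpos hβ hz)
  exact hsub hx

theorem IsOutward.notMem_interior {t e : Finset Plane} {n : Plane} (h : IsOutward t e n)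
    {x : Plane} (hx : x ∈ cell e) : x ∉ interior (cell t) := by
  intro hxi
  obtain ⟨p, hp⟩ : e.Nonempty := by
    rw [← Finset.coe_nonempty, ← convexHull_nonempty_iff (𝕜 := ℝ)]
    exact ⟨x, hx⟩
  obtain ⟨ε, hε, hball⟩ := Metric.isOpen_iff.1 isOpen_interior x hxi
  have hmem : x + (ε / 2) • n ∈ cell t := by
    apply interior_subset
    apply hball
    rw [Metric.mem_ball, dist_self_add_left, norm_smul, h.norm_eq, mul_one, Real.norm_eq_abs,
      abs_of_pos (by linarith)]
    linarith
  have h1 := h.inner_nonpos hp hmem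
  rw [add_sub_right_comm, inner_add_right, inner_smul_right, h.inner_eq_zero hp hx,
    real_inner_self_eq_norm_sq, h.norm_eq] at h1
  linarith

/-- The opposite vertex `p` of an edge `e` of a triangle lies on the other two edges. -/
theorem exists_opposite {t e : Finset Plane} (ht : t.card = 3) (he : e ∈ edgesOf t) :
    ∃ p ∈ t, p ∉ e ∧ (∀ r ∈ t, r = p ∨ r ∈ e) ∧ ∀ e' ∈ edgesOf t, e' ≠ e → p ∈ e' := by
  classical
  have hsub := subset_of_mem_edgesOf he
  have hcard := card_of_mem_edgesOf he
  have h1 : (t \ e).card = 1 := by rw [Finset.card_sdiff_of_subset hsub]; omega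
  obtain ⟨p, hp⟩ := Finset.card_eq_one.1 h1
  have hpm : p ∈ t \ e := by simp [hp]
  rw [Finset.mem_sdiff] at hpm
  have hcase : ∀ r ∈ t, r = p ∨ r ∈ e := by
    intro r hr
    by_cases hre : r ∈ e
    · exact Or.inr hre
    · have : r ∈ t \ e := Finset.mem_sdiff.2 ⟨hr, hre⟩
      rw [hp, Finset.mem_singleton] at this
      exact Or.inl this
  refine ⟨p, hpm.1, hpm.2, hcase, fun e' he' hne => ?_⟩
  by_contra hpe
  apply hne
  refine Finset.eq_of_subset_of_card_le (fun r hr => ?_)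
    (by rw [hcard, card_of_mem_edgesOf he'])
  rcases hcase r (subset_of_mem_edgesOf he' hr) with rfl | h
  · exact absurd hr hpe
  · exact h

/-- The height of a triangle over an edge is at least the diameter of an inscribed disc. -/
theorem two_mul_radius_le_height {t e : Finset Plane} {n p p₀ z : Plane} {r : ℝ}
    (hn : IsOutward t e n) (hp : p ∈ t) (hpe : p ∉ e) (hcase : ∀ r ∈ t, r = p ∨ r ∈ e)
    (hp₀ : p₀ ∈ e) (hball : Metric.ball z r ⊆ cell t) :
    2 * r ≤ inner ℝ n (p₀ - p) := by
  have hH : 0 < inner ℝ n (p₀ - p) := by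
    have := hn.neg p₀ hp₀ p hp hpe
    rw [← neg_sub, inner_neg_right] at this
    linarith
  -- the triangle lies in a strip whose width is the height, and so does the disc
  have hsub : cell t ⊆ {x | 0 ≤ inner ℝ n (x - p) ∧ inner ℝ n (x - p) ≤ inner ℝ n (p₀ - p)} := by
    refine convexHull_min (fun x hx => ?_) ?_
    · rcases hcase x hx with rfl | hxe
      · simpa using hH.le
      · have : inner ℝ n (x - p) = inner ℝ n (p₀ - p) := by
          have := hn.orth x hxe p₀ hp₀
          rw [← sub_sub_sub_cancel_right x p₀ p, inner_sub_right] at this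
          linarith
        rw [Set.mem_ofPred_eq, this]
        exact ⟨hH.le, le_rfl⟩
    · intro x hx y hy α β hα hβ hαβ
      have : α • x + β • y - p = α • (x - p) + β • (y - p) := by
        rw [smul_sub, smul_sub, sub_add_sub_comm, ← add_smul, hαβ, one_smul]
      rw [Set.mem_ofPred_eq] at hx hy ⊢
      rw [this, inner_add_right, inner_smul_right, inner_smul_right]
      refine ⟨add_nonneg (mul_nonneg hα hx.1) (mul_nonneg hβ hy.1), ?_⟩
      calc α * inner ℝ n (x - p) + β * inner ℝ n (y - p)
          ≤ α * inner ℝ n (p₀ - p) + β * inner ℝ n (p₀ - p) :=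
            add_le_add (mul_le_mul_of_nonneg_left hx.2 hα) (mul_le_mul_of_nonneg_left hy.2 hβ)
        _ = inner ℝ n (p₀ - p) := by rw [← add_mul, hαβ, one_mul]
  refine le_of_forall_lt_imp_le_of_dense fun s hs => ?_
  rcases le_or_gt s 0 with hs0 | hs0
  · linarith
  have hmem : ∀ ε : ℝ, |ε| = s / 2 → z + ε • n ∈ cell t := by
    intro ε hε
    apply hball
    rw [Metric.mem_ball, dist_self_add_left, norm_smul, hn.norm_eq, mul_one, Real.norm_eq_abs, hε]
    linarith
  have h1 := (hsub (hmem (s / 2) (abs_of_pos (by linarith)))).2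
  have h2 := (hsub (hmem (-(s / 2)) (by rw [abs_neg, abs_of_pos (by linarith)]))).1
  have e1 : ∀ ε : ℝ, inner ℝ n (z + ε • n - p) = inner ℝ n (z - p) + ε := by
    intro ε
    rw [add_sub_right_comm, inner_add_right, inner_smul_right, real_inner_self_eq_norm_sq,
      hn.norm_eq]
    ring
  rw [e1] at h1 h2
  linarith

/-- Green's formula for the radial field `x - p` that starts at a vertex `p`: only the edge
opposite to `p` contributes. -/
theorem HasTraceGrad.green_radial {t : Finset Plane} (ht : t.card = 3)
    (hind : AffineIndependent ℝ ((↑) : t → Plane)) {N : Finset Plane → Plane}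
    (hN : ∀ e ∈ edgesOf t, IsOutward t e (N e)) {u : Plane → ℝ} {G : Plane → Plane}
    {q : Plane → ℝ} (h : HasTraceGrad t u G q) {e : Finset Plane} (he : e ∈ edgesOf t)
    {p p₀ : Plane} (hp₀ : p₀ ∈ e) (hopp : ∀ e' ∈ edgesOf t, e' ≠ e → p ∈ e') :
    ∫ x, (2 * u x ^ 2 + 2 * u x * inner ℝ (G x) (x - p)) ∂(triMeasure t)
      = inner ℝ (N e) (p₀ - p) * ∫ x, q x ^ 2 ∂(edgeMeasure e) := by
  have hg : ∀ i : Fin 2, ContDiff ℝ ∞ (fun x : Plane => x i - p i) := fun i => by fun_prop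
  have hGi := fun i => h.green ht hind hN (hg i) (EuclideanSpace.single i (1 : ℝ))
  have hf : ∀ (i : Fin 2) (x : Plane),
      fderiv ℝ (fun x : Plane => x i - p i) x (EuclideanSpace.single i (1 : ℝ)) = 1 := by
    intro i x
    have : HasFDerivAt (fun x : Plane => x i - p i) (EuclideanSpace.proj i : Plane →L[ℝ] ℝ) x :=
      (EuclideanSpace.proj i : Plane →L[ℝ] ℝ).hasFDerivAt.sub_const _
    rw [this.fderiv]
    simp
  have hmulL : ∀ {s : Finset Plane} {μ : Measure Plane} (hμ : ∀ᵐ x ∂μ, x ∈ cell s) (i : Fin 2)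
      {F : Plane → ℝ}, MemLp F 2 μ → MemLp (fun x => (x i - p i) * F x) 2 μ := by
    intro s μ hμ i F hF
    obtain ⟨C, hC⟩ := (isCompact_cell s).exists_bound_of_continuousOn (hg i).continuous.continuousOn
    refine hF.of_le_mul (c := C) ((hg i).continuous.aestronglyMeasurable.mul hF.1) ?_
    filter_upwards [hμ] with x hx
    rw [norm_mul]
    exact mul_le_mul_of_nonneg_right (hC x hx) (norm_nonneg _)
  have I1 : Integrable (fun x => u x * u x) (triMeasure t) := h.memLp.integrable_mul h.memLp
  have I2 : ∀ i, Integrable (fun x => 2 * (x i - p i) * u x * inner ℝ (G x)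
      (EuclideanSpace.single i (1 : ℝ))) (triMeasure t) := by
    intro i
    have := ((hmulL (ae_triMeasure_mem t) i h.memLp).integrable_mul
      (h.memLp_grad.inner_const (𝕜 := ℝ) (EuclideanSpace.single i (1 : ℝ)))).const_mul 2
    refine this.congr (ae_of_all _ fun x => ?_)
    simp only [Pi.mul_apply]
    ring
  have I3 : ∀ e' ∈ edgesOf t, ∀ i, Integrable (fun x => (x i - p i) * q x * q x)
      (edgeMeasure e') := fun e' he' i =>
    (hmulL (ae_edgeMeasure_mem e') i (h.memLp_trace e' he')).integrable_mul (h.memLp_trace e' he')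
  have hsum : ∑ i : Fin 2, ∑ e' ∈ edgesOf t, inner ℝ (N e') (EuclideanSpace.single i (1 : ℝ))
        * ∫ x, (x i - p i) * q x * q x ∂(edgeMeasure e')
      = inner ℝ (N e) (p₀ - p) * ∫ x, q x ^ 2 ∂(edgeMeasure e) := by
    rw [Finset.sum_comm]
    have hedge : ∀ e' ∈ edgesOf t, ∑ i : Fin 2, inner ℝ (N e') (EuclideanSpace.single i (1 : ℝ))
        * ∫ x, (x i - p i) * q x * q x ∂(edgeMeasure e')
        = ∫ x, inner ℝ (N e') (x - p) * q x ^ 2 ∂(edgeMeasure e') := by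
      intro e' he'
      simp only [← integral_const_mul]
      rw [← integral_finsetSum _ fun i _ => (I3 e' he' i).const_mul _]
      refine integral_congr_ae (ae_of_all _ fun x => ?_)
      simp [Fin.sum_univ_two, PiLp.inner_apply]
      ring
    rw [Finset.sum_congr rfl hedge, Finset.sum_eq_single e]
    · rw [← integral_const_mul]
      refine integral_congr_ae ?_
      filter_upwards [ae_edgeMeasure_mem e] with x hx
      have := (hN e he).inner_eq_zero hp₀ hx
      rw [← sub_add_sub_cancel x p₀ p, inner_add_right, this, zero_add]
    · intro e' he' hne
      rw [integral_congr_ae (g := fun _ => 0), integral_zero]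
      filter_upwards [ae_edgeMeasure_mem e'] with x hx
      rw [(hN e' he').inner_eq_zero (hopp e' he' hne) hx, zero_mul]
    · exact fun h' => absurd he h'
  rw [← hsum, ← Finset.sum_congr rfl fun i _ => hGi i]
  simp only [hf, one_mul]
  rw [Finset.sum_add_distrib, ← integral_finsetSum _ fun i _ => I2 i,
    ← integral_finsetSum _ fun i _ => I1, ← integral_add (integrable_finsetSum _ fun i _ => I1)
      (integrable_finsetSum _ fun i _ => I2 i)]
  refine integral_congr_ae (ae_of_all _ fun x => ?_)
  simp [Fin.sum_univ_two, PiLp.inner_apply]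
  ring

theorem norm_sub_le_size {t : Finset Plane} {x y : Plane} (hx : x ∈ cell t) (hy : y ∈ cell t) :
    ‖x - y‖ ≤ size t := by
  rw [← dist_eq_norm]
  exact Metric.dist_le_diam_of_mem (isCompact_cell t).isBounded hx hy

theorem size_mono {e t : Finset Plane} (h : e ⊆ t) : size e ≤ size t :=
  Metric.diam_mono (cell_mono h) (isCompact_cell t).isBounded

theorem size_pos {e : Finset Plane} (he : e.card = 2) : 0 < size e := by
  classical
  obtain ⟨p, q, hpq, rfl⟩ := Finset.card_eq_two.1 he
  refine lt_of_lt_of_le (norm_pos_iff.2 (sub_ne_zero.2 hpq))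
    (norm_sub_le_size (subset_convexHull ℝ _ (by simp)) (subset_convexHull ℝ _ (by simp)))

/-- The scaled trace inequality on a triangle: in Green's formula for the radial field from the
opposite vertex, the boundary factor is the height over `e`, which is at least `2 r`. -/
theorem HasTraceGrad.trace_inequality {t : Finset Plane} (ht : t.card = 3)
    (hind : AffineIndependent ℝ ((↑) : t → Plane)) {N : Finset Plane → Plane}
    (hN : ∀ e ∈ edgesOf t, IsOutward t e (N e)) {u : Plane → ℝ} {G : Plane → Plane}
    {q : Plane → ℝ} (h : HasTraceGrad t u G q) {e : Finset Plane} (he : e ∈ edgesOf t)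
    {z : Plane} {r κ : ℝ} (hκ : 0 ≤ κ) (hball : Metric.ball z r ⊆ cell t)
    (hsize : size t ≤ κ * (2 * r)) :
    size t * ∫ x, q x ^ 2 ∂(edgeMeasure e)
      ≤ κ * (3 * ∫ x, u x ^ 2 ∂(triMeasure t)
        + size t ^ 2 * ∫ x, ‖G x‖ ^ 2 ∂(triMeasure t)) := by
  obtain ⟨p, hp, hpe, hcase, hopp⟩ := exists_opposite ht he
  obtain ⟨p₀, hp₀⟩ : e.Nonempty := Finset.card_pos.1 (by rw [card_of_mem_edgesOf he]; norm_num)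
  have hH := two_mul_radius_le_height (hN e he) hp hpe hcase hp₀ hball
  have hI : 0 ≤ ∫ x, q x ^ 2 ∂(edgeMeasure e) := integral_nonneg fun x => sq_nonneg _
  have I1 : Integrable (fun x => 3 * u x ^ 2) (triMeasure t) := h.memLp.integrable_sq.const_mul 3
  have I2 : Integrable (fun x => size t ^ 2 * ‖G x‖ ^ 2) (triMeasure t) :=
    ((memLp_two_iff_integrable_sq_norm h.memLp_grad.1).1 h.memLp_grad).const_mul _
  calc size t * ∫ x, q x ^ 2 ∂(edgeMeasure e)
      ≤ κ * (2 * r) * ∫ x, q x ^ 2 ∂(edgeMeasure e) := mul_le_mul_of_nonneg_right hsize hI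
    _ = κ * (2 * r * ∫ x, q x ^ 2 ∂(edgeMeasure e)) := by ring
    _ ≤ κ * (inner ℝ (N e) (p₀ - p) * ∫ x, q x ^ 2 ∂(edgeMeasure e)) :=
        mul_le_mul_of_nonneg_left (mul_le_mul_of_nonneg_right hH hI) hκ
    _ ≤ _ := by
        refine mul_le_mul_of_nonneg_left ?_ hκ
        rw [← h.green_radial ht hind hN he hp₀ hopp, ← integral_const_mul, ← integral_const_mul,
          ← integral_add I1 I2]
        refine (Real.le_norm_self _).trans (norm_integral_le_of_norm_le
          (g := fun x => 3 * u x ^ 2 + size t ^ 2 * ‖G x‖ ^ 2) (I1.add I2) ?_)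
        filter_upwards [ae_triMeasure_mem t] with x hx
        have h1 : |inner ℝ (G x) (x - p)| ≤ ‖G x‖ * size t :=
          (abs_real_inner_le_norm _ _).trans (mul_le_mul_of_nonneg_left
            (norm_sub_le_size hx (subset_convexHull ℝ _ hp)) (norm_nonneg _))
        have h2 : |u x| * |inner ℝ (G x) (x - p)| ≤ |u x| * (‖G x‖ * size t) :=
          mul_le_mul_of_nonneg_left h1 (abs_nonneg _)
        rw [Real.norm_eq_abs]
        calc |2 * u x ^ 2 + 2 * u x * inner ℝ (G x) (x - p)|
            ≤ |2 * u x ^ 2| + |2 * u x * inner ℝ (G x) (x - p)| := abs_add_le _ _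
          _ = 2 * u x ^ 2 + 2 * (|u x| * |inner ℝ (G x) (x - p)|) := by
              rw [abs_of_nonneg (by positivity), abs_mul, abs_mul, abs_two, mul_assoc]
          _ ≤ 3 * u x ^ 2 + size t ^ 2 * ‖G x‖ ^ 2 := by
              nlinarith [sq_nonneg (|u x| - ‖G x‖ * size t), sq_abs (u x)]

/-- The trace of a Sobolev function on the boundary of a triangle is unique: for the difference,
which vanishes on the triangle, the left side of the radial Green formula is zero. -/
theorem HasTraceGrad.trace_unique {t : Finset Plane} (ht : t.card = 3)
    (hind : AffineIndependent ℝ ((↑) : t → Plane)) {N : Finset Plane → Plane}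
    (hN : ∀ e ∈ edgesOf t, IsOutward t e (N e)) {u u' : Plane → ℝ} {G G' : Plane → Plane}
    {q q' : Plane → ℝ} (h : HasTraceGrad t u G q) (h' : HasTraceGrad t u' G' q')
    (hu : u =ᵐ[triMeasure t] u') {e : Finset Plane} (he : e ∈ edgesOf t) :
    q =ᵐ[edgeMeasure e] q' := by
  obtain ⟨p, hp, hpe, -, hopp⟩ := exists_opposite ht he
  obtain ⟨p₀, hp₀⟩ : e.Nonempty := Finset.card_pos.1 (by rw [card_of_mem_edgesOf he]; norm_num)
  have hH : 0 < inner ℝ (N e) (p₀ - p) := by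
    have := (hN e he).neg p₀ hp₀ p hp hpe
    rw [← neg_sub, inner_neg_right] at this
    linarith
  have key := (h.sub h').green_radial ht hind hN he hp₀ hopp
  rw [integral_congr_ae (g := fun _ => 0), integral_zero] at key
  · have h0 : ∫ x, (q x - q' x) ^ 2 ∂(edgeMeasure e) = 0 := by
      rcases mul_eq_zero.1 key.symm with h0 | h0
      · exact absurd h0 hH.ne'
      · exact h0
    rw [integral_eq_zero_iff_of_nonneg (f := fun x => (q x - q' x) ^ 2) (fun x => sq_nonneg _)
      ((h.memLp_trace e he).sub (h'.memLp_trace e he)).integrable_sq] at h0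
    filter_upwards [h0] with x hx
    exact sub_eq_zero.1 (pow_eq_zero_iff two_ne_zero |>.1 hx)
  · filter_upwards [hu] with x hx
    simp [hx]

/-! ### Weak gradients -/

theorem IsTestFunction.integrable_smul {E : Type*} [NormedAddCommGroup E] [NormedSpace ℝ E]
    {U : Set Plane} {φ : Plane → ℝ} (hφ : IsTestFunction U φ) {G : Plane → E}
    (hG : LocallyIntegrableOn G U) : IntegrableOn (fun x => φ x • G x) U := by
  have hc := hφ.2.1.isCompact
  have h1 : IntegrableOn G (tsupport φ) := hG.integrableOn_compact_subset hφ.2.2 hc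
  have h2 : IntegrableOn (fun x => φ x • G x) (tsupport φ) :=
    h1.continuousOn_smul hφ.1.continuous.continuousOn hc
  have h3 : Function.support (fun x => φ x • G x) ⊆ tsupport φ := fun x hx =>
    subset_tsupport φ (fun h => hx (by simp [h]))
  exact ((integrableOn_iff_integrable_of_support_subset h3).1 h2).integrableOn

theorem IsWeakGrad.unique {U : Set Plane} (hU : IsOpen U) {u : Plane → ℝ} {G G' : Plane → Plane}
    (h : IsWeakGrad U u G) (h' : IsWeakGrad U u G') : G =ᵐ[volume.restrict U] G' := by
  have key := hU.ae_eq_zero_of_integral_contDiff_smul_eq_zero (μ := volume)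
    (f := fun x => G x - G' x) (h.2.1.sub h'.2.1) ?_
  · rw [EventuallyEq, ae_restrict_iff' hU.measurableSet]
    filter_upwards [key] with x hx hxU using sub_eq_zero.1 (hx hxU)
  · intro φ hφ hc hs
    have ht : IsTestFunction U φ := ⟨hφ, hc, hs⟩
    have e1 := h.2.2 φ ht
    have e2 := h'.2.2 φ ht
    rw [e1, neg_inj] at e2
    have hz : ∀ x, x ∉ U → φ x • (G x - G' x) = 0 := fun x hx => by
      rw [image_eq_zero_of_notMem_tsupport (fun h => hx (hs h)), zero_smul]
    rw [← setIntegral_eq_integral_of_forall_compl_eq_zero hz]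
    simp only [smul_sub]
    rw [integral_sub (ht.integrable_smul h.2.1) (ht.integrable_smul h'.2.1), e2, sub_self]

theorem IsWeakGrad.wgrad {U : Set Plane} {u : Plane → ℝ} {G : Plane → Plane}
    (h : IsWeakGrad U u G) : IsWeakGrad U u (wgrad U u) := by
  have h' : ∃ G, IsWeakGrad U u G := ⟨G, h⟩
  rw [DG.wgrad, dif_pos h']
  exact h'.choose_spec

theorem aestronglyMeasurable_wgrad {U : Set Plane} (u : Plane → ℝ) :
    AEStronglyMeasurable (wgrad U u) (volume.restrict U) := by
  by_cases h : ∃ G, IsWeakGrad U u G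
  · exact h.choose_spec.wgrad.2.1.aestronglyMeasurable
  · rw [wgrad, dif_neg h]
    exact aestronglyMeasurable_const

/-- The gradient of a smooth representative is a weak gradient. -/
theorem isWeakGrad_gradient {U : Set Plane} (hU : IsOpen U) {u φ : Plane → ℝ}
    (hφ : ContDiff ℝ ∞ φ) (hu : u =ᵐ[volume.restrict U] φ) : IsWeakGrad U u (gradient φ) := by
  refine ⟨?_, (continuous_gradient hφ).locallyIntegrable.locallyIntegrableOn U, ?_⟩
  · refine (locallyIntegrableOn_iff hU.isLocallyClosed).2 fun K hK hKc => ?_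
    exact (hφ.continuous.continuousOn.integrableOn_compact hKc).congr
      (ae_mono (Measure.restrict_mono hK le_rfl) hu.symm)
  · intro ψ ⟨hψ, hc, hs⟩
    have hc' : HasCompactSupport (gradient ψ) := by
      refine (hc.fderiv (𝕜 := ℝ)).comp_left
        (g := (InnerProductSpace.toDual ℝ Plane).symm) (map_zero _)
    have hz1 : ∀ x, x ∉ U → φ x • gradient ψ x = 0 := fun x hx => by
      have : x ∉ tsupport (fderiv ℝ ψ) := fun h => hx (hs (tsupport_fderiv_subset ℝ h))
      rw [gradient, image_eq_zero_of_notMem_tsupport this, map_zero, smul_zero]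
    have hz2 : ∀ x, x ∉ U → ψ x • gradient φ x = 0 := fun x hx => by
      rw [image_eq_zero_of_notMem_tsupport (fun h => hx (hs h)), zero_smul]
    have e1 : ∫ x in U, u x • gradient ψ x = ∫ x, φ x • gradient ψ x := by
      rw [← setIntegral_eq_integral_of_forall_compl_eq_zero hz1]
      refine integral_congr_ae ?_
      filter_upwards [hu] with x hx
      rw [hx]
    rw [e1, setIntegral_eq_integral_of_forall_compl_eq_zero hz2]
    have c1 : Continuous fun x => φ x • gradient ψ x := hφ.continuous.smul (continuous_gradient hψ)
    have c2 : Continuous fun x => ψ x • gradient φ x := hψ.continuous.smul (continuous_gradient hφ)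
    have i1 : Integrable (fun x => φ x • gradient ψ x) := by
      refine c1.integrable_of_hasCompactSupport (hc'.mono fun x hx h => hx ?_)
      beta_reduce
      rw [h, smul_zero]
    have i2 : Integrable (fun x => ψ x • gradient φ x) :=
      c2.integrable_of_hasCompactSupport hc.smul_right
    refine ext_inner_left ℝ fun d => ?_
    have k1 : inner ℝ d (∫ x, φ x • gradient ψ x) = ∫ x, inner ℝ d (φ x • gradient ψ x) :=
      (integral_inner i1 d).symm
    have k2 : inner ℝ d (∫ x, ψ x • gradient φ x) = ∫ x, inner ℝ d (ψ x • gradient φ x) :=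
      (integral_inner i2 d).symm
    rw [inner_neg_right, k1, k2]
    have j1 : Integrable fun x => φ x * fderiv ℝ ψ x d := by
      refine (i1.const_inner (𝕜 := ℝ) d).congr (ae_of_all _ fun x => ?_)
      simp only [inner_smul_right, inner_gradient']
    have j2 : Integrable fun x => fderiv ℝ φ x d * ψ x := by
      refine (i2.const_inner (𝕜 := ℝ) d).congr (ae_of_all _ fun x => ?_)
      simp only [inner_smul_right, inner_gradient']
      ring
    have j3 : Integrable fun x => φ x * ψ x :=
      (hφ.continuous.mul hψ.continuous).integrable_of_hasCompactSupport hc.mul_left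
    have := integral_mul_fderiv_eq_neg_fderiv_mul_of_integrable j2 j1 j3
      (fun x _ => hφ.differentiable (by simp) x) (fun x _ => hψ.differentiable (by simp) x)
    simp only [inner_smul_right, inner_gradient']
    rw [this]
    congr 1
    exact integral_congr_ae (ae_of_all _ fun x => mul_comm _ _)

/-- The boundary of a triangle, as of any convex set, is a null set. -/
theorem triMeasure_eq (t : Finset Plane) : triMeasure t = volume.restrict (interior (cell t)) :=
  Measure.restrict_congr_set
    (interior_ae_eq_of_null_frontier ((convex_convexHull ℝ _).addHaar_frontier volume)).symm

theorem aestronglyMeasurable_tgrad (t : Finset Plane) (u : Plane → ℝ) :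
    AEStronglyMeasurable (tgrad t u) (triMeasure t) := by
  rw [triMeasure_eq]
  exact aestronglyMeasurable_wgrad u

theorem tgrad_ae_eq {t : Finset Plane} {u φ : Plane → ℝ} (hφ : ContDiff ℝ ∞ φ)
    (hu : u =ᵐ[triMeasure t] φ) : tgrad t u =ᵐ[triMeasure t] gradient φ := by
  rw [triMeasure_eq] at hu ⊢
  have h := isWeakGrad_gradient isOpen_interior hφ hu
  exact h.wgrad.unique isOpen_interior h

theorem hasTraceGrad_of_contDiff (t : Finset Plane) {φ : Plane → ℝ} (hφ : ContDiff ℝ ∞ φ) :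
    HasTraceGrad t φ (gradient φ) φ :=
  ⟨memLp_triMeasure t hφ.continuous, memLp_triMeasure t (continuous_gradient hφ),
    fun _ he => memLp_edgeMeasure (card_of_mem_edgesOf he) hφ.continuous,
    fun _ => φ, fun _ => hφ, by simp, by simp, by simp⟩

theorem IsTrace.hasTraceGrad {t : Finset Plane} {u q : Plane → ℝ} (h : IsTrace t u q)
    (hu : MemLp u 2 (triMeasure t)) : HasTraceGrad t u (tgrad t u) q := by
  obtain ⟨hq, φ, hφ, h1, h2, h3⟩ := h
  refine ⟨hu, ?_, hq, φ, hφ, h1, h2, h3⟩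
  obtain ⟨n, hn⟩ := (h2.eventually (gt_mem_nhds (zero_lt_one : (0 : ℝ≥0∞) < 1))).exists
  have hc := continuous_gradient (hφ n)
  have hd : MemLp (fun x => gradient (φ n) x - tgrad t u x) 2 (triMeasure t) :=
    ⟨hc.aestronglyMeasurable.sub (aestronglyMeasurable_tgrad t u), hn.trans ENNReal.one_lt_top⟩
  refine ((memLp_triMeasure t hc).sub hd).ae_eq (ae_of_all _ fun x => ?_)
  simp

theorem isTrace_of_contDiff {t : Finset Plane} {u φ : Plane → ℝ} (hφ : ContDiff ℝ ∞ φ)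
    (hu : u =ᵐ[triMeasure t] φ) : IsTrace t u φ := by
  refine ⟨fun _ he => memLp_edgeMeasure (card_of_mem_edgesOf he) hφ.continuous,
    fun _ => φ, fun _ => hφ, ?_, ?_, by simp⟩
  · refine tendsto_const_nhds.congr fun _ => ?_
    rw [eLpNorm_congr_ae (g := fun _ => (0 : ℝ)), eLpNorm_zero']
    filter_upwards [hu] with x hx
    rw [hx, sub_self]
  · refine tendsto_const_nhds.congr fun _ => ?_
    rw [eLpNorm_congr_ae (g := fun _ => (0 : Plane)), eLpNorm_zero']
    filter_upwards [tgrad_ae_eq hφ hu] with x hx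
    rw [hx, sub_self]

theorem isTrace_trace {t : Finset Plane} {u q : Plane → ℝ} (h : IsTrace t u q) :
    IsTrace t u (trace t u) := by
  have h' : ∃ q, IsTrace t u q := ⟨q, h⟩
  rw [trace, dif_pos h']
  exact h'.choose_spec

/-! ### Normal derivatives -/

theorem isNormalDeriv_normalDeriv {t : Finset Plane} {u q : Plane → ℝ}
    (h : IsNormalDeriv t u q) : IsNormalDeriv t u (normalDeriv t u) := by
  have h' : ∃ q, IsNormalDeriv t u q := ⟨q, h⟩
  rw [normalDeriv, dif_pos h']
  exact h'.choose_spec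

/-- The normal derivative is unique: test functions supported inside `t` determine `Δu`, and then
the smooth functions on the boundary determine `q`. -/
theorem IsNormalDeriv.unique {t : Finset Plane} {N : Finset Plane → Plane}
    (hN : ∀ e ∈ edgesOf t, IsOutward t e (N e)) {u u' q q' : Plane → ℝ}
    (h : IsNormalDeriv t u q) (h' : IsNormalDeriv t u' q')
    (hu : tgrad t u =ᵐ[triMeasure t] tgrad t u') {e : Finset Plane} (he : e ∈ edgesOf t) :
    q =ᵐ[edgeMeasure e] q' := by
  obtain ⟨hq, f, hf, hgreen⟩ := h
  obtain ⟨hq', f', hf', hgreen'⟩ := h'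
  have hgr : ∀ φ : Plane → ℝ, ∫ x, inner ℝ (tgrad t u x) (gradient φ x) ∂(triMeasure t)
      = ∫ x, inner ℝ (tgrad t u' x) (gradient φ x) ∂(triMeasure t) := fun φ => by
    refine integral_congr_ae ?_
    filter_upwards [hu] with x hx
    rw [hx]
  have hfi : ∀ {φ : Plane → ℝ} (_ : Continuous φ) {f : Plane → ℝ}, MemLp f 2 (triMeasure t) →
      Integrable (fun x => f x * φ x) (triMeasure t) := fun hφ _ hf =>
    hf.integrable_mul (memLp_triMeasure t hφ)
  have hqi : ∀ {φ : Plane → ℝ} (_ : Continuous φ) {q : Plane → ℝ} {e : Finset Plane},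
      e ∈ edgesOf t → MemLp q 2 (edgeMeasure e) →
      Integrable (fun x => q x * φ x) (edgeMeasure e) := fun hφ _ _ he hq =>
    hq.integrable_mul (memLp_edgeMeasure (card_of_mem_edgesOf he) hφ)
  have hdiff : ∀ φ : Plane → ℝ, ContDiff ℝ ∞ φ →
      ∫ x, (f x - f' x) * φ x ∂(triMeasure t)
        = ∑ e ∈ edgesOf t, ∫ x, (q x - q' x) * φ x ∂(edgeMeasure e) := by
    intro φ hφ
    have e1 := hgreen φ hφ
    have e2 := hgreen' φ hφ
    simp only [sub_mul]
    rw [integral_sub (hfi hφ.continuous hf) (hfi hφ.continuous hf'),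
      Finset.sum_congr rfl fun e he => integral_sub (hqi hφ.continuous he (hq e he))
        (hqi hφ.continuous he (hq' e he)), Finset.sum_sub_distrib, ← e1, ← e2, hgr φ]
    ring
  have hff : ∀ᵐ x ∂(triMeasure t), f x - f' x = 0 := by
    have hsub : LocallyIntegrableOn (fun x => f x - f' x) (interior (cell t)) := by
      have : Integrable (fun x => f x - f' x) (triMeasure t) :=
        (hf.sub hf').integrable one_le_two
      rw [triMeasure_eq] at this
      exact IntegrableOn.locallyIntegrableOn this
    have := isOpen_interior.ae_eq_zero_of_integral_contDiff_smul_eq_zero hsub ?_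
    · rwa [triMeasure_eq, ae_restrict_iff' isOpen_interior.measurableSet]
    · intro φ hφ _ hs
      have hz : ∀ x, x ∉ interior (cell t) → φ x = 0 := fun x hx =>
        image_eq_zero_of_notMem_tsupport fun h => hx (hs h)
      have e1 := hdiff φ hφ
      rw [Finset.sum_eq_zero fun e he => ?_, triMeasure_eq,
        setIntegral_eq_integral_of_forall_compl_eq_zero fun x hx => by rw [hz x hx, mul_zero]] at e1
      · simpa [mul_comm] using e1
      · rw [integral_congr_ae (g := fun _ => 0), integral_zero]
        filter_upwards [ae_edgeMeasure_mem e] with x hx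
        rw [hz x ((hN e he).notMem_interior hx), mul_zero]
  -- the boundary integrals are the integral against the sum of the edge measures
  set μ : Measure Plane := Measure.sum (fun e : edgesOf t => edgeMeasure e) with hμ
  have hint : Integrable (fun x => q x - q' x) μ := by
    rw [hμ, Measure.sum_fintype, integrable_finsetSum_measure]
    intro e _
    have := isFiniteMeasure_edgeMeasure (card_of_mem_edgesOf e.2)
    exact ((hq e e.2).sub (hq' e e.2)).integrable one_le_two
  have hzero := ae_eq_zero_of_integral_contDiff_smul_eq_zero hint.locallyIntegrable ?_
  · rw [hμ, Measure.ae_sum_iff] at hzero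
    filter_upwards [hzero ⟨e, he⟩] with x hx using sub_eq_zero.1 hx
  · intro φ hφ _
    have e1 := hdiff φ hφ
    rw [integral_congr_ae (g := fun _ => 0), integral_zero] at e1
    · rw [hμ, Measure.sum_fintype, integral_finsetSum_measure, Finset.univ_eq_attach,
        Finset.sum_attach (edgesOf t) fun e => ∫ x, φ x • (q x - q' x) ∂(edgeMeasure e), e1]
      · exact Finset.sum_congr rfl fun e _ => integral_congr_ae (ae_of_all _ fun x => mul_comm _ _)
      · intro e _
        refine (hqi hφ.continuous e.2 ((hq e e.2).sub (hq' e e.2))).congr (ae_of_all _ fun x => ?_)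
        simp [mul_comm]
    · filter_upwards [hff] with x hx
      rw [hx, zero_mul]

/-- Two edges of a triangle meet in at most one point. -/
theorem ae_notMem_cell_of_ne {t e e' : Finset Plane}
    (hind : AffineIndependent ℝ ((↑) : t → Plane)) (he : e ∈ edgesOf t) (he' : e' ∈ edgesOf t)
    (hne : e' ≠ e) : ∀ᵐ x ∂(edgeMeasure e), x ∉ cell e' := by
  classical
  have hsub : ((e : Set Plane) ∩ e').Subsingleton := by
    rw [← Finset.coe_inter]
    refine Finset.card_le_one_iff_subsingleton.1 ?_
    by_contra hlt
    have h1 := card_of_mem_edgesOf he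
    have h2 := card_of_mem_edgesOf he'
    have e1 := Finset.eq_of_subset_of_card_le (Finset.inter_subset_left (s₁ := e) (s₂ := e'))
      (by omega)
    have e2 := Finset.eq_of_subset_of_card_le (Finset.inter_subset_right (s₁ := e) (s₂ := e'))
      (by omega)
    exact hne (e2.symm.trans e1)
  have hnull : (μH[1] : Measure Plane) (cell e ∩ cell e') = 0 := by
    rw [cell, cell, ← hind.convexHull_inter (subset_of_mem_edgesOf he) (subset_of_mem_edgesOf he'),
      hsub.convex.convexHull_eq]
    have : NullSingletonClass (μH[1] : Measure Plane) :=
      Measure.nullSingletonClass_hausdorff Plane one_pos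
    exact hsub.measure_zero _
  rw [edgeMeasure, ae_restrict_iff' (measurableSet_cell e)]
  filter_upwards [measure_eq_zero_iff_ae_notMem.1 hnull] with x hx hxe hxe' using hx ⟨hxe, hxe'⟩

/-- The normal derivative of an affine function is constant on each edge. -/
theorem exists_isNormalDeriv_affine {t : Finset Plane} (ht : t.card = 3)
    (hind : AffineIndependent ℝ ((↑) : t → Plane)) {N : Finset Plane → Plane}
    (hN : ∀ e ∈ edgesOf t, IsOutward t e (N e)) {u : Plane → ℝ} {g : Plane}
    (hu : tgrad t u =ᵐ[triMeasure t] fun _ => g) :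
    ∃ q, IsNormalDeriv t u q ∧ ∀ e ∈ edgesOf t, q =ᵐ[edgeMeasure e] fun _ => inner ℝ (N e) g := by
  obtain ⟨q, hq⟩ : ∃ q : Plane → ℝ, ∀ e ∈ edgesOf t,
      q =ᵐ[edgeMeasure e] fun _ => inner ℝ (N e) g := by
    refine ⟨fun x => ∑ e ∈ edgesOf t, (cell e).indicator (fun _ => inner ℝ (N e) g) x,
      fun e he => ?_⟩
    have : ∀ᵐ x ∂(edgeMeasure e), ∀ e' ∈ edgesOf t, e' ≠ e → x ∉ cell e' := by
      rw [Finset.eventually_all]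
      intro e' he'
      by_cases hne : e' = e
      · exact ae_of_all _ fun x h => absurd hne h
      · filter_upwards [ae_notMem_cell_of_ne hind he he' hne] with x hx _ using hx
    filter_upwards [this, ae_edgeMeasure_mem e] with x hx hxe
    rw [Finset.sum_eq_single e (fun e' he' hne => Set.indicator_of_notMem (hx e' he' hne) _)
      (fun h => absurd he h), Set.indicator_of_mem hxe]
  refine ⟨q, ⟨fun e he => ?_, 0, MemLp.zero, fun φ hφ => ?_⟩, hq⟩
  · exact (memLp_edgeMeasure (card_of_mem_edgesOf he) continuous_const).ae_eq (hq e he).symm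
  · have h1 : ∫ x, inner ℝ (tgrad t u x) (gradient φ x) ∂(triMeasure t)
        = ∫ x, fderiv ℝ φ x g ∂(triMeasure t) := by
      refine integral_congr_ae ?_
      filter_upwards [hu] with x hx
      rw [hx, real_inner_comm, inner_gradient]
    simp only [Pi.zero_apply, zero_mul, integral_zero, add_zero]
    rw [h1, green_triangle ht hind hN (hφ.of_le (by simp)) g]
    refine Finset.sum_congr rfl fun e he => ?_
    rw [← integral_const_mul]
    refine integral_congr_ae ?_
    filter_upwards [hq e he] with x hx
    rw [hx]

theorem exists_affineMap_eq_inner_add (l : Plane →ᵃ[ℝ] ℝ) :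
    ∃ (g : Plane) (c : ℝ), ∀ x, l x = inner ℝ g x + c := by
  refine ⟨(InnerProductSpace.toDual ℝ Plane).symm (LinearMap.toContinuousLinearMap l.linear), l 0,
    fun x => ?_⟩
  rw [InnerProductSpace.toDual_symm_apply]
  have := l.map_vadd 0 x
  simpa using this

theorem gradient_inner_add (g : Plane) (c : ℝ) (x : Plane) :
    gradient (fun x => inner ℝ g x + c) x = g := by
  refine HasGradientAt.gradient ?_
  rw [hasGradientAt_iff_hasFDerivAt]
  exact ((InnerProductSpace.toDual ℝ Plane g).hasFDerivAt).add_const c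

/-! ### Green's formula for continuous functions with an integrable weak gradient -/

/-- A triangle is the common part of the half planes where its barycentric coordinates are
nonnegative. -/
theorem exists_barycentric {t : Finset Plane} (ht : t.card = 3)
    (hind : AffineIndependent ℝ ((↑) : t → Plane)) :
    ∃ (g : t → Plane) (c : t → ℝ), cell t = {x | ∀ i, 0 ≤ inner ℝ (g i) x + c i} ∧
      interior (cell t) = {x | ∀ i, 0 < inner ℝ (g i) x + c i} := by
  have htop : affineSpan ℝ (Set.range ((↑) : t → Plane)) = ⊤ := by
    rw [hind.affineSpan_eq_top_iff_card_eq_finrank_add_one]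
    simp [ht]
  let b : AffineBasis t ℝ Plane := ⟨(↑), hind, htop⟩
  have hr : Set.range b = (t : Set Plane) := Subtype.range_coe
  choose g c hgc using fun i => exists_affineMap_eq_inner_add (b.coord i)
  refine ⟨g, c, ?_, ?_⟩
  · rw [cell, ← hr, b.convexHull_eq_nonneg_coord]
    simp only [hgc]
  · rw [cell, ← hr, b.interior_convexHull]
    simp only [hgc]

/-- The cutoff function of the half plane `{⟪g, x⟫ + c > 0}`, with a transition layer of width
proportional to `1 / n`. -/
def layer (g : Plane) (c : ℝ) (n : ℕ) (x : Plane) : ℝ :=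
  Real.smoothTransition (n * (inner ℝ g x + c) - 1)

theorem contDiff_layer (g : Plane) (c : ℝ) (n : ℕ) : ContDiff ℝ ∞ (layer g c n) :=
  Real.smoothTransition.contDiff.comp ((contDiff_const.mul
    ((contDiff_const.inner ℝ contDiff_id).add contDiff_const)).sub contDiff_const)

theorem fderiv_layer (g : Plane) (c : ℝ) (n : ℕ) (x d : Plane) :
    fderiv ℝ (layer g c n) x d
      = deriv Real.smoothTransition (n * (inner ℝ g x + c) - 1) * (n * inner ℝ g d) := by
  have h1 : HasFDerivAt (fun x : Plane => (n : ℝ) * (inner ℝ g x + c) - 1)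
      ((n : ℝ) • (InnerProductSpace.toDual ℝ Plane g : Plane →L[ℝ] ℝ)) x :=
    (((InnerProductSpace.toDual ℝ Plane g).hasFDerivAt.add_const c).const_mul (n : ℝ)).sub_const 1
  have h2 : HasDerivAt Real.smoothTransition
      (deriv Real.smoothTransition (n * (inner ℝ g x + c) - 1)) (n * (inner ℝ g x + c) - 1) :=
    ((Real.smoothTransition.contDiff (n := 1)).differentiable (by simp) _).hasDerivAt
  rw [show layer g c n = Real.smoothTransition ∘ (fun x : Plane => (n : ℝ) * (inner ℝ g x + c) - 1)
    from rfl, (h2.comp_hasFDerivAt x h1).fderiv]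
  simp

/-- The derivative of a cutoff function of a half plane has a constant sign, so that its integral
over a triangle is controlled by the boundary values. -/
theorem integral_abs_fderiv_layer_le {t : Finset Plane} (ht : t.card = 3)
    (hind : AffineIndependent ℝ ((↑) : t → Plane)) {N : Finset Plane → Plane}
    (hN : ∀ e ∈ edgesOf t, IsOutward t e (N e)) (g : Plane) (c : ℝ) (n : ℕ) (d : Plane) :
    ∫ x, |fderiv ℝ (layer g c n) x d| ∂(triMeasure t)
      ≤ ∑ e ∈ edgesOf t, |inner ℝ (N e) d| * (edgeMeasure e).real Set.univ := by
  have hS : ∀ y, 0 ≤ deriv Real.smoothTransition y := fun y =>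
    Real.smoothTransition.monotone.deriv_nonneg
  have h1 : ∀ x, |fderiv ℝ (layer g c n) x d|
      = SignType.sign (inner ℝ g d) * fderiv ℝ (layer g c n) x d := by
    intro x
    rw [fderiv_layer, abs_mul, abs_mul, abs_of_nonneg (hS _), Nat.abs_cast,
      ← sign_mul_self]
    ring
  have h2 : |((SignType.sign (inner ℝ g d) : SignType) : ℝ)| ≤ 1 := by
    rcases lt_trichotomy (inner ℝ g d) 0 with h | h | h <;> simp [h]
  simp only [h1]
  rw [integral_const_mul, green_triangle ht hind hN ((contDiff_layer g c n).of_le (by simp)) d]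
  refine (le_abs_self _).trans ?_
  rw [abs_mul]
  refine (mul_le_of_le_one_left (abs_nonneg _) h2).trans ?_
  refine (Finset.abs_sum_le_sum_abs _ _).trans (Finset.sum_le_sum fun e he => ?_)
  rw [abs_mul]
  refine mul_le_mul_of_nonneg_left ?_ (abs_nonneg _)
  have := isFiniteMeasure_edgeMeasure (card_of_mem_edgesOf he)
  rw [← Real.norm_eq_abs]
  refine (norm_integral_le_of_norm_le_const (C := 1) (ae_of_all _ fun x => ?_)).trans_eq (one_mul _)
  rw [Real.norm_eq_abs, layer, abs_of_nonneg (Real.smoothTransition.nonneg _)]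
  exact Real.smoothTransition.le_one _

/-- Smooth cutoff functions which exhaust the interior of a triangle, with gradients bounded in
`L¹`. -/
theorem exists_cutoff {t : Finset Plane} (ht : t.card = 3)
    (hind : AffineIndependent ℝ ((↑) : t → Plane)) {N : Finset Plane → Plane}
    (hN : ∀ e ∈ edgesOf t, IsOutward t e (N e)) :
    ∃ χ : ℕ → Plane → ℝ, (∀ n, IsTestFunction (interior (cell t)) (χ n)) ∧
      (∀ n x, |χ n x| ≤ 1) ∧ (∀ x ∈ interior (cell t), ∀ᶠ n in atTop, χ n x = 1) ∧
      ∀ d : Plane, ∃ C : ℝ, ∀ n, ∫ x, |fderiv ℝ (χ n) x d| ∂(triMeasure t) ≤ C := by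
  obtain ⟨g, c, hcell, hint⟩ := exists_barycentric ht hind
  have hl0 : ∀ i n x, 0 ≤ layer (g i) (c i) n x := fun i n x => Real.smoothTransition.nonneg _
  have hl1 : ∀ i n x, layer (g i) (c i) n x ≤ 1 := fun i n x => Real.smoothTransition.le_one _
  have hprod : ∀ (s : Finset t) n x, |∏ i ∈ s, layer (g i) (c i) n x| ≤ 1 := by
    intro s n x
    rw [abs_of_nonneg (Finset.prod_nonneg fun i _ => hl0 i n x)]
    exact Finset.prod_le_one (fun i _ => hl0 i n x) fun i _ => hl1 i n x
  refine ⟨fun n x => ∏ i, layer (g i) (c i) n x, fun n => ?_, fun n x => hprod _ n x,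
    fun x hx => ?_, fun d => ?_⟩
  · set K : Set Plane := {x | ∀ i, 1 ≤ n * (inner ℝ (g i) x + c i)} with hK
    have hKc : IsClosed K := by
      rw [hK, Set.ofPred_forall]
      exact isClosed_iInter fun i => isClosed_le continuous_const (by fun_prop)
    have hsupp : Function.support (fun x => ∏ i, layer (g i) (c i) n x) ⊆ K := by
      intro x hx i
      rw [Function.mem_support, Finset.prod_ne_zero_iff] at hx
      by_contra hlt
      refine hx i (Finset.mem_univ i) (Real.smoothTransition.zero_of_nonpos ?_)
      linarith [not_le.1 hlt]
    have hKint : K ⊆ interior (cell t) := by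
      intro x hx
      rw [hint]
      intro i
      by_contra hle
      have h1 := hx i
      have h2 : (n : ℝ) * (inner ℝ (g i) x + c i) ≤ 0 :=
        mul_nonpos_of_nonneg_of_nonpos (Nat.cast_nonneg n) (not_lt.1 hle)
      linarith
    have hts := closure_minimal hsupp hKc
    refine ⟨?_, ?_, hts.trans hKint⟩
    · exact contDiff_prod fun i _ => contDiff_layer (g i) (c i) n
    · exact (isCompact_cell t).of_isClosed_subset (isClosed_tsupport _)
        (hts.trans (hKint.trans interior_subset))
  · rw [hint] at hx
    have : ∀ i, ∀ᶠ n : ℕ in atTop, layer (g i) (c i) n x = 1 := by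
      intro i
      have h1 : Tendsto (fun n : ℕ => (n : ℝ) * (inner ℝ (g i) x + c i)) atTop atTop :=
        tendsto_natCast_atTop_atTop.atTop_mul_const (hx i)
      filter_upwards [h1.eventually_ge_atTop 2] with n hn
      exact Real.smoothTransition.one_of_one_le (by linarith)
    filter_upwards [eventually_all.2 this] with n hn
    exact Finset.prod_eq_one fun i _ => hn i
  · classical
    refine ⟨∑ i : t, ∑ e ∈ edgesOf t, |inner ℝ (N e) d| * (edgeMeasure e).real Set.univ,
      fun n => ?_⟩
    have hi : ∀ i, Integrable (fun x => |fderiv ℝ (layer (g i) (c i) n) x d|) (triMeasure t) := by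
      intro i
      refine ((memLp_triMeasure t ?_).integrable one_le_two)
      exact (((contDiff_layer (g i) (c i) n).continuous_fderiv (by simp)).clm_apply
        continuous_const).abs
    calc ∫ x, |fderiv ℝ (fun x => ∏ i, layer (g i) (c i) n x) x d| ∂(triMeasure t)
        ≤ ∫ x, ∑ i, |fderiv ℝ (layer (g i) (c i) n) x d| ∂(triMeasure t) := by
          refine integral_mono_of_nonneg (ae_of_all _ fun x => abs_nonneg _)
            (integrable_finsetSum _ fun i _ => hi i) (ae_of_all _ fun x => ?_)
          beta_reduce
          rw [(HasFDerivAt.finsetProd (u := Finset.univ) fun i _ =>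
            ((contDiff_layer (g i) (c i) n).differentiable (by simp) x).hasFDerivAt).fderiv]
          rw [sum_apply]
          refine (Finset.abs_sum_le_sum_abs _ _).trans (Finset.sum_le_sum fun i _ => ?_)
          rw [smul_apply, smul_eq_mul, abs_mul]
          exact mul_le_of_le_one_left (abs_nonneg _) (hprod _ n x)
      _ = ∑ i, ∫ x, |fderiv ℝ (layer (g i) (c i) n) x d| ∂(triMeasure t) :=
          integral_finsetSum _ fun i _ => hi i
      _ ≤ _ := Finset.sum_le_sum fun i _ => integral_abs_fderiv_layer_le ht hind hN _ _ n d

/-- The gradients of the cutoff functions concentrate on the boundary. For a smooth function this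
is Green's formula; the uniform `L¹` bound extends it to continuous functions. -/
theorem tendsto_integral_mul_fderiv_cutoff {t : Finset Plane} (ht : t.card = 3)
    (hind : AffineIndependent ℝ ((↑) : t → Plane)) {N : Finset Plane → Plane}
    (hN : ∀ e ∈ edgesOf t, IsOutward t e (N e)) {χ : ℕ → Plane → ℝ}
    (hχ : ∀ n, IsTestFunction (interior (cell t)) (χ n)) (hχ1 : ∀ n x, |χ n x| ≤ 1)
    (hlim : ∀ x ∈ interior (cell t), ∀ᶠ n in atTop, χ n x = 1) {d : Plane} {C : ℝ}
    (hC : ∀ n, ∫ x, |fderiv ℝ (χ n) x d| ∂(triMeasure t) ≤ C) {f : Plane → ℝ}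
    (hf : Continuous f) :
    Tendsto (fun n => ∫ x, f x * fderiv ℝ (χ n) x d ∂(triMeasure t)) atTop
      (𝓝 (-∑ e ∈ edgesOf t, inner ℝ (N e) d * ∫ x, f x ∂(edgeMeasure e))) := by
  have hz : ∀ n x, x ∉ interior (cell t) → χ n x = 0 := fun n x hx =>
    image_eq_zero_of_notMem_tsupport fun h => hx ((hχ n).2.2 h)
  have hdc : ∀ n, Continuous fun x => fderiv ℝ (χ n) x d := fun n =>
    ((hχ n).1.continuous_fderiv (by simp)).clm_apply continuous_const
  have hi : ∀ {h : Plane → ℝ}, Continuous h → Integrable h (triMeasure t) := fun hh =>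
    (memLp_triMeasure t hh).integrable one_le_two
  have hie : ∀ {h : Plane → ℝ}, Continuous h → ∀ e ∈ edgesOf t, Integrable h (edgeMeasure e) := by
    intro h hh e he
    have := isFiniteMeasure_edgeMeasure (card_of_mem_edgesOf he)
    exact (memLp_edgeMeasure (card_of_mem_edgesOf he) hh).integrable one_le_two
  have smooth : ∀ g : Plane → ℝ, ContDiff ℝ ∞ g →
      Tendsto (fun n => ∫ x, g x * fderiv ℝ (χ n) x d ∂(triMeasure t)) atTop
        (𝓝 (-∑ e ∈ edgesOf t, inner ℝ (N e) d * ∫ x, g x ∂(edgeMeasure e))) := by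
    intro g hg
    have hgd : Continuous fun x => fderiv ℝ g x d :=
      (hg.continuous_fderiv (by simp)).clm_apply continuous_const
    have e1 : ∀ n, ∫ x, g x * fderiv ℝ (χ n) x d ∂(triMeasure t)
        = -∫ x, χ n x * fderiv ℝ g x d ∂(triMeasure t) := by
      intro n
      have := green_triangle ht hind hN ((hg.mul (hχ n).1).of_le (by simp)) d
      rw [Finset.sum_eq_zero fun e he => ?_] at this
      · rw [eq_neg_iff_add_eq_zero, ← integral_add (hi (hg.continuous.fun_mul (hdc n)))
          (hi ((hχ n).1.continuous.fun_mul hgd)), ← this]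
        refine integral_congr_ae (ae_of_all _ fun x => ?_)
        have dg := (hg.differentiable (by simp) x).hasFDerivAt
        have dχ := ((hχ n).1.differentiable (by simp) x).hasFDerivAt
        beta_reduce
        rw [show (fun x => g x * χ n x) = g * χ n from rfl, (dg.mul dχ).fderiv]
        simp
      · rw [integral_congr_ae (g := fun _ => 0), integral_zero, mul_zero]
        filter_upwards [ae_edgeMeasure_mem e] with x hx
        rw [hz n x ((hN e he).notMem_interior hx), mul_zero]
    simp only [e1]
    refine Tendsto.neg ?_
    rw [← green_triangle ht hind hN (hg.of_le (by simp)) d]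
    refine tendsto_integral_of_dominated_convergence (fun x => |fderiv ℝ g x d|)
      (fun n => ((hχ n).1.continuous.fun_mul hgd).aestronglyMeasurable) (hi hgd.abs)
      (fun n => ae_of_all _ fun x => ?_) ?_
    · rw [norm_mul]
      exact mul_le_of_le_one_left (abs_nonneg _) (hχ1 n x)
    · rw [triMeasure_eq]
      filter_upwards [ae_restrict_mem isOpen_interior.measurableSet] with x hx
      refine tendsto_const_nhds.congr' ?_
      filter_upwards [hlim x hx] with n hn
      rw [hn, one_mul]
  set P : ℝ := ∑ e ∈ edgesOf t, |inner ℝ (N e) d| * (edgeMeasure e).real Set.univ with hP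
  have hP0 : 0 ≤ P := Finset.sum_nonneg fun e _ => by positivity
  have hC0 : 0 ≤ C := (integral_nonneg fun x => abs_nonneg _).trans (hC 0)
  rw [Metric.tendsto_atTop]
  intro ε hε
  -- a uniform error `δ` of a smooth approximation costs at most `δ * (C + P)`
  set δ : ℝ := ε / (2 * (C + P + 1)) with hδ
  have hδ0 : 0 < δ := by positivity
  obtain ⟨g, hg, hgf, -⟩ := hf.exists_contDiff_approx ⊤ (continuous_const (y := δ))
    fun _ => hδ0
  have hg' : ContDiff ℝ ∞ g := hg
  obtain ⟨n₀, hn₀⟩ := Metric.tendsto_atTop.1 (smooth g hg') (ε / 2) (half_pos hε)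
  refine ⟨n₀, fun n hn => ?_⟩
  have h1 := hn₀ n hn
  have h2 : |∫ x, f x * fderiv ℝ (χ n) x d ∂(triMeasure t)
      - ∫ x, g x * fderiv ℝ (χ n) x d ∂(triMeasure t)| ≤ δ * C := by
    rw [← integral_sub (hi (hf.fun_mul (hdc n))) (hi (hg'.continuous.fun_mul (hdc n))),
      ← Real.norm_eq_abs]
    refine (norm_integral_le_of_norm_le (g := fun x => δ * |fderiv ℝ (χ n) x d|)
      ((hi (hdc n).abs).const_mul δ) (ae_of_all _ fun x => ?_)).trans ?_
    · rw [← sub_mul, norm_mul, ← dist_eq_norm, dist_comm]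
      exact mul_le_mul_of_nonneg_right (hgf x).le (abs_nonneg _)
    · rw [integral_const_mul]
      exact mul_le_mul_of_nonneg_left (hC n) hδ0.le
  have h3 : |∑ e ∈ edgesOf t, inner ℝ (N e) d * ∫ x, f x ∂(edgeMeasure e)
      - ∑ e ∈ edgesOf t, inner ℝ (N e) d * ∫ x, g x ∂(edgeMeasure e)| ≤ δ * P := by
    rw [← Finset.sum_sub_distrib, hP, Finset.mul_sum]
    refine (Finset.abs_sum_le_sum_abs _ _).trans (Finset.sum_le_sum fun e he => ?_)
    have := isFiniteMeasure_edgeMeasure (card_of_mem_edgesOf he)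
    rw [← mul_sub, abs_mul, ← integral_sub (hie hf e he) (hie hg'.continuous e he), mul_left_comm]
    refine mul_le_mul_of_nonneg_left ?_ (abs_nonneg _)
    rw [← Real.norm_eq_abs]
    refine norm_integral_le_of_norm_le_const (ae_of_all _ fun x => ?_)
    rw [← dist_eq_norm, dist_comm]
    exact (hgf x).le
  have h4 : δ * C + δ * P < ε / 2 := by
    have : δ * (C + P + 1) = ε / 2 := by
      rw [hδ]; field_simp
    nlinarith
  rw [Real.dist_eq] at h1 ⊢
  rw [abs_lt] at h1 ⊢
  rw [abs_le] at h2 h3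
  constructor <;> linarith [h1.1, h1.2, h2.1, h2.2, h3.1, h3.2]

/-- Green's formula on a triangle for the product of a smooth function and a continuous function
with an integrable weak gradient. The weak gradient is tested with `χ n * φ` for the cutoff
functions `χ n`; in the limit, the gradients of `χ n` produce the boundary terms. -/
theorem IsWeakGrad.green {t : Finset Plane} (ht : t.card = 3)
    (hind : AffineIndependent ℝ ((↑) : t → Plane)) {N : Finset Plane → Plane}
    (hN : ∀ e ∈ edgesOf t, IsOutward t e (N e)) {u : Plane → ℝ} {G : Plane → Plane}
    (h : IsWeakGrad (interior (cell t)) u G) (hu : ContinuousOn u (cell t))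
    (hG : Integrable G (triMeasure t)) {φ : Plane → ℝ} (hφ : ContDiff ℝ ∞ φ) (d : Plane) :
    ∫ x, u x * fderiv ℝ φ x d ∂(triMeasure t) + ∫ x, φ x * inner ℝ (G x) d ∂(triMeasure t)
      = ∑ e ∈ edgesOf t, inner ℝ (N e) d * ∫ x, u x * φ x ∂(edgeMeasure e) := by
  obtain ⟨χ, hχ, hχ1, hlim, hC⟩ := exists_cutoff ht hind hN
  obtain ⟨C, hC⟩ := hC d
  -- a continuous extension of `u` to the plane
  obtain ⟨w, hw⟩ := ContinuousMap.exists_restrict_eq (isCompact_cell t).isClosed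
    ⟨(cell t).domRestrict u, hu.domRestrict⟩
  have hwu : ∀ x ∈ cell t, w x = u x := fun x hx => DFunLike.congr_fun hw ⟨x, hx⟩
  have hwc : Continuous w := w.continuous
  have hφd : Continuous fun x => fderiv ℝ φ x d :=
    (hφ.continuous_fderiv (by simp)).clm_apply continuous_const
  have hdc : ∀ n, Continuous fun x => fderiv ℝ (χ n) x d := fun n =>
    ((hχ n).1.continuous_fderiv (by simp)).clm_apply continuous_const
  have hi : ∀ {h : Plane → ℝ}, Continuous h → Integrable h (triMeasure t) := fun hh =>
    (memLp_triMeasure t hh).integrable one_le_two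
  have hGd : Integrable (fun x => φ x * inner ℝ (G x) d) (triMeasure t) := by
    obtain ⟨K, hK⟩ := (isCompact_cell t).exists_bound_of_continuousOn hφ.continuous.continuousOn
    refine (hG.inner_const (𝕜 := ℝ) d).bdd_mul hφ.continuous.aestronglyMeasurable (c := K) ?_
    filter_upwards [ae_triMeasure_mem t] with x hx using hK x hx
  have key : ∀ n, ∫ x, w x * φ x * fderiv ℝ (χ n) x d ∂(triMeasure t)
      = -∫ x, χ n x * (φ x * inner ℝ (G x) d) ∂(triMeasure t)
        - ∫ x, χ n x * (w x * fderiv ℝ φ x d) ∂(triMeasure t) := by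
    intro n
    have htest : IsTestFunction (interior (cell t)) (fun x => χ n x * φ x) :=
      ⟨(hχ n).1.mul hφ, (hχ n).2.1.mul_right, (tsupport_mul_subset_left).trans (hχ n).2.2⟩
    have hw1 := h.2.2 _ htest
    have hi2 : Integrable (fun x => (χ n x * φ x) • G x) (triMeasure t) := by
      have := htest.integrable_smul h.2.1
      rwa [IntegrableOn, ← triMeasure_eq] at this
    have hi1 : Integrable (fun x => u x • gradient (fun x => χ n x * φ x) x) (triMeasure t) := by
      have h1 : Integrable (fun x => w x • gradient (fun x => χ n x * φ x) x) (triMeasure t) :=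
        (memLp_triMeasure t (hwc.smul (continuous_gradient htest.1))).integrable one_le_two
      refine h1.congr ?_
      filter_upwards [ae_triMeasure_mem t] with x hx
      rw [hwu x hx]
    rw [← triMeasure_eq] at hw1
    have hw2 := congrArg (fun y : Plane => inner ℝ d y) hw1
    have k1 : inner ℝ d (∫ x, u x • gradient (fun x => χ n x * φ x) x ∂(triMeasure t))
        = ∫ x, inner ℝ d (u x • gradient (fun x => χ n x * φ x) x) ∂(triMeasure t) :=
      (integral_inner hi1 d).symm
    have k2 : inner ℝ d (∫ x, (χ n x * φ x) • G x ∂(triMeasure t))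
        = ∫ x, inner ℝ d ((χ n x * φ x) • G x) ∂(triMeasure t) := (integral_inner hi2 d).symm
    beta_reduce at hw2
    rw [inner_neg_right, k1, k2] at hw2
    have hgr : ∀ x, fderiv ℝ (fun x => χ n x * φ x) x d
        = χ n x * fderiv ℝ φ x d + φ x * fderiv ℝ (χ n) x d := by
      intro x
      have dφ := (hφ.differentiable (by simp) x).hasFDerivAt
      have dχ := ((hχ n).1.differentiable (by simp) x).hasFDerivAt
      rw [show (fun x => χ n x * φ x) = χ n * φ from rfl, (dχ.mul dφ).fderiv]
      simp
    have l1 : ∫ x, inner ℝ d (u x • gradient (fun x => χ n x * φ x) x) ∂(triMeasure t)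
        = ∫ x, w x * φ x * fderiv ℝ (χ n) x d ∂(triMeasure t)
          + ∫ x, χ n x * (w x * fderiv ℝ φ x d) ∂(triMeasure t) := by
      rw [← integral_add (hi ((hwc.fun_mul hφ.continuous).fun_mul (hdc n)))
        (hi ((hχ n).1.continuous.fun_mul (hwc.fun_mul hφd)))]
      refine integral_congr_ae ?_
      filter_upwards [ae_triMeasure_mem t] with x hx
      rw [inner_smul_right, inner_gradient', hgr, hwu x hx]
      ring
    have l2 : ∫ x, inner ℝ d ((χ n x * φ x) • G x) ∂(triMeasure t)
        = ∫ x, χ n x * (φ x * inner ℝ (G x) d) ∂(triMeasure t) := by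
      refine integral_congr_ae (ae_of_all _ fun x => ?_)
      beta_reduce
      rw [inner_smul_right, real_inner_comm, mul_assoc]
    rw [l1, l2] at hw2
    linarith
  have dom : ∀ {F : Plane → ℝ}, Integrable F (triMeasure t) →
      Tendsto (fun n => ∫ x, χ n x * F x ∂(triMeasure t)) atTop
        (𝓝 (∫ x, F x ∂(triMeasure t))) := by
    intro F hF
    refine tendsto_integral_of_dominated_convergence (fun x => |F x|)
      (fun n => (hχ n).1.continuous.aestronglyMeasurable.mul hF.1) hF.abs
      (fun n => ae_of_all _ fun x => ?_) ?_
    · rw [norm_mul]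
      exact mul_le_of_le_one_left (abs_nonneg _) (hχ1 n x)
    · rw [triMeasure_eq]
      filter_upwards [ae_restrict_mem isOpen_interior.measurableSet] with x hx
      refine tendsto_const_nhds.congr' ?_
      filter_upwards [hlim x hx] with n hn
      rw [hn, one_mul]
  have T1 := tendsto_integral_mul_fderiv_cutoff ht hind hN hχ hχ1 hlim hC
    (hwc.fun_mul hφ.continuous)
  have T2 := (dom hGd).neg.sub (dom (hi (hwc.fun_mul hφd)))
  have := tendsto_nhds_unique T1 (T2.congr fun n => (key n).symm)
  have r1 : ∫ x, w x * fderiv ℝ φ x d ∂(triMeasure t)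
      = ∫ x, u x * fderiv ℝ φ x d ∂(triMeasure t) := by
    refine integral_congr_ae ?_
    filter_upwards [ae_triMeasure_mem t] with x hx
    rw [hwu x hx]
  have r2 : ∀ e ∈ edgesOf t, inner ℝ (N e) d * ∫ x, w x * φ x ∂(edgeMeasure e)
      = inner ℝ (N e) d * ∫ x, u x * φ x ∂(edgeMeasure e) := by
    intro e he
    congr 1
    refine integral_congr_ae ?_
    filter_upwards [ae_edgeMeasure_mem e] with x hx
    rw [hwu x (cell_mono (subset_of_mem_edgesOf he) hx)]
  rw [Finset.sum_congr rfl r2, r1] at this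
  linarith

/-! ### The geometry of a triangulation -/

/-- In the plane, a vector orthogonal to a nonzero `n` is a multiple of any nonzero vector
orthogonal to `n`. -/
theorem exists_smul_of_orthogonal {n u w : Plane} (hn : n ≠ 0) (hu0 : u ≠ 0)
    (hu : inner ℝ n u = 0) (hw : inner ℝ n w = 0) : ∃ β : ℝ, w = β • u := by
  simp only [PiLp.inner_apply, Fin.sum_univ_two, RCLike.inner_apply, conj_trivial] at hu hw
  have hdet : w 0 * u 1 - w 1 * u 0 = 0 := by
    by_contra hne
    apply hn
    ext i
    fin_cases i
    · have : n 0 * (w 0 * u 1 - w 1 * u 0) = 0 := by linear_combination u 1 * hw - w 1 * hu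
      simpa [hne] using this
    · have : n 1 * (w 0 * u 1 - w 1 * u 0) = 0 := by linear_combination w 0 * hu - u 0 * hw
      simpa [hne] using this
  have hU : u 0 ^ 2 + u 1 ^ 2 ≠ 0 := by
    intro h
    apply hu0
    ext i
    fin_cases i
    · show u 0 = 0
      nlinarith [sq_nonneg (u 0), sq_nonneg (u 1)]
    · show u 1 = 0
      nlinarith [sq_nonneg (u 0), sq_nonneg (u 1)]
  refine ⟨(w 0 * u 0 + w 1 * u 1) / (u 0 ^ 2 + u 1 ^ 2), ?_⟩
  ext i
  fin_cases i
  · simp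
    field_simp
    linear_combination u 1 * hdet
  · simp
    field_simp
    linear_combination -u 0 * hdet

namespace Triangulation

variable {Ω : Set Plane} (𝓣 : Triangulation Ω)

theorem mem_triangles {t : Finset Plane} :
    t ∈ 𝓣.triangles ↔ t ∈ 𝓣.complex.faces ∧ t.card = 3 := by
  simp [triangles]

theorem mem_edges {e : Finset Plane} : e ∈ 𝓣.edges ↔ e ∈ 𝓣.complex.faces ∧ e.card = 2 := by
  simp [edges]

theorem mem_adjacent {e t : Finset Plane} : t ∈ 𝓣.adjacent e ↔ t ∈ 𝓣.triangles ∧ e ⊆ t := by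
  simp [adjacent]

theorem mem_edges_of_mem_edgesOf {t e : Finset Plane} (ht : t ∈ 𝓣.triangles)
    (he : e ∈ edgesOf t) : e ∈ 𝓣.edges := by
  have hc := card_of_mem_edgesOf he
  refine 𝓣.mem_edges.2 ⟨𝓣.complex.down_closed (𝓣.mem_triangles.1 ht).1 (subset_of_mem_edgesOf he)
    (Finset.card_pos.1 (by omega)), hc⟩

theorem mem_edgesOf_of_mem_adjacent {t e : Finset Plane} (he : e ∈ 𝓣.edges)
    (ht : t ∈ 𝓣.adjacent e) : e ∈ edgesOf t :=
  Finset.mem_powersetCard.2 ⟨(𝓣.mem_adjacent.1 ht).2, (𝓣.mem_edges.1 he).2⟩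

theorem sum_triangles_edgesOf (F : Finset Plane → Finset Plane → ℝ) :
    ∑ t ∈ 𝓣.triangles, ∑ e ∈ edgesOf t, F t e = ∑ e ∈ 𝓣.edges, ∑ t ∈ 𝓣.adjacent e, F t e := by
  refine Finset.sum_comm' fun t e => ?_
  constructor
  · rintro ⟨ht, he⟩
    exact ⟨𝓣.mem_adjacent.2 ⟨ht, subset_of_mem_edgesOf he⟩, 𝓣.mem_edges_of_mem_edgesOf ht he⟩
  · rintro ⟨ht, he⟩
    exact ⟨(𝓣.mem_adjacent.1 ht).1, 𝓣.mem_edgesOf_of_mem_adjacent he ht⟩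

theorem affineIndependent {t : Finset Plane} (ht : t ∈ 𝓣.triangles) :
    AffineIndependent ℝ ((↑) : t → Plane) :=
  𝓣.complex.indep (𝓣.mem_triangles.1 ht).1

theorem plus_mem_adjacent {e : Finset Plane} (he : e ∈ 𝓣.edges) : 𝓣.plus e ∈ 𝓣.adjacent e := by
  obtain ⟨h1, h2⟩ := 𝓣.mem_edges.1 he
  obtain ⟨h3, h4, h5⟩ := 𝓣.plus_mem e h1 h2
  exact 𝓣.mem_adjacent.2 ⟨𝓣.mem_triangles.2 ⟨h3, h4⟩, h5⟩

theorem inner_normal_ne_zero {e t : Finset Plane} (he : e ∈ 𝓣.edges) (ht : t ∈ 𝓣.adjacent e)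
    {p r : Plane} (hp : p ∈ e) (hr : r ∈ t) (hre : r ∉ e) :
    inner ℝ (𝓣.normal e) (r - p) ≠ 0 := by
  intro h0
  obtain ⟨hef, hec⟩ := 𝓣.mem_edges.1 he
  obtain ⟨htt, het⟩ := 𝓣.mem_adjacent.1 ht
  obtain ⟨b, c, hset, hrb, hrc, hbc, hD⟩ :=
    exists_triangle_vertices (𝓣.mem_triangles.1 htt).2 (𝓣.affineIndependent htt) hr
  have hn : 𝓣.normal e ≠ 0 := by
    rw [← norm_pos_iff, 𝓣.norm_normal e hef hec]
    exact one_pos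
  -- the edge consists of the other two vertices
  have hsub : ∀ x ∈ e, x = b ∨ x = c := by
    intro x hx
    have : x ∈ (t : Set Plane) := het hx
    rw [hset] at this
    rcases this with rfl | h | h
    · exact absurd hx hre
    · exact Or.inl h
    · exact Or.inr h
  have hbc' : b ∈ e ∧ c ∈ e := by
    obtain ⟨x, y, hxy, rfl⟩ := Finset.card_eq_two.1 hec
    have hx := hsub x (by simp)
    have hy := hsub y (by simp)
    rcases hx with rfl | rfl <;> rcases hy with rfl | rfl <;> simp_all
  have hrb' : inner ℝ (𝓣.normal e) (b - r) = 0 := by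
    have := 𝓣.normal_orthogonal e hef hec b hbc'.1 p hp
    rw [← sub_sub_sub_cancel_right b r p, inner_sub_right, this, h0, sub_zero]
  have hrc' : inner ℝ (𝓣.normal e) (c - r) = 0 := by
    have := 𝓣.normal_orthogonal e hef hec c hbc'.2 p hp
    rw [← sub_sub_sub_cancel_right c r p, inner_sub_right, this, h0, sub_zero]
  obtain ⟨β, hβ⟩ := exists_smul_of_orthogonal hn (sub_ne_zero.2 hrb.symm) hrb' hrc'
  apply hD
  rw [hβ]
  simp [det2]
  ring

/-- Two different triangles with a common edge lie on different sides of it: otherwise they would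
overlap near the midpoint of the edge. -/
theorem opposite_sides {e t t' : Finset Plane} (he : e ∈ 𝓣.edges) (ht : t ∈ 𝓣.adjacent e)
    (ht' : t' ∈ 𝓣.adjacent e) (hne : t ≠ t') {p r r' : Plane} (hp : p ∈ e) (hr : r ∈ t)
    (hre : r ∉ e) (hr' : r' ∈ t') (hre' : r' ∉ e) :
    inner ℝ (𝓣.normal e) (r - p) * inner ℝ (𝓣.normal e) (r' - p) < 0 := by
  classical
  obtain ⟨hef, hec⟩ := 𝓣.mem_edges.1 he
  obtain ⟨htt, het⟩ := 𝓣.mem_adjacent.1 ht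
  obtain ⟨htt', het'⟩ := 𝓣.mem_adjacent.1 ht'
  have h0 := 𝓣.inner_normal_ne_zero he ht hp hr hre
  have h0' := 𝓣.inner_normal_ne_zero he ht' hp hr' hre'
  by_contra hcon
  have hpos : 0 < inner ℝ (𝓣.normal e) (r - p) * inner ℝ (𝓣.normal e) (r' - p) :=
    lt_of_le_of_ne (not_lt.1 hcon) (mul_ne_zero h0 h0').symm
  have hn : 𝓣.normal e ≠ 0 := by
    rw [← norm_pos_iff, 𝓣.norm_normal e hef hec]
    exact one_pos
  obtain ⟨q, hq, hqp⟩ := Finset.exists_mem_ne (by omega : 1 < e.card) p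
  have horth := 𝓣.normal_orthogonal e hef hec q hq p hp
  set n := 𝓣.normal e with hndef
  set α : ℝ := inner ℝ n (r' - p) / inner ℝ n (r - p) with hα
  have hα0 : 0 < α := by
    rw [hα, div_pos_iff]
    rcases mul_pos_iff.1 hpos with ⟨h1, h2⟩ | ⟨h1, h2⟩
    · exact Or.inl ⟨h2, h1⟩
    · exact Or.inr ⟨h2, h1⟩
  obtain ⟨β, hβ⟩ := exists_smul_of_orthogonal (w := (r' - p) - α • (r - p)) hn
    (sub_ne_zero.2 hqp) horth (by
      rw [inner_sub_right, inner_smul_right, hα, div_mul_cancel₀ _ h0, sub_self])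
  -- `x`, near the midpoint of the edge, has nonnegative barycentric coordinates in both triangles
  obtain ⟨ε, hε0, hε1, hεα⟩ : ∃ ε : ℝ, 0 < ε ∧ ε ≤ 1 ∧ ε * (α + |β| + 1) ≤ 1 / 2 := by
    have : 0 < α + |β| + 1 := by positivity
    refine ⟨1 / (2 * (α + |β| + 1)), by positivity, ?_, ?_⟩
    · rw [div_le_one (by positivity)]
      linarith [abs_nonneg β]
    · field_simp
      rfl
  have b1 := abs_le.1 (le_refl |β|)
  set x : Plane := (1 / 2 : ℝ) • p + (1 / 2 : ℝ) • q
    + ε • (r' - ((1 / 2 : ℝ) • p + (1 / 2 : ℝ) • q)) with hx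
  have hcell : ∀ {s : Finset Plane} {a b c : Plane}, a ∈ s → b ∈ s → c ∈ s → ∀ {w₁ w₂ w₃ : ℝ},
      0 ≤ w₁ → 0 ≤ w₂ → 0 ≤ w₃ → w₁ + w₂ + w₃ = 1 → w₁ • a + w₂ • b + w₃ • c ∈ cell s := by
    intro s a b c ha hb hc w₁ w₂ w₃ h1 h2 h3 hsum
    have := (convex_convexHull ℝ (s : Set Plane)).sum_mem (t := Finset.univ)
      (w := ![w₁, w₂, w₃]) (z := ![a, b, c])
      (by intro i _; fin_cases i <;> simpa) (by simpa [Fin.sum_univ_three] using hsum)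
      (by
        intro i _
        fin_cases i
        · exact subset_convexHull ℝ _ ha
        · exact subset_convexHull ℝ _ hb
        · exact subset_convexHull ℝ _ hc)
    simpa [Fin.sum_univ_three, cell] using this
  have hx1 : x ∈ cell t' := by
    have : x = ((1 - ε) / 2) • p + ((1 - ε) / 2) • q + ε • r' := by rw [hx]; module
    rw [this]
    exact hcell (het' hp) (het' hq) hr' (by linarith) (by linarith) hε0.le (by ring)
  have hx2 : x ∈ cell t := by
    have hr'' : r' = p + α • (r - p) + β • (q - p) := by
      rw [← hβ]; abel
    have : x = (1 / 2 + ε / 2 - ε * α - ε * β) • p + (1 / 2 - ε / 2 + ε * β) • q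
        + (ε * α) • r := by rw [hx, hr'']; module
    rw [this]
    refine hcell (het hp) (het hq) hr ?_ ?_ (by positivity) (by ring)
    · nlinarith
    · nlinarith
  -- the common part of the two triangles is the edge
  have hinter : (t : Set Plane) ∩ t' ⊆ e := by
    rintro y ⟨hy, hy'⟩
    by_contra hye
    apply hne
    have hins : ∀ s : Finset Plane, s.card = 3 → e ⊆ s → y ∈ s → insert y e = s := by
      intro s hs hes hys
      refine Finset.eq_of_subset_of_card_le (Finset.insert_subset hys hes) ?_
      rw [Finset.card_insert_of_notMem hye, hec, hs]
    rw [← hins t (𝓣.mem_triangles.1 htt).2 het hy, hins t' (𝓣.mem_triangles.1 htt').2 het' hy']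
  have hxe : x ∈ cell e :=
    convexHull_mono hinter (𝓣.complex.inter_subset_convexHull (𝓣.mem_triangles.1 htt).1
      (𝓣.mem_triangles.1 htt').1 ⟨hx2, hx1⟩)
  have hxe' : inner ℝ n (x - p) = 0 := by
    have hsub : cell e ⊆ {x | inner ℝ n (x - p) = 0} := by
      refine convexHull_min (fun y hy => 𝓣.normal_orthogonal e hef hec y hy p hp) ?_
      intro y hy z hz a b _ _ hab
      have : a • y + b • z - p = a • (y - p) + b • (z - p) := by
        rw [smul_sub, smul_sub, sub_add_sub_comm, ← add_smul, hab, one_smul]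
      rw [Set.mem_ofPred_eq] at hy hz ⊢
      rw [this, inner_add_right, inner_smul_right, inner_smul_right, hy, hz]
      simp
    exact hsub hxe
  have : x - p = ((1 - ε) / 2) • (q - p) + ε • (r' - p) := by rw [hx]; module
  rw [this, inner_add_right, inner_smul_right, inner_smul_right, horth] at hxe'
  rcases mul_eq_zero.1 (by simpa using hxe' : ε * inner ℝ n (r' - p) = 0) with h | h
  · exact hε0.ne' h
  · exact h0' h

theorem exists_mem_notMem {e t : Finset Plane} (he : e ∈ 𝓣.edges) (ht : t ∈ 𝓣.adjacent e) :
    ∃ r ∈ t, r ∉ e := by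
  have h1 := (𝓣.mem_edges.1 he).2
  have h2 := (𝓣.mem_triangles.1 (𝓣.mem_adjacent.1 ht).1).2
  exact Finset.exists_mem_notMem_of_card_lt_card (by omega)

/-- The outward normal of a triangle on an edge is `± n`. -/
theorem isOutward {e t : Finset Plane} (he : e ∈ 𝓣.edges) (ht : t ∈ 𝓣.adjacent e) :
    IsOutward t e (𝓣.sgn e t • 𝓣.normal e) := by
  obtain ⟨hef, hec⟩ := 𝓣.mem_edges.1 he
  have hplus := 𝓣.plus_mem_adjacent he
  refine ⟨?_, fun p hp q hq => ?_, fun p hp r hr hre => ?_⟩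
  · rw [norm_smul, 𝓣.norm_normal e hef hec, mul_one, sgn]
    split_ifs <;> simp
  · rw [inner_smul_left, 𝓣.normal_orthogonal e hef hec p hp q hq, mul_zero]
  · rw [inner_smul_left, sgn]
    split_ifs with h
    · subst h
      simpa using 𝓣.normal_outward e hef hec p hp r hr hre
    · obtain ⟨r', hr', hre'⟩ := 𝓣.exists_mem_notMem he hplus
      have h1 := 𝓣.opposite_sides he ht hplus h hp hr hre hr' hre'
      have h2 := 𝓣.normal_outward e hef hec p hp r' hr' hre'
      have h3 : 0 < inner ℝ (𝓣.normal e) (r - p) := by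
        by_contra hle
        have := mul_nonneg_of_nonpos_of_nonpos (not_lt.1 hle) h2.le
        linarith
      simpa using h3

theorem isOutward_of_mem_edgesOf {t : Finset Plane} (ht : t ∈ 𝓣.triangles) :
    ∀ e ∈ edgesOf t, IsOutward t e (𝓣.sgn e t • 𝓣.normal e) := fun _ he =>
  𝓣.isOutward (𝓣.mem_edges_of_mem_edgesOf ht he)
    (𝓣.mem_adjacent.2 ⟨ht, subset_of_mem_edgesOf he⟩)

/-- An edge belongs to one or two triangles. -/
theorem adjacent_eq {e : Finset Plane} (he : e ∈ 𝓣.edges) :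
    𝓣.adjacent e = {𝓣.plus e} ∨
      ∃ t, t ≠ 𝓣.plus e ∧ ∀ s, s ∈ 𝓣.adjacent e ↔ s = 𝓣.plus e ∨ s = t := by
  have hplus := 𝓣.plus_mem_adjacent he
  by_cases h : ∃ t ∈ 𝓣.adjacent e, t ≠ 𝓣.plus e
  · right
    obtain ⟨t, ht, hne⟩ := h
    refine ⟨t, hne, fun s => ⟨fun hs => ?_, ?_⟩⟩
    · by_contra! hcon
      obtain ⟨p, hp⟩ : e.Nonempty := Finset.card_pos.1 (by rw [(𝓣.mem_edges.1 he).2]; norm_num)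
      obtain ⟨r, hr, hre⟩ := 𝓣.exists_mem_notMem he ht
      obtain ⟨r', hr', hre'⟩ := 𝓣.exists_mem_notMem he hplus
      obtain ⟨r'', hr'', hre''⟩ := 𝓣.exists_mem_notMem he hs
      have h1 := 𝓣.opposite_sides he ht hplus hne hp hr hre hr' hre'
      have h2 := 𝓣.opposite_sides he hs hplus hcon.1 hp hr'' hre'' hr' hre'
      have h3 := 𝓣.opposite_sides he ht hs hcon.2.symm hp hr hre hr'' hre''
      have := mul_pos_of_neg_of_neg h1 h2
      nlinarith [sq_nonneg (inner ℝ (𝓣.normal e) (r' - p))]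
    · rintro (rfl | rfl)
      · exact hplus
      · exact ht
  · left
    push Not at h
    exact Finset.eq_singleton_iff_unique_mem.2 ⟨hplus, h⟩

theorem sgn_mul_self (e t : Finset Plane) : 𝓣.sgn e t * 𝓣.sgn e t = 1 := by
  rw [sgn]
  split_ifs <;> norm_num

theorem adjacent_cases {e : Finset Plane} (he : e ∈ 𝓣.edges) :
    ((𝓣.adjacent e).card = 1 ∧
      ∀ f : Finset Plane → ℝ, ∑ t ∈ 𝓣.adjacent e, f t = f (𝓣.plus e)) ∨
    ((𝓣.adjacent e).card = 2 ∧ ∃ t, t ≠ 𝓣.plus e ∧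
      ∀ f : Finset Plane → ℝ, ∑ s ∈ 𝓣.adjacent e, f s = f (𝓣.plus e) + f t) := by
  classical
  rcases 𝓣.adjacent_eq he with h | ⟨t, hne, h⟩
  · left
    rw [h]
    simp
  · right
    have : 𝓣.adjacent e = {𝓣.plus e, t} := by
      ext s
      simp [h]
    rw [this]
    exact ⟨Finset.card_pair hne.symm, t, hne, fun f => Finset.sum_pair hne.symm⟩

/-- The jump of a square is twice the product of the jump and the average. -/
theorem sum_sgn_mul_sq {e : Finset Plane} (he : e ∈ 𝓣.edges) (a : Finset Plane → ℝ) :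
    ∑ t ∈ 𝓣.adjacent e, 𝓣.sgn e t * a t ^ 2
      = (∑ t ∈ 𝓣.adjacent e, 𝓣.sgn e t * a t) * ∑ t ∈ 𝓣.adjacent e, a t := by
  rcases 𝓣.adjacent_cases he with ⟨-, h⟩ | ⟨-, t, hne, h⟩
  · rw [h, h, h, sgn, if_pos rfl]
    ring
  · rw [h, h, h, sgn, sgn, if_pos rfl, if_neg hne]
    ring

theorem card_adjacent_pos {e : Finset Plane} (he : e ∈ 𝓣.edges) :
    (1 : ℝ) ≤ (𝓣.adjacent e).card := by
  rcases 𝓣.adjacent_cases he with ⟨h, -⟩ | ⟨h, -⟩ <;> rw [h] <;> norm_num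

theorem card_adjacent_le {e : Finset Plane} (he : e ∈ 𝓣.edges) :
    ((𝓣.adjacent e).card : ℝ) ≤ 2 := by
  rcases 𝓣.adjacent_cases he with ⟨h, -⟩ | ⟨h, -⟩ <;> rw [h] <;> norm_num

theorem sq_average_le {e : Finset Plane} (he : e ∈ 𝓣.edges) (a : Finset Plane → ℝ) :
    ((∑ t ∈ 𝓣.adjacent e, a t) / (𝓣.adjacent e).card) ^ 2 ≤ ∑ t ∈ 𝓣.adjacent e, a t ^ 2 := by
  have h1 := 𝓣.card_adjacent_pos he
  have h2 := sq_sum_le_card_mul_sum_sq (s := 𝓣.adjacent e) (f := a)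
  have h3 : 0 ≤ ∑ t ∈ 𝓣.adjacent e, a t ^ 2 := Finset.sum_nonneg fun t _ => sq_nonneg _
  rw [div_pow, div_le_iff₀ (by positivity)]
  nlinarith [mul_nonneg h3 (by linarith : (0 : ℝ) ≤ (𝓣.adjacent e).card)]

theorem cell_subset_closure {t : Finset Plane} (ht : t ∈ 𝓣.triangles) : cell t ⊆ closure Ω := by
  rw [← 𝓣.space_eq]
  exact 𝓣.complex.convexHull_subset_space (𝓣.mem_triangles.1 ht).1

theorem interior_cell_subset (hΩ : interior (closure Ω) = Ω) {t : Finset Plane}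
    (ht : t ∈ 𝓣.triangles) : interior (cell t) ⊆ Ω :=
  (interior_mono (𝓣.cell_subset_closure ht)).trans hΩ.subset

theorem ae_triMeasure_of_ae (hΩ : interior (closure Ω) = Ω) {t : Finset Plane}
    (ht : t ∈ 𝓣.triangles) {P : Plane → Prop} (h : ∀ᵐ x ∂(volume.restrict Ω), P x) :
    ∀ᵐ x ∂(triMeasure t), P x := by
  rw [triMeasure_eq]
  exact ae_mono (Measure.restrict_mono (𝓣.interior_cell_subset hΩ ht) le_rfl) h

end Triangulation

theorem sq_eLpNorm_two {α E : Type*} [MeasurableSpace α] [NormedAddCommGroup E] {μ : Measure α}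
    {f : α → E} (hf : MemLp f 2 μ) : eLpNorm f 2 μ ^ 2 = ENNReal.ofReal (∫ x, ‖f x‖ ^ 2 ∂μ) := by
  have h0 : 0 ≤ ∫ x, ‖f x‖ ^ 2 ∂μ := integral_nonneg fun x => by positivity
  rw [hf.eLpNorm_eq_integral_rpow_norm two_ne_zero ENNReal.ofNat_ne_top,
    ← ENNReal.ofReal_pow (by positivity)]
  congr 1
  simp only [ENNReal.toReal_ofNat, Real.rpow_ofNat]
  rw [← Real.rpow_natCast, ← Real.rpow_mul h0]
  norm_num

namespace Triangulation

variable {Ω : Set Plane} (𝓣 : Triangulation Ω)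

/-! ### The energy norm -/

/-- `∑_T ‖∇v‖²`. -/
def gradSq (v : Plane → ℝ) : ℝ := ∑ t ∈ 𝓣.triangles, ∫ x, ‖tgrad t v x‖ ^ 2 ∂(triMeasure t)

/-- `∑_T ‖v‖²`. -/
def l2Sq (v : Plane → ℝ) : ℝ := ∑ t ∈ 𝓣.triangles, ∫ x, ‖v x‖ ^ 2 ∂(triMeasure t)

/-- `∑_e h_e⁻¹ ‖[v]‖²`. -/
def jumpSq (v : Plane → ℝ) : ℝ :=
  ∑ e ∈ 𝓣.edges, (size e)⁻¹ * ∫ x, ‖𝓣.jump e v x‖ ^ 2 ∂(edgeMeasure e)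

/-- `∑_e h_e ‖{v}‖²`. -/
def avgSq (v : Plane → ℝ) : ℝ :=
  ∑ e ∈ 𝓣.edges, size e * ∫ x, ‖𝓣.avg e v x‖ ^ 2 ∂(edgeMeasure e)

/-- `∑_e h_e ‖{n·∇v}‖²`. -/
def normalSq (v : Plane → ℝ) : ℝ :=
  ∑ e ∈ 𝓣.edges, size e * ∫ x, ‖𝓣.avgNormal e v x‖ ^ 2 ∂(edgeMeasure e)

/-- The square of the energy norm as a real number. -/
def energy (σ : ℝ) (v : Plane → ℝ) : ℝ :=
  ∑ t ∈ 𝓣.triangles, (∫ x, ‖tgrad t v x‖ ^ 2 ∂(triMeasure t)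
    + (∑ e ∈ edgesOf t, σ / size e * ∫ x, ‖𝓣.jump e v x‖ ^ 2 ∂(edgeMeasure e))
    + ∑ e ∈ edgesOf t, size e / σ * ∫ x, ‖𝓣.avgNormal e v x‖ ^ 2 ∂(edgeMeasure e))

/-- On every triangle `v` is square integrable and has square integrable traces and normal
derivatives. -/
structure Regular (v : Plane → ℝ) : Prop where
  memLp : ∀ t ∈ 𝓣.triangles, MemLp v 2 (triMeasure t)
  hasL2Traces : 𝓣.HasL2Traces v

variable {𝓣}

theorem size_pos_of_mem_edges {e : Finset Plane} (he : e ∈ 𝓣.edges) : 0 < size e :=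
  size_pos (𝓣.mem_edges.1 he).2

theorem Regular.hasTraceGrad {v : Plane → ℝ} (hv : 𝓣.Regular v)
    {t : Finset Plane} (ht : t ∈ 𝓣.triangles) :
    HasTraceGrad t v (tgrad t v) (trace t v) := by
  obtain ⟨q, hq⟩ := (hv.hasL2Traces t ht).1
  exact (isTrace_trace hq).hasTraceGrad (hv.memLp t ht)

theorem Regular.memLp_trace {v : Plane → ℝ} (hv : 𝓣.Regular v)
    {e t : Finset Plane} (he : e ∈ 𝓣.edges) (ht : t ∈ 𝓣.adjacent e) :
    MemLp (trace t v) 2 (edgeMeasure e) :=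
  (hv.hasTraceGrad (𝓣.mem_adjacent.1 ht).1).memLp_trace e (𝓣.mem_edgesOf_of_mem_adjacent he ht)

theorem Regular.memLp_normalDeriv {v : Plane → ℝ} (hv : 𝓣.Regular v)
    {e t : Finset Plane} (he : e ∈ 𝓣.edges) (ht : t ∈ 𝓣.adjacent e) :
    MemLp (normalDeriv t v) 2 (edgeMeasure e) := by
  obtain ⟨q, hq⟩ := (hv.hasL2Traces t (𝓣.mem_adjacent.1 ht).1).2
  exact (isNormalDeriv_normalDeriv hq).1 e (𝓣.mem_edgesOf_of_mem_adjacent he ht)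

theorem Regular.memLp_jump {v : Plane → ℝ} (hv : 𝓣.Regular v)
    {e : Finset Plane} (he : e ∈ 𝓣.edges) :
    MemLp (𝓣.jump e v) 2 (edgeMeasure e) :=
  memLp_finsetSum _ fun _ ht => (hv.memLp_trace he ht).const_mul _

theorem Regular.memLp_avg {v : Plane → ℝ} (hv : 𝓣.Regular v)
    {e : Finset Plane} (he : e ∈ 𝓣.edges) :
    MemLp (𝓣.avg e v) 2 (edgeMeasure e) := by
  have := (memLp_finsetSum (𝓣.adjacent e) fun t ht => hv.memLp_trace he ht).mul_const
    (((𝓣.adjacent e).card : ℝ)⁻¹)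
  exact this.ae_eq (ae_of_all _ fun x => by simp [avg, div_eq_mul_inv])

theorem Regular.memLp_avgNormal {v : Plane → ℝ} (hv : 𝓣.Regular v)
    {e : Finset Plane} (he : e ∈ 𝓣.edges) :
    MemLp (𝓣.avgNormal e v) 2 (edgeMeasure e) := by
  have := (memLp_finsetSum (𝓣.adjacent e) fun t ht =>
    (hv.memLp_normalDeriv he ht).const_mul (𝓣.sgn e t)).mul_const (((𝓣.adjacent e).card : ℝ)⁻¹)
  exact this.ae_eq (ae_of_all _ fun x => by simp [avgNormal, div_eq_mul_inv])

theorem Regular.energyNorm_eq {v : Plane → ℝ} (hv : 𝓣.Regular v)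
    {σ : ℝ} (hσ : 0 < σ) :
    𝓣.energyNorm σ v = ENNReal.ofReal √(𝓣.energy σ v) := by
  have hG : ∀ t, 0 ≤ ∫ x, ‖tgrad t v x‖ ^ 2 ∂(triMeasure t) := fun t =>
    integral_nonneg fun x => by positivity
  have hJ : ∀ e, 0 ≤ σ / size e * ∫ x, ‖𝓣.jump e v x‖ ^ 2 ∂(edgeMeasure e) := fun e =>
    mul_nonneg (div_nonneg hσ.le Metric.diam_nonneg) (integral_nonneg fun x => by positivity)
  have hN : ∀ e, 0 ≤ size e / σ * ∫ x, ‖𝓣.avgNormal e v x‖ ^ 2 ∂(edgeMeasure e) := fun e =>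
    mul_nonneg (div_nonneg Metric.diam_nonneg hσ.le) (integral_nonneg fun x => by positivity)
  have hJs := fun t => Finset.sum_nonneg fun e (_ : e ∈ edgesOf t) => hJ e
  have hNs := fun t => Finset.sum_nonneg fun e (_ : e ∈ edgesOf t) => hN e
  rw [energyNorm, if_pos hv.hasL2Traces, Real.sqrt_eq_rpow,
    ← ENNReal.ofReal_rpow_of_nonneg (show 0 ≤ 𝓣.energy σ v from Finset.sum_nonneg fun t _ =>
      add_nonneg (add_nonneg (hG t) (hJs t)) (hNs t)) (by norm_num)]
  congr 1
  rw [energy, ENNReal.ofReal_sum_of_nonneg fun t _ =>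
      add_nonneg (add_nonneg (hG t) (hJs t)) (hNs t)]
  refine Finset.sum_congr rfl fun t ht => ?_
  rw [ENNReal.ofReal_add (add_nonneg (hG t) (hJs t)) (hNs t), ENNReal.ofReal_add (hG t) (hJs t),
    sq_eLpNorm_two (hv.hasTraceGrad ht).memLp_grad,
    ENNReal.ofReal_sum_of_nonneg fun e _ => hJ e, ENNReal.ofReal_sum_of_nonneg fun e _ => hN e]
  congr 1
  · congr 1
    refine Finset.sum_congr rfl fun e he => ?_
    rw [ENNReal.ofReal_mul (div_nonneg hσ.le (show 0 ≤ size e from Metric.diam_nonneg)),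
      sq_eLpNorm_two (hv.memLp_jump (𝓣.mem_edges_of_mem_edgesOf ht he))]
  · refine Finset.sum_congr rfl fun e he => ?_
    rw [ENNReal.ofReal_mul (div_nonneg (show 0 ≤ size e from Metric.diam_nonneg) hσ.le),
      sq_eLpNorm_two (hv.memLp_avgNormal (𝓣.mem_edges_of_mem_edgesOf ht he))]

variable (𝓣)

theorem gradSq_nonneg (v : Plane → ℝ) : 0 ≤ 𝓣.gradSq v :=
  Finset.sum_nonneg fun _ _ => integral_nonneg fun x => by positivity

theorem l2Sq_nonneg (v : Plane → ℝ) : 0 ≤ 𝓣.l2Sq v :=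
  Finset.sum_nonneg fun _ _ => integral_nonneg fun x => by positivity

theorem jumpSq_nonneg (v : Plane → ℝ) : 0 ≤ 𝓣.jumpSq v :=
  Finset.sum_nonneg fun _ _ => mul_nonneg (inv_nonneg.2 Metric.diam_nonneg)
    (integral_nonneg fun x => by positivity)

theorem avgSq_nonneg (v : Plane → ℝ) : 0 ≤ 𝓣.avgSq v :=
  Finset.sum_nonneg fun _ _ => mul_nonneg Metric.diam_nonneg
    (integral_nonneg fun x => by positivity)

theorem normalSq_nonneg (v : Plane → ℝ) : 0 ≤ 𝓣.normalSq v :=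
  Finset.sum_nonneg fun _ _ => mul_nonneg Metric.diam_nonneg
    (integral_nonneg fun x => by positivity)

/-- In the energy, the terms of an edge are counted once for every adjacent triangle. -/
theorem energy_eq (σ : ℝ) (v : Plane → ℝ) :
    𝓣.energy σ v = 𝓣.gradSq v
      + σ * (∑ e ∈ 𝓣.edges, (𝓣.adjacent e).card *
          ((size e)⁻¹ * ∫ x, ‖𝓣.jump e v x‖ ^ 2 ∂(edgeMeasure e)))
      + σ⁻¹ * ∑ e ∈ 𝓣.edges, (𝓣.adjacent e).card *
          (size e * ∫ x, ‖𝓣.avgNormal e v x‖ ^ 2 ∂(edgeMeasure e)) := by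
  rw [energy, Finset.sum_add_distrib, Finset.sum_add_distrib,
    𝓣.sum_triangles_edgesOf fun t e => σ / size e * ∫ x, ‖𝓣.jump e v x‖ ^ 2 ∂(edgeMeasure e),
    𝓣.sum_triangles_edgesOf fun t e => size e / σ * ∫ x, ‖𝓣.avgNormal e v x‖ ^ 2 ∂(edgeMeasure e),
    gradSq, Finset.mul_sum, Finset.mul_sum]
  simp only [Finset.sum_const, nsmul_eq_mul]
  congr 1
  · congr 1
    exact Finset.sum_congr rfl fun e _ => by ring
  · exact Finset.sum_congr rfl fun e _ => by ring

theorem le_energy {σ : ℝ} (hσ : 0 < σ) (v : Plane → ℝ) :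
    𝓣.gradSq v + σ * 𝓣.jumpSq v + σ⁻¹ * 𝓣.normalSq v ≤ 𝓣.energy σ v := by
  rw [energy_eq]
  refine add_le_add (add_le_add le_rfl (mul_le_mul_of_nonneg_left ?_ hσ.le))
    (mul_le_mul_of_nonneg_left ?_ (inv_nonneg.2 hσ.le))
  · exact Finset.sum_le_sum fun e he => le_mul_of_one_le_left
      (mul_nonneg (inv_nonneg.2 Metric.diam_nonneg) (integral_nonneg fun x => by positivity))
      (𝓣.card_adjacent_pos he)
  · exact Finset.sum_le_sum fun e he => le_mul_of_one_le_left
      (mul_nonneg Metric.diam_nonneg (integral_nonneg fun x => by positivity))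
      (𝓣.card_adjacent_pos he)

theorem energy_le {σ : ℝ} (hσ : 0 < σ) (v : Plane → ℝ) :
    𝓣.energy σ v ≤ 𝓣.gradSq v + σ * (2 * 𝓣.jumpSq v) + σ⁻¹ * (2 * 𝓣.normalSq v) := by
  rw [energy_eq, jumpSq, normalSq, Finset.mul_sum (a := 2), Finset.mul_sum (a := 2)]
  refine add_le_add (add_le_add le_rfl (mul_le_mul_of_nonneg_left ?_ hσ.le))
    (mul_le_mul_of_nonneg_left ?_ (inv_nonneg.2 hσ.le))
  · exact Finset.sum_le_sum fun e he => mul_le_mul_of_nonneg_right (𝓣.card_adjacent_le he)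
      (mul_nonneg (inv_nonneg.2 Metric.diam_nonneg) (integral_nonneg fun x => by positivity))
  · exact Finset.sum_le_sum fun e he => mul_le_mul_of_nonneg_right (𝓣.card_adjacent_le he)
      (mul_nonneg Metric.diam_nonneg (integral_nonneg fun x => by positivity))

/-! ### The broken Poincaré inequality -/

theorem size_le {R : ℝ} (hR : closure Ω ⊆ Metric.closedBall 0 R) {t : Finset Plane}
    (ht : t ∈ 𝓣.triangles) : size t ≤ 2 * R := by
  obtain ⟨p, hp⟩ : t.Nonempty := Finset.card_pos.1 (by rw [(𝓣.mem_triangles.1 ht).2]; norm_num)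
  have hpm := hR (𝓣.cell_subset_closure ht (subset_convexHull ℝ _ hp))
  have hR0 : 0 ≤ R := dist_nonneg.trans (Metric.mem_closedBall.1 hpm)
  exact (Metric.diam_mono ((𝓣.cell_subset_closure ht).trans hR) Metric.isBounded_closedBall).trans
    (Metric.diam_closedBall hR0)

theorem card_mul_avg {e : Finset Plane} (he : e ∈ 𝓣.edges) (v : Plane → ℝ) (x : Plane) :
    ∑ t ∈ 𝓣.adjacent e, trace t v x = (𝓣.adjacent e).card * 𝓣.avg e v x := by
  have := 𝓣.card_adjacent_pos he
  rw [avg, mul_div_cancel₀]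
  positivity

theorem cell_subset_of_mem_edges {e : Finset Plane} (he : e ∈ 𝓣.edges) : cell e ⊆ closure Ω := by
  have h := 𝓣.mem_adjacent.1 (𝓣.plus_mem_adjacent he)
  exact (cell_mono h.2).trans (𝓣.cell_subset_closure h.1)

variable {𝓣}

/-- The scaled trace inequality, summed over the triangulation. -/
theorem Regular.avgSq_le {v : Plane → ℝ} (hv : 𝓣.Regular v) {R K : ℝ}
    (hR : closure Ω ⊆ Metric.closedBall 0 R) (hK : 0 ≤ K) (hreg : 𝓣.ShapeRegular K) :
    𝓣.avgSq v ≤ 9 * K * 𝓣.l2Sq v + 12 * K * R ^ 2 * 𝓣.gradSq v := by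
  have htr : ∀ e ∈ 𝓣.edges, ∀ t ∈ 𝓣.adjacent e,
      Integrable (fun x => trace t v x ^ 2) (edgeMeasure e) := fun e he t ht =>
    (hv.memLp_trace he ht).integrable_sq
  calc 𝓣.avgSq v
      ≤ ∑ e ∈ 𝓣.edges, ∑ t ∈ 𝓣.adjacent e, size e * ∫ x, trace t v x ^ 2 ∂(edgeMeasure e) := by
        refine Finset.sum_le_sum fun e he => ?_
        rw [← Finset.mul_sum, ← integral_finsetSum _ (htr e he)]
        refine mul_le_mul_of_nonneg_left ?_ Metric.diam_nonneg
        refine integral_mono_of_nonneg (ae_of_all _ fun x => by positivity)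
          (integrable_finsetSum _ (htr e he)) (ae_of_all _ fun x => ?_)
        beta_reduce
        rw [Real.norm_eq_abs, sq_abs]
        exact 𝓣.sq_average_le he fun t => trace t v x
    _ = ∑ t ∈ 𝓣.triangles, ∑ e ∈ edgesOf t, size e * ∫ x, trace t v x ^ 2 ∂(edgeMeasure e) :=
        (𝓣.sum_triangles_edgesOf _).symm
    _ ≤ ∑ t ∈ 𝓣.triangles, ∑ e ∈ edgesOf t, K * (3 * ∫ x, ‖v x‖ ^ 2 ∂(triMeasure t)
          + 4 * R ^ 2 * ∫ x, ‖tgrad t v x‖ ^ 2 ∂(triMeasure t)) := by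
        refine Finset.sum_le_sum fun t ht => Finset.sum_le_sum fun e he => ?_
        obtain ⟨z, r, hr, hball, hsize⟩ := hreg t ht
        have h1 := (hv.hasTraceGrad ht).trace_inequality (𝓣.mem_triangles.1 ht).2
          (𝓣.affineIndependent ht) (𝓣.isOutward_of_mem_edgesOf ht) he hK hball hsize
        have h2 : size e * ∫ x, trace t v x ^ 2 ∂(edgeMeasure e)
            ≤ size t * ∫ x, trace t v x ^ 2 ∂(edgeMeasure e) :=
          mul_le_mul_of_nonneg_right (size_mono (subset_of_mem_edgesOf he))
            (integral_nonneg fun x => sq_nonneg _)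
        refine h2.trans (h1.trans (mul_le_mul_of_nonneg_left ?_ hK))
        simp only [Real.norm_eq_abs, sq_abs]
        have h3 : size t ^ 2 ≤ 4 * R ^ 2 := by
          have := 𝓣.size_le hR ht
          have h0 : 0 ≤ size t := Metric.diam_nonneg
          nlinarith
        exact add_le_add le_rfl (mul_le_mul_of_nonneg_right h3
          (integral_nonneg fun x => by positivity))
    _ = 9 * K * 𝓣.l2Sq v + 12 * K * R ^ 2 * 𝓣.gradSq v := by
        rw [l2Sq, gradSq, Finset.mul_sum, Finset.mul_sum, ← Finset.sum_add_distrib]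
        refine Finset.sum_congr rfl fun t ht => ?_
        rw [Finset.sum_const, edgesOf, Finset.card_powersetCard, (𝓣.mem_triangles.1 ht).2]
        norm_num [Nat.choose]
        ring

/-- Green's formula for the field `x₀ • e₀`, whose divergence is one, summed over the triangles. -/
theorem Regular.l2Sq_eq {v : Plane → ℝ} (hv : 𝓣.Regular v) :
    𝓣.l2Sq v = -(∑ t ∈ 𝓣.triangles, ∫ x, 2 * x 0 * v x *
          inner ℝ (tgrad t v x) (EuclideanSpace.single 0 (1 : ℝ)) ∂(triMeasure t))
      + ∑ e ∈ 𝓣.edges, ∫ x, inner ℝ (𝓣.normal e) (EuclideanSpace.single 0 (1 : ℝ)) * x 0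
          * (𝓣.jump e v x * ((𝓣.adjacent e).card * 𝓣.avg e v x)) ∂(edgeMeasure e) := by
  set d : Plane := EuclideanSpace.single 0 (1 : ℝ) with hd
  have hx0 : ContDiff ℝ ∞ (fun x : Plane => x 0) := by fun_prop
  have hf : ∀ x : Plane, fderiv ℝ (fun x : Plane => x 0) x d = 1 := by
    intro x
    have : HasFDerivAt (fun x : Plane => x 0) (EuclideanSpace.proj 0 : Plane →L[ℝ] ℝ) x :=
      (EuclideanSpace.proj 0 : Plane →L[ℝ] ℝ).hasFDerivAt
    rw [this.fderiv, hd]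
    simp
  have htri : ∀ t ∈ 𝓣.triangles, ∫ x, ‖v x‖ ^ 2 ∂(triMeasure t)
        + ∫ x, 2 * x 0 * v x * inner ℝ (tgrad t v x) d ∂(triMeasure t)
      = ∑ e ∈ edgesOf t, inner ℝ (𝓣.sgn e t • 𝓣.normal e) d *
          ∫ x, x 0 * trace t v x * trace t v x ∂(edgeMeasure e) := by
    intro t ht
    rw [← (hv.hasTraceGrad ht).green (𝓣.mem_triangles.1 ht).2 (𝓣.affineIndependent ht)
      (𝓣.isOutward_of_mem_edgesOf ht) hx0 d]
    congr 1
    refine integral_congr_ae (ae_of_all _ fun x => ?_)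
    beta_reduce
    rw [hf, Real.norm_eq_abs, sq_abs]
    ring
  have hedge : ∀ e ∈ 𝓣.edges, ∑ t ∈ 𝓣.adjacent e, inner ℝ (𝓣.sgn e t • 𝓣.normal e) d *
          ∫ x, x 0 * trace t v x * trace t v x ∂(edgeMeasure e)
      = ∫ x, inner ℝ (𝓣.normal e) d * x 0
          * (𝓣.jump e v x * ((𝓣.adjacent e).card * 𝓣.avg e v x)) ∂(edgeMeasure e) := by
    intro e he
    simp only [← integral_const_mul]
    rw [← integral_finsetSum]
    · refine integral_congr_ae (ae_of_all _ fun x => ?_)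
      beta_reduce
      rw [← 𝓣.card_mul_avg he, jump, ← 𝓣.sum_sgn_mul_sq he, Finset.mul_sum]
      refine Finset.sum_congr rfl fun t _ => ?_
      rw [inner_smul_left]
      simp only [conj_trivial]
      ring
    · intro t ht
      refine Integrable.const_mul ?_ _
      obtain ⟨C, hC⟩ := (isCompact_cell e).exists_bound_of_continuousOn hx0.continuous.continuousOn
      have := ((hv.memLp_trace he ht).integrable_sq).bdd_mul (c := C)
        hx0.continuous.aestronglyMeasurable (by
          filter_upwards [ae_edgeMeasure_mem e] with x hx using hC x hx)
      refine this.congr (ae_of_all _ fun x => ?_)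
      beta_reduce
      ring
  have h1 := Finset.sum_congr rfl htri
  rw [𝓣.sum_triangles_edgesOf fun t e => inner ℝ (𝓣.sgn e t • 𝓣.normal e) d *
    ∫ x, x 0 * trace t v x * trace t v x ∂(edgeMeasure e), Finset.sum_congr rfl hedge,
    Finset.sum_add_distrib] at h1
  rw [l2Sq]
  linarith

/-- The broken Poincaré inequality. -/
theorem Regular.l2Sq_le {v : Plane → ℝ} (hv : 𝓣.Regular v) {R K : ℝ} (hR0 : 0 < R)
    (hR : closure Ω ⊆ Metric.closedBall 0 R) (hK : 1 ≤ K) (hreg : 𝓣.ShapeRegular K) :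
    𝓣.l2Sq v ≤ 72 * K * R ^ 2 * (𝓣.gradSq v + 𝓣.jumpSq v) := by
  have hS := hv.avgSq_le hR (by linarith) hreg
  have hX0 := 𝓣.l2Sq_nonneg v
  have hG0 := 𝓣.gradSq_nonneg v
  have hJ0 := 𝓣.jumpSq_nonneg v
  have hS0 := 𝓣.avgSq_nonneg v
  have hd : ‖(EuclideanSpace.single 0 (1 : ℝ) : Plane)‖ = 1 := by simp
  have hx : ∀ x ∈ closure Ω, |x 0| ≤ R := by
    intro x hx
    have h1 := mem_closedBall_zero_iff.1 (hR hx)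
    exact (PiLp.norm_apply_le x 0).trans h1
  have e1 : |∑ t ∈ 𝓣.triangles, ∫ x, 2 * x 0 * v x *
          inner ℝ (tgrad t v x) (EuclideanSpace.single 0 (1 : ℝ)) ∂(triMeasure t)|
      ≤ 2 * R * (√(𝓣.l2Sq v) * √(𝓣.gradSq v)) := by
    have := abs_sum_integral_le 𝓣.triangles (μ := triMeasure) (f := fun _ => v)
      (g := fun t => tgrad t v) (K := 2 * R) (a := fun _ => 1) (fun _ _ => one_pos)
      (by positivity) (fun t ht => hv.memLp t ht) (fun t ht => (hv.hasTraceGrad ht).memLp_grad)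
      (h := fun t x => 2 * x 0 * v x *
          inner ℝ (tgrad t v x) (EuclideanSpace.single 0 (1 : ℝ))) ?_
    · simpa only [one_mul, inv_one, l2Sq, gradSq] using this
    · intro t ht
      filter_upwards [ae_triMeasure_mem t] with x hxt
      have h1 := hx x (𝓣.cell_subset_closure ht hxt)
      have h2 := abs_real_inner_le_norm (tgrad t v x) (EuclideanSpace.single 0 (1 : ℝ))
      rw [hd, mul_one] at h2
      rw [abs_mul, abs_mul, abs_mul, abs_two, Real.norm_eq_abs]
      calc 2 * |x 0| * |v x| * _ ≤ 2 * R * |v x| * ‖tgrad t v x‖ := by gcongr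
        _ = _ := by ring
  have e2 : |∑ e ∈ 𝓣.edges, ∫ x, inner ℝ (𝓣.normal e) (EuclideanSpace.single 0 (1 : ℝ)) * x 0
          * (𝓣.jump e v x * ((𝓣.adjacent e).card * 𝓣.avg e v x)) ∂(edgeMeasure e)|
      ≤ 2 * R * (√(𝓣.jumpSq v) * √(𝓣.avgSq v)) := by
    have := abs_sum_integral_le 𝓣.edges (μ := edgeMeasure) (f := fun e => 𝓣.jump e v)
      (g := fun e => 𝓣.avg e v) (K := 2 * R) (a := fun e => (size e)⁻¹)
      (fun e he => inv_pos.2 (size_pos_of_mem_edges he))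
      (by positivity) (fun e he => hv.memLp_jump he) (fun e he => hv.memLp_avg he)
      (h := fun e x => inner ℝ (𝓣.normal e) (EuclideanSpace.single 0 (1 : ℝ)) * x 0
          * (𝓣.jump e v x * ((𝓣.adjacent e).card * 𝓣.avg e v x))) ?_
    · simpa only [inv_inv, jumpSq, avgSq] using this
    · intro e he
      filter_upwards [ae_edgeMeasure_mem e] with x hxe
      have h1 := hx x (𝓣.cell_subset_of_mem_edges he hxe)
      have h2 := abs_real_inner_le_norm (𝓣.normal e) (EuclideanSpace.single 0 (1 : ℝ))
      rw [hd, mul_one, 𝓣.norm_normal e (𝓣.mem_edges.1 he).1 (𝓣.mem_edges.1 he).2] at h2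
      have h3 := 𝓣.card_adjacent_le he
      rw [abs_mul, abs_mul, abs_mul, abs_mul, Nat.abs_cast, Real.norm_eq_abs, Real.norm_eq_abs]
      calc _ ≤ 1 * R * (|𝓣.jump e v x| * (2 * |𝓣.avg e v x|)) := by gcongr
        _ = _ := by ring
  have key := hv.l2Sq_eq
  have h1 := (abs_le.1 e1).1
  have h2 := (abs_le.1 e2).2
  have h3 : 2 * R * (√(𝓣.l2Sq v) * √(𝓣.gradSq v)) ≤ 𝓣.l2Sq v / 4 + 4 * R ^ 2 * 𝓣.gradSq v := by
    have a1 := Real.sq_sqrt hX0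
    have a2 := Real.sq_sqrt hG0
    nlinarith [sq_nonneg (√(𝓣.l2Sq v) / 2 - 2 * R * √(𝓣.gradSq v))]
  -- the weight `36 * K` makes the trace inequality return at most a quarter of `l2Sq`
  have h4 : 2 * R * (√(𝓣.jumpSq v) * √(𝓣.avgSq v))
      ≤ 𝓣.avgSq v / (36 * K) + 36 * K * R ^ 2 * 𝓣.jumpSq v := by
    have a1 := Real.sq_sqrt hJ0
    have a2 := Real.sq_sqrt hS0
    have hK0 : 0 < 36 * K := by linarith
    rw [div_add' _ _ _ hK0.ne', le_div_iff₀ hK0]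
    have e : (√(𝓣.avgSq v) - 36 * K * R * √(𝓣.jumpSq v)) ^ 2
        = 𝓣.avgSq v - 2 * R * (√(𝓣.jumpSq v) * √(𝓣.avgSq v)) * (36 * K)
          + 36 * K * R ^ 2 * 𝓣.jumpSq v * (36 * K) := by
      linear_combination a2 + (36 * K * R) ^ 2 * a1
    linarith [sq_nonneg (√(𝓣.avgSq v) - 36 * K * R * √(𝓣.jumpSq v))]
  have h5 : 𝓣.avgSq v / (36 * K) ≤ 𝓣.l2Sq v / 4 + R ^ 2 * 𝓣.gradSq v / 3 := by
    rw [div_le_iff₀ (by linarith)]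
    linarith
  have h6 : R ^ 2 * 𝓣.gradSq v ≤ K * (R ^ 2 * 𝓣.gradSq v) :=
    le_mul_of_one_le_left (by positivity) hK
  have h7 : 0 ≤ K * (R ^ 2 * 𝓣.gradSq v) := by positivity
  nlinarith

end Triangulation

namespace Triangulation

variable {Ω : Set Plane} {𝓣 : Triangulation Ω}

/-! ### Boundedness -/

theorem memLp_of_memSum (hΩ : interior (closure Ω) = Ω) {ζ : Plane → Plane} {γ w : Plane → ℝ}
    (hw : 𝓣.MemSum ζ γ w) {t : Finset Plane} (ht : t ∈ 𝓣.triangles) :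
    MemLp w 2 (triMeasure t) := by
  obtain ⟨y, v, hy, hv, hwv⟩ := hw
  obtain ⟨l, hl⟩ := hv t ht
  have h1 : MemLp y 2 (triMeasure t) := by
    rw [triMeasure_eq]
    exact hy.1.1.mono_measure (Measure.restrict_mono (𝓣.interior_cell_subset hΩ ht) le_rfl)
  have h2 : MemLp v 2 (triMeasure t) :=
    (memLp_triMeasure t l.continuous_of_finiteDimensional).ae_eq hl.symm
  exact (h1.add h2).ae_eq (EventuallyEq.symm (𝓣.ae_triMeasure_of_ae hΩ ht hwv))

/-- A constant, at least one, for the bounds of `l2Sq` and `avgSq` by `gradSq + jumpSq`. With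
`l2Sq ≤ 72 K R² (gradSq + jumpSq)`, the trace inequality gives `9 K * 72 K R² + 12 K R²` for
`avgSq`, which is at most `660 K² R²`. -/
def poincareConst (K R : ℝ) : ℝ := 660 * K ^ 2 * R ^ 2 + 1

theorem one_le_poincareConst (K R : ℝ) : 1 ≤ poincareConst K R := by
  rw [poincareConst]
  nlinarith [mul_nonneg (sq_nonneg K) (sq_nonneg R)]

theorem Regular.l2Sq_le_poincareConst {v : Plane → ℝ} (hv : 𝓣.Regular v) {R K : ℝ} (hR0 : 0 < R)
    (hR : closure Ω ⊆ Metric.closedBall 0 R) (hK : 1 ≤ K) (hreg : 𝓣.ShapeRegular K) :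
    𝓣.l2Sq v ≤ poincareConst K R * (𝓣.gradSq v + 𝓣.jumpSq v) := by
  refine (hv.l2Sq_le hR0 hR hK hreg).trans (mul_le_mul_of_nonneg_right ?_
    (add_nonneg (𝓣.gradSq_nonneg v) (𝓣.jumpSq_nonneg v)))
  have h1 : K * R ^ 2 ≤ K ^ 2 * R ^ 2 := by gcongr; nlinarith
  have h2 : 0 ≤ K ^ 2 * R ^ 2 := by positivity
  rw [poincareConst]
  linarith

theorem Regular.avgSq_le_poincareConst {v : Plane → ℝ} (hv : 𝓣.Regular v) {R K : ℝ} (hR0 : 0 < R)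
    (hR : closure Ω ⊆ Metric.closedBall 0 R) (hK : 1 ≤ K) (hreg : 𝓣.ShapeRegular K) :
    𝓣.avgSq v ≤ poincareConst K R * (𝓣.gradSq v + 𝓣.jumpSq v) := by
  have h1 : K * R ^ 2 ≤ K ^ 2 * R ^ 2 := by gcongr; nlinarith
  have hG := 𝓣.gradSq_nonneg v
  have hJ := 𝓣.jumpSq_nonneg v
  calc 𝓣.avgSq v ≤ 9 * K * 𝓣.l2Sq v + 12 * K * R ^ 2 * 𝓣.gradSq v :=
        hv.avgSq_le hR (by linarith) hreg
    _ ≤ 9 * K * (72 * K * R ^ 2 * (𝓣.gradSq v + 𝓣.jumpSq v))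
          + 12 * (K ^ 2 * R ^ 2) * (𝓣.gradSq v + 𝓣.jumpSq v) := by
        refine add_le_add (mul_le_mul_of_nonneg_left (hv.l2Sq_le hR0 hR hK hreg) (by linarith)) ?_
        exact mul_le_mul (by linarith) (by linarith) hG (by positivity)
    _ ≤ _ := by
        rw [poincareConst]
        linarith

theorem Regular.abs_aSip_le {w v : Plane → ℝ} (hw : 𝓣.Regular w) (hv : 𝓣.Regular v) {σ : ℝ}
    (hσ : 0 < σ) : |𝓣.aSip σ w v| ≤ 4 * (√(𝓣.energy σ w) * √(𝓣.energy σ v)) := by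
  have hEw := 𝓣.le_energy hσ w
  have hEv := 𝓣.le_energy hσ v
  have hpos : ∀ u, 0 ≤ 𝓣.gradSq u ∧ 0 ≤ σ * 𝓣.jumpSq u ∧ 0 ≤ σ⁻¹ * 𝓣.normalSq u := fun u =>
    ⟨𝓣.gradSq_nonneg u, mul_nonneg hσ.le (𝓣.jumpSq_nonneg u),
      mul_nonneg (inv_nonneg.2 hσ.le) (𝓣.normalSq_nonneg u)⟩
  obtain ⟨gw, jw, nw⟩ := hpos w
  obtain ⟨gv, jv, nv⟩ := hpos v
  have h1 : |∑ t ∈ 𝓣.triangles, ∫ x, inner ℝ (tgrad t w x) (tgrad t v x) ∂(triMeasure t)|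
      ≤ √(𝓣.energy σ w) * √(𝓣.energy σ v) := by
    have := abs_sum_integral_le 𝓣.triangles (μ := triMeasure) (f := fun t => tgrad t w)
      (g := fun t => tgrad t v) (K := 1) (a := fun _ => 1)
      (h := fun t x => inner ℝ (tgrad t w x) (tgrad t v x)) (fun _ _ => one_pos)
      zero_le_one (fun t ht => (hw.hasTraceGrad ht).memLp_grad)
      (fun t ht => (hv.hasTraceGrad ht).memLp_grad)
      (fun t _ => ae_of_all _ fun x => by rw [one_mul]; exact abs_real_inner_le_norm _ _)
    simp only [one_mul, inv_one] at this
    exact this.trans (mul_le_mul (Real.sqrt_le_sqrt (show 𝓣.gradSq w ≤ _ by linarith))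
      (Real.sqrt_le_sqrt (show 𝓣.gradSq v ≤ _ by linarith)) (Real.sqrt_nonneg _)
      (Real.sqrt_nonneg _))
  have hNJ : ∀ u u', 𝓣.Regular u → 𝓣.Regular u' →
      |∑ e ∈ 𝓣.edges, ∫ x, 𝓣.avgNormal e u x * 𝓣.jump e u' x ∂(edgeMeasure e)|
        ≤ √(σ⁻¹ * 𝓣.normalSq u) * √(σ * 𝓣.jumpSq u') := by
    intro u u' hu hu'
    have := abs_sum_integral_le 𝓣.edges (μ := edgeMeasure) (f := fun e => 𝓣.avgNormal e u)
      (g := fun e => 𝓣.jump e u') (K := 1) (a := fun e => size e)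
      (h := fun e x => 𝓣.avgNormal e u x * 𝓣.jump e u' x)
      (fun e he => size_pos_of_mem_edges he)
      zero_le_one (fun e he => hu.memLp_avgNormal he) (fun e he => hu'.memLp_jump he)
      (fun t _ => ae_of_all _ fun x => by rw [one_mul, abs_mul]; rfl)
    rw [one_mul] at this
    refine this.trans_eq ?_
    rw [Real.sqrt_mul (inv_nonneg.2 hσ.le), Real.sqrt_mul hσ.le, Real.sqrt_inv, normalSq, jumpSq]
    have : √σ ≠ 0 := (Real.sqrt_pos.2 hσ).ne'
    field_simp
  have h2 := (hNJ w v hw hv).trans (mul_le_mul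
    (Real.sqrt_le_sqrt (show _ ≤ 𝓣.energy σ w by linarith))
    (Real.sqrt_le_sqrt (show _ ≤ 𝓣.energy σ v by linarith)) (Real.sqrt_nonneg _)
    (Real.sqrt_nonneg _))
  have h3 := (hNJ v w hv hw).trans (mul_le_mul
    (Real.sqrt_le_sqrt (show _ ≤ 𝓣.energy σ v by linarith))
    (Real.sqrt_le_sqrt (show _ ≤ 𝓣.energy σ w by linarith)) (Real.sqrt_nonneg _)
    (Real.sqrt_nonneg _))
  have h4 : |σ * ∑ e ∈ 𝓣.edges, (size e)⁻¹ * ∫ x, 𝓣.jump e w x * 𝓣.jump e v x ∂(edgeMeasure e)|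
      ≤ √(𝓣.energy σ w) * √(𝓣.energy σ v) := by
    have := abs_sum_integral_le 𝓣.edges (μ := edgeMeasure) (f := fun e => 𝓣.jump e w)
      (g := fun e x => (size e)⁻¹ * 𝓣.jump e v x) (K := 1) (a := fun e => (size e)⁻¹)
      (h := fun e x => (size e)⁻¹ * (𝓣.jump e w x * 𝓣.jump e v x))
      (fun e he => inv_pos.2 (size_pos_of_mem_edges he))
      zero_le_one (fun e he => hw.memLp_jump he) (fun e he => (hv.memLp_jump he).const_mul _)
      (fun t _ => ae_of_all _ fun x => by
        rw [one_mul, ← norm_mul, ← Real.norm_eq_abs]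
        exact le_of_eq (congrArg _ (by ring)))
    simp only [integral_const_mul, norm_mul, mul_pow] at this
    rw [one_mul, Finset.sum_congr (f := fun e => (size e)⁻¹⁻¹ *
      (‖(size e)⁻¹‖ ^ 2 * ∫ x, ‖𝓣.jump e v x‖ ^ 2 ∂(edgeMeasure e)))
      (g := fun e => (size e)⁻¹ * ∫ x, ‖𝓣.jump e v x‖ ^ 2 ∂(edgeMeasure e)) rfl fun e he => by
        have := (size_pos_of_mem_edges he).ne'
        rw [Real.norm_eq_abs, sq_abs]
        field_simp] at this
    rw [abs_mul, abs_of_pos hσ]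
    calc _ ≤ σ * (√(𝓣.jumpSq w) * √(𝓣.jumpSq v)) := mul_le_mul_of_nonneg_left this hσ.le
      _ = √(σ * 𝓣.jumpSq w) * √(σ * 𝓣.jumpSq v) := by
          rw [Real.sqrt_mul hσ.le, Real.sqrt_mul hσ.le]
          linear_combination (-(√(𝓣.jumpSq w) * √(𝓣.jumpSq v))) * Real.sq_sqrt hσ.le
      _ ≤ _ := mul_le_mul (Real.sqrt_le_sqrt (by linarith)) (Real.sqrt_le_sqrt (by linarith))
          (Real.sqrt_nonneg _) (Real.sqrt_nonneg _)
  rw [aSip]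
  rw [abs_le] at h1 h2 h3 h4 ⊢
  constructor <;> linarith

open scoped Classical in
theorem interior_union_inflow_subset (ζ : Plane → Plane) :
    𝓣.interiorEdges ∪ 𝓣.inflowEdges ζ ⊆ 𝓣.edges :=
  Finset.union_subset (Finset.filter_subset _ _)
    ((Finset.filter_subset _ _).trans (Finset.filter_subset _ _))

theorem Regular.abs_aAr_le {w v : Plane → ℝ} (hw : 𝓣.Regular w) (hv : 𝓣.Regular v)
    {ζ : Plane → Plane} {γ : Plane → ℝ} {M : ℝ} (hM : 0 ≤ M) (hζ : ∀ x ∈ closure Ω, ‖ζ x‖ ≤ M)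
    (hγ : ∀ t ∈ 𝓣.triangles, ∀ᵐ x ∂(triMeasure t), |γ x| ≤ M) :
    |𝓣.aAr ζ γ w v| ≤ M * (√(2 * 𝓣.gradSq w + 2 * 𝓣.l2Sq w) * √(𝓣.l2Sq v))
      + M * (√(𝓣.jumpSq w) * √(𝓣.avgSq v)) := by
  classical
  have h1 : |∑ t ∈ 𝓣.triangles,
        ∫ x, (inner ℝ (ζ x) (tgrad t w x) + γ x * w x) * v x ∂(triMeasure t)|
      ≤ M * (√(2 * 𝓣.gradSq w + 2 * 𝓣.l2Sq w) * √(𝓣.l2Sq v)) := by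
    have hm : ∀ t ∈ 𝓣.triangles, MemLp (fun x => ‖tgrad t w x‖ + ‖w x‖) 2 (triMeasure t) :=
      fun t ht => (hw.hasTraceGrad ht).memLp_grad.norm.add (hw.memLp t ht).norm
    have := abs_sum_integral_le 𝓣.triangles (μ := triMeasure)
      (f := fun t x => ‖tgrad t w x‖ + ‖w x‖)
      (g := fun _ => v) (K := M) (a := fun _ => 1)
      (h := fun t x => (inner ℝ (ζ x) (tgrad t w x) + γ x * w x) * v x) (fun _ _ => one_pos)
      hM hm (fun t ht => hv.memLp t ht) ?_
    · simp only [one_mul, inv_one] at this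
      refine this.trans (mul_le_mul_of_nonneg_left (mul_le_mul_of_nonneg_right
        (Real.sqrt_le_sqrt ?_) (Real.sqrt_nonneg _)) hM)
      rw [gradSq, l2Sq, Finset.mul_sum, Finset.mul_sum, ← Finset.sum_add_distrib]
      refine Finset.sum_le_sum fun t ht => ?_
      have i1 := (hw.hasTraceGrad ht).memLp_grad.norm.integrable_sq
      have i2 := (hw.memLp t ht).norm.integrable_sq
      rw [← integral_const_mul, ← integral_const_mul,
        ← integral_add (i1.const_mul 2) (i2.const_mul 2)]
      refine integral_mono_of_nonneg (ae_of_all _ fun x => by positivity)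
        ((i1.const_mul 2).add (i2.const_mul 2)) (ae_of_all _ fun x => ?_)
      beta_reduce
      rw [Real.norm_eq_abs, sq_abs]
      nlinarith [sq_nonneg (‖tgrad t w x‖ - ‖w x‖)]
    · intro t ht
      filter_upwards [hγ t ht, ae_triMeasure_mem t] with x hx hxt
      have hz := hζ x (𝓣.cell_subset_closure ht hxt)
      rw [abs_mul, Real.norm_of_nonneg (add_nonneg (norm_nonneg _) (norm_nonneg _)), ← mul_assoc]
      refine mul_le_mul_of_nonneg_right ?_ (abs_nonneg _)
      calc _ ≤ |inner ℝ (ζ x) (tgrad t w x)| + |γ x * w x| := abs_add_le _ _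
        _ ≤ ‖ζ x‖ * ‖tgrad t w x‖ + |γ x| * ‖w x‖ := by
            rw [abs_mul]
            exact add_le_add (abs_real_inner_le_norm _ _) le_rfl
        _ ≤ M * ‖tgrad t w x‖ + M * ‖w x‖ := by gcongr
        _ = _ := by ring
  have h2 : |∑ e ∈ 𝓣.interiorEdges ∪ 𝓣.inflowEdges ζ,
        ∫ x, inner ℝ (𝓣.normal e) (ζ x) * 𝓣.jump e w x * 𝓣.avg e v x ∂(edgeMeasure e)|
      ≤ M * (√(𝓣.jumpSq w) * √(𝓣.avgSq v)) := by
    have hsub := 𝓣.interior_union_inflow_subset ζ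
    have := abs_sum_integral_le (𝓣.interiorEdges ∪ 𝓣.inflowEdges ζ) (μ := edgeMeasure)
      (f := fun e => 𝓣.jump e w)
      (g := fun e => 𝓣.avg e v) (K := M) (a := fun e => (size e)⁻¹)
      (h := fun e x => inner ℝ (𝓣.normal e) (ζ x) * 𝓣.jump e w x * 𝓣.avg e v x)
      (fun e he => inv_pos.2 (size_pos_of_mem_edges (hsub he)))
      hM (fun e he => hw.memLp_jump (hsub he)) (fun e he => hv.memLp_avg (hsub he)) ?_
    · simp only [inv_inv] at this
      refine this.trans (mul_le_mul_of_nonneg_left (mul_le_mul (Real.sqrt_le_sqrt ?_)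
        (Real.sqrt_le_sqrt ?_) (Real.sqrt_nonneg _) (Real.sqrt_nonneg _)) hM)
      · exact Finset.sum_le_sum_of_subset_of_nonneg hsub fun e _ _ =>
          mul_nonneg (inv_nonneg.2 Metric.diam_nonneg) (integral_nonneg fun x => by positivity)
      · exact Finset.sum_le_sum_of_subset_of_nonneg hsub fun e _ _ =>
          mul_nonneg Metric.diam_nonneg (integral_nonneg fun x => by positivity)
    · intro e he
      filter_upwards [ae_edgeMeasure_mem e] with x hxe
      have he' := 𝓣.mem_edges.1 (hsub he)
      have hz := hζ x (𝓣.cell_subset_of_mem_edges (hsub he) hxe)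
      have hn := abs_real_inner_le_norm (𝓣.normal e) (ζ x)
      rw [𝓣.norm_normal e he'.1 he'.2, one_mul] at hn
      rw [abs_mul, abs_mul, Real.norm_eq_abs, Real.norm_eq_abs, mul_assoc]
      gcongr
      exact hn.trans hz
  rw [aAr]
  rw [abs_le] at h1 h2 ⊢
  constructor <;> linarith

theorem Regular.abs_aForm_le {w v : Plane → ℝ} (hw : 𝓣.Regular w) (hv : 𝓣.Regular v)
    {ζ : Plane → Plane} {γ : Plane → ℝ} {σ R K M : ℝ} (hσ : 1 ≤ σ) (hR0 : 0 < R)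
    (hR : closure Ω ⊆ Metric.closedBall 0 R) (hK : 1 ≤ K) (hreg : 𝓣.ShapeRegular K)
    (hM : 0 ≤ M) (hζ : ∀ x ∈ closure Ω, ‖ζ x‖ ≤ M)
    (hγ : ∀ t ∈ 𝓣.triangles, ∀ᵐ x ∂(triMeasure t), |γ x| ≤ M) :
    |𝓣.aForm σ ζ γ w v|
      ≤ (4 + 3 * M * poincareConst K R) * (√(𝓣.energy σ w) * √(𝓣.energy σ v)) := by
  set B := poincareConst K R with hB
  have hσ0 : 0 < σ := by linarith
  have hB1 : 1 ≤ B := one_le_poincareConst K R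
  have hE : ∀ u, 𝓣.gradSq u + 𝓣.jumpSq u ≤ 𝓣.energy σ u := by
    intro u
    have h1 := 𝓣.le_energy hσ0 u
    have h2 := mul_nonneg (inv_nonneg.2 hσ0.le) (𝓣.normalSq_nonneg u)
    have h3 := le_mul_of_one_le_left (𝓣.jumpSq_nonneg u) hσ
    linarith
  have hgw := 𝓣.gradSq_nonneg w
  have hgv := 𝓣.gradSq_nonneg v
  have hjw := 𝓣.jumpSq_nonneg w
  have hjv := 𝓣.jumpSq_nonneg v
  have hEw := hE w
  have hEv := hE v
  have hEw0 : 0 ≤ 𝓣.energy σ w := by linarith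
  have hEv0 : 0 ≤ 𝓣.energy σ v := by linarith
  have hBE : ∀ u, B * (𝓣.gradSq u + 𝓣.jumpSq u) ≤ B ^ 2 * 𝓣.energy σ u := by
    intro u
    have h1 : 0 ≤ 𝓣.gradSq u + 𝓣.jumpSq u := add_nonneg (𝓣.gradSq_nonneg u) (𝓣.jumpSq_nonneg u)
    exact mul_le_mul (by nlinarith) (hE u) h1 (by positivity)
  have s1 : √(2 * 𝓣.gradSq w + 2 * 𝓣.l2Sq w) ≤ 2 * √(𝓣.energy σ w) * √B := by
    have : 2 * √(𝓣.energy σ w) * √B = √(4 * 𝓣.energy σ w * B) := by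
      rw [Real.sqrt_mul (by positivity), Real.sqrt_mul (by norm_num),
        show (4 : ℝ) = 2 ^ 2 by norm_num, Real.sqrt_sq (by norm_num)]
    rw [this]
    have h1 := hw.l2Sq_le_poincareConst hR0 hR hK hreg
    have h2 : 𝓣.gradSq w ≤ B * 𝓣.energy σ w := by nlinarith
    have h3 : B * (𝓣.gradSq w + 𝓣.jumpSq w) ≤ B * 𝓣.energy σ w :=
      mul_le_mul_of_nonneg_left hEw (by linarith)
    exact Real.sqrt_le_sqrt (by linarith)
  have s2 : √(𝓣.l2Sq v) ≤ √B * √(𝓣.energy σ v) := by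
    rw [← Real.sqrt_mul (by linarith)]
    exact Real.sqrt_le_sqrt ((hv.l2Sq_le_poincareConst hR0 hR hK hreg).trans
      (mul_le_mul_of_nonneg_left hEv (by linarith)))
  have s3 : √(𝓣.jumpSq w) ≤ √(𝓣.energy σ w) := Real.sqrt_le_sqrt (by linarith)
  have s4 : √(𝓣.avgSq v) ≤ B * √(𝓣.energy σ v) := by
    rw [← Real.sqrt_sq (show 0 ≤ B by linarith), ← Real.sqrt_mul (by positivity)]
    exact Real.sqrt_le_sqrt ((hv.avgSq_le_poincareConst hR0 hR hK hreg).trans (hBE v))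
  have h1 := hw.abs_aSip_le hv hσ0
  have h2 := hw.abs_aAr_le hv hM hζ hγ
  have h3 : √(2 * 𝓣.gradSq w + 2 * 𝓣.l2Sq w) * √(𝓣.l2Sq v)
      ≤ 2 * B * (√(𝓣.energy σ w) * √(𝓣.energy σ v)) := by
    calc _ ≤ (2 * √(𝓣.energy σ w) * √B) * (√B * √(𝓣.energy σ v)) := by gcongr
      _ = 2 * (√B * √B) * (√(𝓣.energy σ w) * √(𝓣.energy σ v)) := by ring
      _ = _ := by rw [Real.mul_self_sqrt (by linarith)]
  have h4 : √(𝓣.jumpSq w) * √(𝓣.avgSq v) ≤ B * (√(𝓣.energy σ w) * √(𝓣.energy σ v)) := by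
    calc _ ≤ √(𝓣.energy σ w) * (B * √(𝓣.energy σ v)) := by gcongr
      _ = _ := by ring
  have h5 := mul_le_mul_of_nonneg_left h3 hM
  have h6 := mul_le_mul_of_nonneg_left h4 hM
  have h7 := abs_add_le (𝓣.aSip σ w v) (𝓣.aAr ζ γ w v)
  rw [aForm]
  linarith

theorem ae_eq_zero_of_integral_sq {α E : Type*} [MeasurableSpace α] [NormedAddCommGroup E]
    {μ : Measure α} {f : α → E} (hf : MemLp f 2 μ) (h : ∫ x, ‖f x‖ ^ 2 ∂μ = 0) : f =ᵐ[μ] 0 := by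
  have := (integral_eq_zero_iff_of_nonneg (fun x => by positivity) hf.norm.integrable_sq).1 h
  filter_upwards [this] with x hx
  simpa using hx

/-- A function of energy zero, together with all the data that enter the bilinear form, vanishes
almost everywhere. Thus the form vanishes, whatever the traces of the other function are. -/
theorem Regular.aForm_eq_zero {w : Plane → ℝ} (hw : 𝓣.Regular w)
    {σ R K : ℝ} (hσ : 0 < σ) (hR0 : 0 < R)
    (hR : closure Ω ⊆ Metric.closedBall 0 R) (hK : 1 ≤ K) (hreg : 𝓣.ShapeRegular K)
    (h0 : 𝓣.energy σ w = 0) (ζ : Plane → Plane) (γ v : Plane → ℝ) :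
    𝓣.aForm σ ζ γ w v = 0 ∧ 𝓣.aForm σ ζ γ v w = 0 := by
  have hE := 𝓣.le_energy hσ w
  have hG0 := 𝓣.gradSq_nonneg w
  have hJ0 := mul_nonneg hσ.le (𝓣.jumpSq_nonneg w)
  have hN0 := mul_nonneg (inv_nonneg.2 hσ.le) (𝓣.normalSq_nonneg w)
  have hG : 𝓣.gradSq w = 0 := by linarith
  have hJ : 𝓣.jumpSq w = 0 := by
    have : σ * 𝓣.jumpSq w = 0 := by linarith
    simpa [hσ.ne'] using this
  have hN : 𝓣.normalSq w = 0 := by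
    have : σ⁻¹ * 𝓣.normalSq w = 0 := by linarith
    simpa [hσ.ne'] using this
  have hL : 𝓣.l2Sq w = 0 := by
    have := hw.l2Sq_le_poincareConst hR0 hR hK hreg
    rw [hG, hJ, add_zero, mul_zero] at this
    exact le_antisymm this (𝓣.l2Sq_nonneg w)
  have hA : 𝓣.avgSq w = 0 := by
    have := hw.avgSq_le_poincareConst hR0 hR hK hreg
    rw [hG, hJ, add_zero, mul_zero] at this
    exact le_antisymm this (𝓣.avgSq_nonneg w)
  have tG : ∀ t ∈ 𝓣.triangles, tgrad t w =ᵐ[triMeasure t] 0 := fun t ht =>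
    ae_eq_zero_of_integral_sq (hw.hasTraceGrad ht).memLp_grad
      ((Finset.sum_eq_zero_iff_of_nonneg fun t _ => integral_nonneg fun x => by positivity).1
        hG t ht)
  have tL : ∀ t ∈ 𝓣.triangles, w =ᵐ[triMeasure t] 0 := fun t ht =>
    ae_eq_zero_of_integral_sq (hw.memLp t ht)
      ((Finset.sum_eq_zero_iff_of_nonneg fun t _ => integral_nonneg fun x => by positivity).1
        hL t ht)
  have eJ : ∀ e ∈ 𝓣.edges, 𝓣.jump e w =ᵐ[edgeMeasure e] 0 := fun e he =>
    ae_eq_zero_of_integral_sq (hw.memLp_jump he) <| by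
      have := (Finset.sum_eq_zero_iff_of_nonneg fun e _ => mul_nonneg
        (inv_nonneg.2 Metric.diam_nonneg) (integral_nonneg fun x => by positivity)).1 hJ e he
      exact (mul_eq_zero.1 this).resolve_left (inv_pos.2 (size_pos_of_mem_edges he)).ne'
  have eN : ∀ e ∈ 𝓣.edges, 𝓣.avgNormal e w =ᵐ[edgeMeasure e] 0 := fun e he =>
    ae_eq_zero_of_integral_sq (hw.memLp_avgNormal he) <| by
      have := (Finset.sum_eq_zero_iff_of_nonneg fun e _ => mul_nonneg
        Metric.diam_nonneg (integral_nonneg fun x => by positivity)).1 hN e he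
      exact (mul_eq_zero.1 this).resolve_left (size_pos_of_mem_edges he).ne'
  have eA : ∀ e ∈ 𝓣.edges, 𝓣.avg e w =ᵐ[edgeMeasure e] 0 := fun e he =>
    ae_eq_zero_of_integral_sq (hw.memLp_avg he) <| by
      have := (Finset.sum_eq_zero_iff_of_nonneg fun e _ => mul_nonneg
        Metric.diam_nonneg (integral_nonneg fun x => by positivity)).1 hA e he
      exact (mul_eq_zero.1 this).resolve_left (size_pos_of_mem_edges he).ne'
  have hsub := 𝓣.interior_union_inflow_subset ζ
  constructor
  · have a1 : ∑ t ∈ 𝓣.triangles, ∫ x, inner ℝ (tgrad t w x) (tgrad t v x) ∂(triMeasure t) = 0 :=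
      Finset.sum_eq_zero fun t ht => integral_eq_zero_of_ae <| by
        filter_upwards [tG t ht] with x hx
        simp [hx]
    have a2 : ∑ e ∈ 𝓣.edges, ∫ x, 𝓣.avgNormal e w x * 𝓣.jump e v x ∂(edgeMeasure e) = 0 :=
      Finset.sum_eq_zero fun e he => integral_eq_zero_of_ae <| by
        filter_upwards [eN e he] with x hx
        simp [hx]
    have a3 : ∑ e ∈ 𝓣.edges, ∫ x, 𝓣.avgNormal e v x * 𝓣.jump e w x ∂(edgeMeasure e) = 0 :=
      Finset.sum_eq_zero fun e he => integral_eq_zero_of_ae <| by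
        filter_upwards [eJ e he] with x hx
        simp [hx]
    have a4 : ∑ e ∈ 𝓣.edges, (size e)⁻¹ *
        ∫ x, 𝓣.jump e w x * 𝓣.jump e v x ∂(edgeMeasure e) = 0 :=
      Finset.sum_eq_zero fun e he => mul_eq_zero_of_right _ <| integral_eq_zero_of_ae <| by
        filter_upwards [eJ e he] with x hx
        simp [hx]
    have a5 : ∑ t ∈ 𝓣.triangles,
        ∫ x, (inner ℝ (ζ x) (tgrad t w x) + γ x * w x) * v x ∂(triMeasure t) = 0 :=
      Finset.sum_eq_zero fun t ht => integral_eq_zero_of_ae <| by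
        filter_upwards [tG t ht, tL t ht] with x hx hx'
        simp [hx, hx']
    rw [aForm, aSip, aAr, a1, a2, a3, a4, a5, Finset.sum_eq_zero]
    · simp
    · intro e he
      refine integral_eq_zero_of_ae ?_
      filter_upwards [eJ e (hsub he)] with x hx
      simp [hx]
  · have a1 : ∑ t ∈ 𝓣.triangles, ∫ x, inner ℝ (tgrad t v x) (tgrad t w x) ∂(triMeasure t) = 0 :=
      Finset.sum_eq_zero fun t ht => integral_eq_zero_of_ae <| by
        filter_upwards [tG t ht] with x hx
        simp [hx]
    have a2 : ∑ e ∈ 𝓣.edges, ∫ x, 𝓣.avgNormal e v x * 𝓣.jump e w x ∂(edgeMeasure e) = 0 :=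
      Finset.sum_eq_zero fun e he => integral_eq_zero_of_ae <| by
        filter_upwards [eJ e he] with x hx
        simp [hx]
    have a3 : ∑ e ∈ 𝓣.edges, ∫ x, 𝓣.avgNormal e w x * 𝓣.jump e v x ∂(edgeMeasure e) = 0 :=
      Finset.sum_eq_zero fun e he => integral_eq_zero_of_ae <| by
        filter_upwards [eN e he] with x hx
        simp [hx]
    have a4 : ∑ e ∈ 𝓣.edges, (size e)⁻¹ *
        ∫ x, 𝓣.jump e v x * 𝓣.jump e w x ∂(edgeMeasure e) = 0 :=
      Finset.sum_eq_zero fun e he => mul_eq_zero_of_right _ <| integral_eq_zero_of_ae <| by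
        filter_upwards [eJ e he] with x hx
        simp [hx]
    have a5 : ∑ t ∈ 𝓣.triangles,
        ∫ x, (inner ℝ (ζ x) (tgrad t v x) + γ x * v x) * w x ∂(triMeasure t) = 0 :=
      Finset.sum_eq_zero fun t ht => integral_eq_zero_of_ae <| by
        filter_upwards [tL t ht] with x hx
        simp [hx]
    rw [aForm, aSip, aAr, a1, a2, a3, a4, a5, Finset.sum_eq_zero]
    · simp
    · intro e he
      refine integral_eq_zero_of_ae ?_
      filter_upwards [eA e (hsub he)] with x hx
      simp [hx]

/-- Boundedness, including the functions of infinite energy. -/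
theorem ofReal_abs_aForm_le (hΩ : interior (closure Ω) = Ω) {ζ : Plane → Plane} {γ : Plane → ℝ}
    {σ R K M : ℝ} (hσ : 1 ≤ σ) (hR0 : 0 < R)
    (hR : closure Ω ⊆ Metric.closedBall 0 R) (hK : 1 ≤ K) (hreg : 𝓣.ShapeRegular K)
    (hM : 0 ≤ M) (hζ : ∀ x ∈ closure Ω, ‖ζ x‖ ≤ M)
    (hγ : ∀ᵐ x ∂(volume.restrict Ω), |γ x| ≤ M)
    {w v : Plane → ℝ} (hw : 𝓣.MemSum ζ γ w) (hv : 𝓣.MemSum ζ γ v) :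
    ENNReal.ofReal |𝓣.aForm σ ζ γ w v|
      ≤ ENNReal.ofReal (4 + 3 * M * poincareConst K R)
        * (𝓣.energyNorm σ w * 𝓣.energyNorm σ v) := by
  have hσ0 : 0 < σ := by linarith
  have hC : 0 < 4 + 3 * M * poincareConst K R := by
    have := mul_nonneg hM (zero_le_one.trans (one_le_poincareConst K R))
    linarith
  have hreg' : ∀ u, 𝓣.MemSum ζ γ u → 𝓣.HasL2Traces u → 𝓣.Regular u := fun u hu h =>
    ⟨fun t ht => memLp_of_memSum hΩ hu ht, h⟩
  have hE0 : ∀ u, 0 ≤ 𝓣.energy σ u := fun u => le_trans (by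
    have := 𝓣.gradSq_nonneg u
    have := mul_nonneg hσ0.le (𝓣.jumpSq_nonneg u)
    have := mul_nonneg (inv_nonneg.2 hσ0.le) (𝓣.normalSq_nonneg u)
    positivity) (𝓣.le_energy hσ0 u)
  have hzero : ∀ u, 𝓣.Regular u → 𝓣.energyNorm σ u = 0 → 𝓣.energy σ u = 0 := by
    intro u hu h
    rw [hu.energyNorm_eq hσ0, ENNReal.ofReal_eq_zero, Real.sqrt_le_iff] at h
    exact le_antisymm (by simpa using h.2) (hE0 u)
  have htop : ∀ u, ¬ 𝓣.HasL2Traces u → 𝓣.energyNorm σ u = ⊤ := fun u hu => by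
    rw [energyNorm, if_neg hu]
  have hC' : ENNReal.ofReal (4 + 3 * M * poincareConst K R) ≠ 0 := by simpa using hC
  by_cases h1 : 𝓣.HasL2Traces w
  · have hw' := hreg' w hw h1
    by_cases h2 : 𝓣.HasL2Traces v
    · have hv' := hreg' v hv h2
      rw [hw'.energyNorm_eq hσ0, hv'.energyNorm_eq hσ0, ← ENNReal.ofReal_mul (Real.sqrt_nonneg _),
        ← ENNReal.ofReal_mul hC.le]
      exact ENNReal.ofReal_le_ofReal (hw'.abs_aForm_le hv' hσ hR0 hR hK hreg hM hζ
        fun t ht => 𝓣.ae_triMeasure_of_ae hΩ ht hγ)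
    · by_cases h3 : 𝓣.energyNorm σ w = 0
      · rw [(hw'.aForm_eq_zero hσ0 hR0 hR hK hreg (hzero w hw' h3) ζ γ v).1]
        simp
      · rw [htop v h2, ENNReal.mul_top h3, ENNReal.mul_top hC']
        exact le_top
  · rw [htop w h1]
    by_cases h3 : 𝓣.energyNorm σ v = 0
    · have hv' : 𝓣.Regular v := hreg' v hv (by
        by_contra h
        rw [htop v h] at h3
        exact ENNReal.top_ne_zero h3)
      rw [(hv'.aForm_eq_zero hσ0 hR0 hR hK hreg (hzero v hv' h3) ζ γ w).2]
      simp
    · rw [ENNReal.top_mul h3, ENNReal.mul_top hC']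
      exact le_top

end Triangulation

/-! ### Green's formula for the convection field -/

theorem IsWeakGrad.mono {U V : Set Plane} {u : Plane → ℝ} {G : Plane → Plane}
    (h : IsWeakGrad U u G) (hVU : V ⊆ U) : IsWeakGrad V u G := by
  refine ⟨h.1.mono_set hVU, h.2.1.mono_set hVU, fun φ hφ => ?_⟩
  have hz : ∀ x, x ∉ tsupport φ → φ x • G x = 0 := fun x hx => by
    rw [image_eq_zero_of_notMem_tsupport hx, zero_smul]
  have hz' : ∀ x, x ∉ tsupport φ → u x • gradient φ x = 0 := fun x hx => by
    rw [gradient, fderiv_of_notMem_tsupport ℝ hx, map_zero, smul_zero]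
  have := h.2.2 φ ⟨hφ.1, hφ.2.1, hφ.2.2.trans hVU⟩
  rw [setIntegral_eq_integral_of_forall_compl_eq_zero fun x hx =>
      hz x fun h' => hx (hVU (hφ.2.2 h')),
    setIntegral_eq_integral_of_forall_compl_eq_zero fun x hx =>
      hz' x fun h' => hx (hVU (hφ.2.2 h'))] at this
  rw [setIntegral_eq_integral_of_forall_compl_eq_zero fun x hx => hz x fun h' => hx (hφ.2.2 h'),
    setIntegral_eq_integral_of_forall_compl_eq_zero fun x hx => hz' x fun h' => hx (hφ.2.2 h'),
    this]

theorem MemW1.isWeakGrad_wgrad {p : ℝ≥0∞} {U : Set Plane} {u : Plane → ℝ} (h : MemW1 p U u) :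
    IsWeakGrad U u (wgrad U u) := by
  obtain ⟨-, G, hG, -⟩ := h
  exact hG.wgrad

theorem MemW1.memLp_wgrad {p : ℝ≥0∞} {U : Set Plane} (hU : IsOpen U) {u : Plane → ℝ}
    (h : MemW1 p U u) : MemLp (wgrad U u) p (volume.restrict U) := by
  obtain ⟨-, G, hG, hGp⟩ := h
  exact hGp.ae_eq (hG.unique hU hG.wgrad)

theorem inner_single_right (x : Plane) (i : Fin 2) :
    inner ℝ x (EuclideanSpace.single i (1 : ℝ)) = x i := by
  simp [EuclideanSpace.inner_single_right]

theorem sum_mul_apply (x y : Plane) : ∑ i, x i * y i = inner ℝ x y := by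
  rw [PiLp.inner_apply]
  exact Finset.sum_congr rfl fun i _ => by simp [mul_comm]

theorem integrable_edgeMeasure_of_continuousOn {e : Finset Plane} (he : e.card = 2)
    {f : Plane → ℝ} (hf : ContinuousOn f (cell e)) : Integrable f (edgeMeasure e) := by
  have : IsFiniteMeasure ((μH[1] : Measure Plane).restrict (cell e)) :=
    isFiniteMeasure_edgeMeasure he
  exact (memLp_restrict_of_continuousOn (isCompact_cell e) hf (p := 1)).integrable le_rfl

theorem integrable_triMeasure_of_continuousOn {t : Finset Plane}
    {f : Plane → ℝ} (hf : ContinuousOn f (cell t)) : Integrable f (triMeasure t) :=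
  hf.integrableOn_compact (isCompact_cell t)

theorem integrable_wgrad {Ω : Set Plane} (hΩo : IsOpen Ω) {ζ : Plane → Plane}
    (hζ : ∀ i : Fin 2, MemW1 ⊤ Ω (fun x => ζ x i)) {t : Finset Plane}
    (ht : interior (cell t) ⊆ Ω) (i : Fin 2) :
    Integrable (wgrad Ω fun x => ζ x i) (triMeasure t) := by
  have h : MemLp (wgrad Ω fun x => ζ x i) ⊤ (triMeasure t) := by
    rw [triMeasure_eq]
    exact ((hζ i).memLp_wgrad hΩo).mono_measure (Measure.restrict_mono ht le_rfl)
  exact h.integrable le_top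

/-- The divergence theorem for `φ ζ` on a triangle. -/
theorem integral_wdiv_mul {Ω : Set Plane} (hΩo : IsOpen Ω) {ζ : Plane → Plane}
    (hζ : ∀ i : Fin 2, MemW1 ⊤ Ω (fun x => ζ x i)) {t : Finset Plane} (ht : t.card = 3)
    (hind : AffineIndependent ℝ ((↑) : t → Plane)) {N : Finset Plane → Plane}
    (hN : ∀ e ∈ edgesOf t, IsOutward t e (N e)) (htΩ : interior (cell t) ⊆ Ω)
    (hζc : ContinuousOn ζ (cell t)) {φ : Plane → ℝ} (hφ : ContDiff ℝ ∞ φ) :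
    ∫ x, inner ℝ (ζ x) (gradient φ x) ∂(triMeasure t) + ∫ x, φ x * wdiv Ω ζ x ∂(triMeasure t)
      = ∑ e ∈ edgesOf t, ∫ x, inner ℝ (N e) (ζ x) * φ x ∂(edgeMeasure e) := by
  have hζi : ∀ i : Fin 2, ContinuousOn (fun x => ζ x i) (cell t) := fun i =>
    (EuclideanSpace.proj i : Plane →L[ℝ] ℝ).continuous.comp_continuousOn hζc
  have hg := fun i => (hζ i).isWeakGrad_wgrad.mono htΩ |>.green ht hind hN (hζi i)
    (integrable_wgrad hΩo hζ htΩ i) hφ (EuclideanSpace.single i 1)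
  have hsum := Finset.sum_congr (s₁ := (Finset.univ : Finset (Fin 2))) rfl fun i _ => hg i
  simp only [← inner_gradient, inner_single_right] at hsum
  have i1 : ∀ i : Fin 2, Integrable (fun x => ζ x i * gradient φ x i) (triMeasure t) := fun i =>
    integrable_triMeasure_of_continuousOn <| (hζi i).mul
      ((EuclideanSpace.proj i : Plane →L[ℝ] ℝ).continuous.comp
        (continuous_gradient hφ)).continuousOn
  have i2 : ∀ i : Fin 2, Integrable (fun x => φ x * wgrad Ω (fun x => ζ x i) x i)
      (triMeasure t) := by
    intro i
    obtain ⟨C, hC⟩ := (isCompact_cell t).exists_bound_of_continuousOn hφ.continuous.continuousOn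
    exact ((EuclideanSpace.proj i : Plane →L[ℝ] ℝ).integrable_comp
      (integrable_wgrad hΩo hζ htΩ i)).bdd_mul (c := C) hφ.continuous.aestronglyMeasurable (by
        filter_upwards [ae_triMeasure_mem t] with x hx using hC x hx)
  rw [Finset.sum_add_distrib, ← integral_finsetSum _ fun i _ => i1 i,
    ← integral_finsetSum _ fun i _ => i2 i, Finset.sum_comm] at hsum
  simp only [← Finset.mul_sum, sum_mul_apply] at hsum
  refine hsum.trans (Finset.sum_congr rfl fun e he => ?_)
  have hsub := cell_mono (subset_of_mem_edgesOf he)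
  simp only [← integral_const_mul]
  rw [← integral_finsetSum]
  · refine integral_congr_ae (ae_of_all _ fun x => ?_)
    beta_reduce
    rw [← sum_mul_apply, Finset.sum_mul]
    exact Finset.sum_congr rfl fun i _ => (mul_assoc _ _ _).symm
  · intro i _
    exact (integrable_edgeMeasure_of_continuousOn (card_of_mem_edgesOf he)
      (((hζi i).mono hsub).mul hφ.continuous.continuousOn)).const_mul _

namespace Triangulation

variable {Ω : Set Plane} (𝓣 : Triangulation Ω)

/-! ### Piecewise affine functions -/

/-- On every triangle `t`, `v` agrees with the affine function `⟨g t, ·⟩ + c t`. -/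
def IsPiecewiseAffine (v : Plane → ℝ) (g : Finset Plane → Plane) (c : Finset Plane → ℝ) : Prop :=
  ∀ t ∈ 𝓣.triangles, v =ᵐ[triMeasure t] fun x => inner ℝ (g t) x + c t

variable {𝓣}

theorem MemVh.exists_isPiecewiseAffine {v : Plane → ℝ} (hv : 𝓣.MemVh v) :
    ∃ g c, 𝓣.IsPiecewiseAffine v g c := by
  have : ∀ t, ∃ (g : Plane) (c : ℝ), t ∈ 𝓣.triangles →
      v =ᵐ[triMeasure t] fun x => inner ℝ g x + c := by
    intro t
    by_cases ht : t ∈ 𝓣.triangles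
    · obtain ⟨l, hl⟩ := hv t ht
      obtain ⟨g, c, hgc⟩ := exists_affineMap_eq_inner_add l
      exact ⟨g, c, fun _ => hl.trans (ae_of_all _ hgc)⟩
    · exact ⟨0, 0, fun h => absurd h ht⟩
  choose g c h using this
  exact ⟨g, c, h⟩

theorem contDiff_inner_add (g : Plane) (c : ℝ) : ContDiff ℝ ∞ fun x : Plane => inner ℝ g x + c :=
  (contDiff_const.inner ℝ contDiff_id).add contDiff_const

namespace IsPiecewiseAffine

variable {v : Plane → ℝ} {g : Finset Plane → Plane} {c : Finset Plane → ℝ}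

theorem tgrad_ae (h : 𝓣.IsPiecewiseAffine v g c) {t : Finset Plane} (ht : t ∈ 𝓣.triangles) :
    tgrad t v =ᵐ[triMeasure t] fun _ => g t :=
  (tgrad_ae_eq (contDiff_inner_add (g t) (c t)) (h t ht)).trans
    (ae_of_all _ fun x => gradient_inner_add _ _ x)

theorem exists_isNormalDeriv (h : 𝓣.IsPiecewiseAffine v g c) {t : Finset Plane}
    (ht : t ∈ 𝓣.triangles) : ∃ q, IsNormalDeriv t v q ∧
      ∀ e ∈ edgesOf t, q =ᵐ[edgeMeasure e] fun _ => inner ℝ (𝓣.sgn e t • 𝓣.normal e) (g t) :=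
  exists_isNormalDeriv_affine (𝓣.mem_triangles.1 ht).2 (𝓣.affineIndependent ht)
    (𝓣.isOutward_of_mem_edgesOf ht) (h.tgrad_ae ht)

theorem regular (h : 𝓣.IsPiecewiseAffine v g c) : 𝓣.Regular v where
  memLp t ht := (memLp_triMeasure t (contDiff_inner_add (g t) (c t)).continuous).ae_eq (h t ht).symm
  hasL2Traces t ht := by
    obtain ⟨q, hq, -⟩ := h.exists_isNormalDeriv ht
    exact ⟨⟨_, isTrace_of_contDiff (contDiff_inner_add (g t) (c t)) (h t ht)⟩, q, hq⟩

theorem trace_ae (h : 𝓣.IsPiecewiseAffine v g c) {t e : Finset Plane} (ht : t ∈ 𝓣.triangles)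
    (he : e ∈ edgesOf t) : trace t v =ᵐ[edgeMeasure e] fun x => inner ℝ (g t) x + c t :=
  (h.regular.hasTraceGrad ht).trace_unique (𝓣.mem_triangles.1 ht).2 (𝓣.affineIndependent ht)
    (𝓣.isOutward_of_mem_edgesOf ht) (hasTraceGrad_of_contDiff t (contDiff_inner_add (g t) (c t)))
    (h t ht) he

theorem normalDeriv_ae (h : 𝓣.IsPiecewiseAffine v g c) {t e : Finset Plane}
    (ht : t ∈ 𝓣.triangles) (he : e ∈ edgesOf t) :
    normalDeriv t v =ᵐ[edgeMeasure e] fun _ => inner ℝ (𝓣.sgn e t • 𝓣.normal e) (g t) := by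
  obtain ⟨q, hq, hqe⟩ := h.exists_isNormalDeriv ht
  exact ((isNormalDeriv_normalDeriv hq).unique (𝓣.isOutward_of_mem_edgesOf ht) hq
    (ae_eq_refl _) he).trans (hqe e he)

/-- The inverse inequality for the normal derivatives: on each triangle the gradient is constant, so
the trace inequality has no derivative term. -/
theorem normalSq_le (h : 𝓣.IsPiecewiseAffine v g c) {K : ℝ} (hK : 0 ≤ K)
    (hreg : 𝓣.ShapeRegular K) : 𝓣.normalSq v ≤ 9 * K * 𝓣.gradSq v := by
  calc 𝓣.normalSq v
      ≤ ∑ e ∈ 𝓣.edges, ∑ t ∈ 𝓣.adjacent e, size e * ∫ _, ‖g t‖ ^ 2 ∂(edgeMeasure e) := by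
        refine Finset.sum_le_sum fun e he => ?_
        have hfin := isFiniteMeasure_edgeMeasure (𝓣.mem_edges.1 he).2
        have hint : ∀ t ∈ 𝓣.adjacent e, Integrable (fun _ : Plane => ‖g t‖ ^ 2) (edgeMeasure e) :=
          fun t _ => integrable_const _
        rw [← Finset.mul_sum, ← integral_finsetSum _ hint]
        refine mul_le_mul_of_nonneg_left ?_ Metric.diam_nonneg
        refine integral_mono_of_nonneg (ae_of_all _ fun x => by positivity)
          (integrable_finsetSum _ hint) ?_
        have hae : ∀ᵐ x ∂(edgeMeasure e), ∀ t ∈ 𝓣.adjacent e,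
            normalDeriv t v x = inner ℝ (𝓣.sgn e t • 𝓣.normal e) (g t) := by
          rw [Finset.eventually_all]
          exact fun t ht => h.normalDeriv_ae (𝓣.mem_adjacent.1 ht).1
            (𝓣.mem_edgesOf_of_mem_adjacent he ht)
        filter_upwards [hae] with x hx
        rw [Real.norm_eq_abs, sq_abs]
        refine (𝓣.sq_average_le he fun t => 𝓣.sgn e t * normalDeriv t v x).trans
          (Finset.sum_le_sum fun t ht => ?_)
        have h1 := abs_real_inner_le_norm (𝓣.normal e) (g t)
        rw [𝓣.norm_normal e (𝓣.mem_edges.1 he).1 (𝓣.mem_edges.1 he).2, one_mul] at h1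
        rw [hx t ht, inner_smul_left, conj_trivial, ← mul_assoc, sgn_mul_self, one_mul, ← sq_abs]
        gcongr
    _ = ∑ t ∈ 𝓣.triangles, ∑ e ∈ edgesOf t, size e * ∫ _, ‖g t‖ ^ 2 ∂(edgeMeasure e) :=
        (𝓣.sum_triangles_edgesOf _).symm
    _ ≤ ∑ t ∈ 𝓣.triangles, ∑ e ∈ edgesOf t, K * (3 * ∫ x, ‖tgrad t v x‖ ^ 2 ∂(triMeasure t)) := by
        refine Finset.sum_le_sum fun t ht => Finset.sum_le_sum fun e he => ?_
        obtain ⟨z, r, hr, hball, hsize⟩ := hreg t ht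
        have h1 := (hasTraceGrad_of_contDiff t
          (contDiff_const (c := ‖g t‖))).trace_inequality (𝓣.mem_triangles.1 ht).2
          (𝓣.affineIndependent ht) (𝓣.isOutward_of_mem_edgesOf ht) he hK hball hsize
        simp only [gradient_fun_const, norm_zero] at h1
        have h2 : size e * ∫ _, ‖g t‖ ^ 2 ∂(edgeMeasure e)
            ≤ size t * ∫ _, ‖g t‖ ^ 2 ∂(edgeMeasure e) :=
          mul_le_mul_of_nonneg_right (size_mono (subset_of_mem_edgesOf he))
            (integral_nonneg fun x => sq_nonneg _)
        refine (h2.trans h1).trans_eq ?_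
        have h3 : ∫ x, ‖tgrad t v x‖ ^ 2 ∂(triMeasure t) = ∫ _, ‖g t‖ ^ 2 ∂(triMeasure t) :=
          integral_congr_ae <| by
            filter_upwards [h.tgrad_ae ht] with x hx
            rw [hx]
        rw [h3]
        simp
    _ = 9 * K * 𝓣.gradSq v := by
        rw [gradSq, Finset.mul_sum]
        refine Finset.sum_congr rfl fun t ht => ?_
        rw [Finset.sum_const, edgesOf, Finset.card_powersetCard, (𝓣.mem_triangles.1 ht).2]
        norm_num [Nat.choose]
        ring

/-! ### Coercivity -/

/-- Coercivity of the symmetric interior penalty form, up to the jumps. -/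
theorem le_aSip (h : 𝓣.IsPiecewiseAffine v g c) {K : ℝ} (hK : 0 ≤ K)
    (hreg : 𝓣.ShapeRegular K) (σ : ℝ) :
    𝓣.gradSq v / 2 + (σ - 18 * K) * 𝓣.jumpSq v ≤ 𝓣.aSip σ v v := by
  have hv := h.regular
  have hG := 𝓣.gradSq_nonneg v
  have hJ := 𝓣.jumpSq_nonneg v
  have hN := h.normalSq_le hK hreg
  have hN0 := 𝓣.normalSq_nonneg v
  have h1 := abs_sum_integral_le 𝓣.edges (μ := edgeMeasure) (f := fun e => 𝓣.avgNormal e v)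
    (g := fun e => 𝓣.jump e v) (K := 1) (a := fun e => size e)
    (h := fun e x => 𝓣.avgNormal e v x * 𝓣.jump e v x)
    (fun e he => size_pos_of_mem_edges he)
    zero_le_one (fun e he => hv.memLp_avgNormal he) (fun e he => hv.memLp_jump he)
    (fun t _ => ae_of_all _ fun x => by rw [one_mul, abs_mul]; rfl)
  rw [one_mul] at h1
  change _ ≤ √(𝓣.normalSq v) * √(𝓣.jumpSq v) at h1
  have h2 : √(𝓣.normalSq v) * √(𝓣.jumpSq v) ≤ 𝓣.gradSq v / 4 + 9 * K * 𝓣.jumpSq v := by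
    rw [← Real.sqrt_mul hN0]
    refine Real.sqrt_le_iff.2 ⟨by positivity, ?_⟩
    have := mul_le_mul_of_nonneg_right hN hJ
    nlinarith [sq_nonneg (𝓣.gradSq v / 4 - 9 * K * 𝓣.jumpSq v)]
  have e1 : ∑ t ∈ 𝓣.triangles, ∫ x, inner ℝ (tgrad t v x) (tgrad t v x) ∂(triMeasure t)
      = 𝓣.gradSq v :=
    Finset.sum_congr rfl fun t _ => by simp only [real_inner_self_eq_norm_sq]
  have e2 : ∑ e ∈ 𝓣.edges, (size e)⁻¹ * ∫ x, 𝓣.jump e v x * 𝓣.jump e v x ∂(edgeMeasure e)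
      = 𝓣.jumpSq v :=
    Finset.sum_congr rfl fun e _ => by
      simp only [Real.norm_eq_abs, sq, abs_mul_abs_self]
  rw [aSip, e1, e2]
  have := (abs_le.1 h1).2
  linarith

variable {ζ : Plane → Plane} {γ : Plane → ℝ}

/-- The volume term of the convection form on one triangle: Green's formula for `v² ζ`. -/
theorem le_integral_convection (h : 𝓣.IsPiecewiseAffine v g c) (hΩo : IsOpen Ω)
    (hΩ : interior (closure Ω) = Ω) (hζ : ∀ i : Fin 2, MemW1 ⊤ Ω (fun x => ζ x i))
    (hζc : ContinuousOn ζ (closure Ω)) (hγ : MemLp γ ⊤ (volume.restrict Ω))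
    (hpos : ∀ᵐ x ∂(volume.restrict Ω), 0 ≤ γ x - 1 / 2 * wdiv Ω ζ x)
    {t : Finset Plane} (ht : t ∈ 𝓣.triangles) :
    ∑ e ∈ edgesOf t, 1 / 2 * (𝓣.sgn e t *
        ∫ x, inner ℝ (𝓣.normal e) (ζ x) * trace t v x ^ 2 ∂(edgeMeasure e))
      ≤ ∫ x, (inner ℝ (ζ x) (tgrad t v x) + γ x * v x) * v x ∂(triMeasure t) := by
  set l : Plane → ℝ := fun x => inner ℝ (g t) x + c t with hl
  have hlc : ContDiff ℝ ∞ l := contDiff_inner_add _ _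
  have hl2 : ContDiff ℝ ∞ fun x => l x ^ 2 := hlc.pow 2
  have hsub := 𝓣.cell_subset_closure ht
  have htΩ := 𝓣.interior_cell_subset hΩ ht
  have hζt := hζc.mono hsub
  have hgrad : ∀ x, gradient (fun x => l x ^ 2) x = (2 * l x) • g t := by
    intro x
    have h1 : HasFDerivAt l (InnerProductSpace.toDual ℝ Plane (g t)) x :=
      ((InnerProductSpace.toDual ℝ Plane (g t)).hasFDerivAt).add_const (c t)
    have h2 := h1.pow 2
    refine HasGradientAt.gradient ?_
    rw [hasGradientAt_iff_hasFDerivAt]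
    refine h2.congr_fderiv ?_
    ext y
    simp
  have key := integral_wdiv_mul hΩo hζ (𝓣.mem_triangles.1 ht).2
    (𝓣.affineIndependent ht) (𝓣.isOutward_of_mem_edgesOf ht) htΩ hζt hl2
  simp only [hgrad, inner_smul_right] at key
  have i1 : Integrable (fun x => 2 * l x * inner ℝ (ζ x) (g t)) (triMeasure t) :=
    integrable_triMeasure_of_continuousOn <|
      (continuousOn_const.mul hlc.continuous.continuousOn).mul (hζt.inner continuousOn_const)
  obtain ⟨C, hC⟩ := (isCompact_cell t).exists_bound_of_continuousOn hl2.continuous.continuousOn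
  have hCae : ∀ᵐ x ∂(triMeasure t), ‖l x ^ 2‖ ≤ C := by
    filter_upwards [ae_triMeasure_mem t] with x hx using hC x hx
  have i2 : Integrable (fun x => l x ^ 2 * γ x) (triMeasure t) := by
    have : MemLp γ ⊤ (triMeasure t) := by
      rw [triMeasure_eq]
      exact hγ.mono_measure (Measure.restrict_mono htΩ le_rfl)
    exact (this.integrable le_top).bdd_mul (c := C) hl2.continuous.aestronglyMeasurable hCae
  have i3 : Integrable (fun x => l x ^ 2 * wdiv Ω ζ x) (triMeasure t) := by
    have : Integrable (wdiv Ω ζ) (triMeasure t) :=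
      integrable_finsetSum _ fun i _ => (EuclideanSpace.proj i : Plane →L[ℝ] ℝ).integrable_comp
        (integrable_wgrad hΩo hζ htΩ i)
    exact this.bdd_mul (c := C) hl2.continuous.aestronglyMeasurable hCae
  have e1 : ∫ x, (inner ℝ (ζ x) (tgrad t v x) + γ x * v x) * v x ∂(triMeasure t)
      = 1 / 2 * ∫ x, 2 * l x * inner ℝ (ζ x) (g t) ∂(triMeasure t)
        + ∫ x, l x ^ 2 * γ x ∂(triMeasure t) := by
    rw [← integral_const_mul, ← integral_add (i1.const_mul _) i2]
    refine integral_congr_ae ?_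
    filter_upwards [h t ht, h.tgrad_ae ht] with x hx hx'
    rw [hx, hx']
    change (_ + γ x * l x) * l x = _
    ring
  have e2 : 0 ≤ ∫ x, l x ^ 2 * γ x ∂(triMeasure t)
      - 1 / 2 * ∫ x, l x ^ 2 * wdiv Ω ζ x ∂(triMeasure t) := by
    rw [← integral_const_mul, ← integral_sub i2 (i3.const_mul _)]
    refine integral_nonneg_of_ae ?_
    filter_upwards [𝓣.ae_triMeasure_of_ae hΩ ht hpos] with x hx
    have := mul_nonneg (sq_nonneg (l x)) hx
    simp only [Pi.zero_apply]
    linarith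
  have e3 : ∑ e ∈ edgesOf t, 1 / 2 * (𝓣.sgn e t *
        ∫ x, inner ℝ (𝓣.normal e) (ζ x) * trace t v x ^ 2 ∂(edgeMeasure e))
      = 1 / 2 * ∑ e ∈ edgesOf t,
        ∫ x, inner ℝ (𝓣.sgn e t • 𝓣.normal e) (ζ x) * l x ^ 2 ∂(edgeMeasure e) := by
    rw [Finset.mul_sum]
    refine Finset.sum_congr rfl fun e he => ?_
    rw [← integral_const_mul]
    congr 1
    refine integral_congr_ae ?_
    filter_upwards [h.trace_ae ht he] with x hx
    rw [hx, inner_smul_left, conj_trivial, mul_assoc]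
  rw [e3, e1, ← key]
  linarith

/-- The convection form is nonnegative up to the jumps on the boundary: in the sum of Green's
formulas the interior edges cancel against the upwind terms. -/
theorem le_aAr (h : 𝓣.IsPiecewiseAffine v g c) (hΩo : IsOpen Ω)
    (hΩ : interior (closure Ω) = Ω) (hζ : ∀ i : Fin 2, MemW1 ⊤ Ω (fun x => ζ x i))
    (hζc : ContinuousOn ζ (closure Ω)) (hγ : MemLp γ ⊤ (volume.restrict Ω))
    (hpos : ∀ᵐ x ∂(volume.restrict Ω), 0 ≤ γ x - 1 / 2 * wdiv Ω ζ x) {R M : ℝ}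
    (hR : closure Ω ⊆ Metric.closedBall 0 R) (hM0 : 0 ≤ M) (hM : ∀ x ∈ closure Ω, ‖ζ x‖ ≤ M) :
    -(R * M * 𝓣.jumpSq v) ≤ 𝓣.aAr ζ γ v v := by
  classical
  have hv := h.regular
  set b : Finset Plane → ℝ := fun e =>
    ∫ x, inner ℝ (𝓣.normal e) (ζ x) * 𝓣.jump e v x * 𝓣.avg e v x ∂(edgeMeasure e) with hb
  have hnζ : ∀ e ∈ 𝓣.edges, ∀ x ∈ cell e, |inner ℝ (𝓣.normal e) (ζ x)| ≤ M := by
    intro e he x hx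
    have h1 := abs_real_inner_le_norm (𝓣.normal e) (ζ x)
    rw [𝓣.norm_normal e (𝓣.mem_edges.1 he).1 (𝓣.mem_edges.1 he).2, one_mul] at h1
    exact h1.trans (hM x (𝓣.cell_subset_of_mem_edges he hx))
  have hedge : ∀ e ∈ 𝓣.edges, ∑ t ∈ 𝓣.adjacent e, 1 / 2 * (𝓣.sgn e t *
        ∫ x, inner ℝ (𝓣.normal e) (ζ x) * trace t v x ^ 2 ∂(edgeMeasure e))
      = (𝓣.adjacent e).card / 2 * b e := by
    intro e he
    have hint : ∀ t ∈ 𝓣.adjacent e, Integrable (fun x => 𝓣.sgn e t *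
        (inner ℝ (𝓣.normal e) (ζ x) * trace t v x ^ 2)) (edgeMeasure e) := by
      intro t ht
      refine Integrable.const_mul ?_ _
      have hc : ContinuousOn (fun x => inner ℝ (𝓣.normal e) (ζ x) : Plane → ℝ) (cell e) :=
        continuousOn_const.inner (hζc.mono (𝓣.cell_subset_of_mem_edges he))
      exact ((hv.memLp_trace he ht).integrable_sq).bdd_mul (c := M)
        (hc.aestronglyMeasurable_of_isCompact (isCompact_cell e) (measurableSet_cell e)) (by
          filter_upwards [ae_edgeMeasure_mem e] with x hx using hnζ e he x hx)
    rw [← Finset.mul_sum]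
    simp only [← integral_const_mul]
    rw [← integral_finsetSum _ hint, hb, ← integral_const_mul, ← integral_const_mul]
    refine integral_congr_ae (ae_of_all _ fun x => ?_)
    beta_reduce
    have e1 : ∑ t ∈ 𝓣.adjacent e, 𝓣.sgn e t * (inner ℝ (𝓣.normal e) (ζ x) * trace t v x ^ 2)
        = inner ℝ (𝓣.normal e) (ζ x) * ∑ t ∈ 𝓣.adjacent e, 𝓣.sgn e t * trace t v x ^ 2 := by
      rw [Finset.mul_sum]
      exact Finset.sum_congr rfl fun t _ => by ring
    rw [e1, 𝓣.sum_sgn_mul_sq he, 𝓣.card_mul_avg he, ← jump]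
    ring
  -- interior edges have two adjacent triangles, so that the factor below is one
  have hvol : ∑ e ∈ 𝓣.edges, (𝓣.adjacent e).card / 2 * b e
      ≤ ∑ t ∈ 𝓣.triangles,
        ∫ x, (inner ℝ (ζ x) (tgrad t v x) + γ x * v x) * v x ∂(triMeasure t) := by
    rw [← Finset.sum_congr rfl hedge, ← 𝓣.sum_triangles_edgesOf fun t e => 1 / 2 * (𝓣.sgn e t *
        ∫ x, inner ℝ (𝓣.normal e) (ζ x) * trace t v x ^ 2 ∂(edgeMeasure e))]
    exact Finset.sum_le_sum fun t ht => h.le_integral_convection hΩo hΩ hζ hζc hγ hpos ht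
  -- on a boundary edge the average is the jump, and `h_e ≤ 2 * R`
  have hbd : ∀ e ∈ 𝓣.edges, (𝓣.adjacent e).card = 1 →
      |b e| ≤ 2 * R * M * ((size e)⁻¹ * ∫ x, ‖𝓣.jump e v x‖ ^ 2 ∂(edgeMeasure e)) := by
    intro e he hcard
    have hja : ∀ x, 𝓣.jump e v x = 𝓣.avg e v x := by
      intro x
      rcases 𝓣.adjacent_cases he with ⟨-, h1⟩ | ⟨h1, -⟩
      · rw [jump, avg, h1, h1, hcard, sgn, if_pos rfl]
        simp
      · omega
    have hI : 0 ≤ ∫ x, ‖𝓣.jump e v x‖ ^ 2 ∂(edgeMeasure e) :=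
      integral_nonneg fun x => by positivity
    have h1 : |b e| ≤ M * ∫ x, ‖𝓣.jump e v x‖ ^ 2 ∂(edgeMeasure e) := by
      rw [← integral_const_mul, ← Real.norm_eq_abs, hb]
      refine norm_integral_le_of_norm_le ((hv.memLp_jump he).norm.integrable_sq.const_mul M) ?_
      filter_upwards [ae_edgeMeasure_mem e] with x hx
      rw [← hja, norm_mul, norm_mul, mul_assoc, ← sq]
      exact mul_le_mul_of_nonneg_right (hnζ e he x hx) (sq_nonneg _)
    have h2 : size e ≤ 2 * R := (size_mono (𝓣.mem_adjacent.1 (𝓣.plus_mem_adjacent he)).2).trans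
      (𝓣.size_le hR (𝓣.mem_adjacent.1 (𝓣.plus_mem_adjacent he)).1)
    have h3 := size_pos_of_mem_edges he
    have h4 : 1 ≤ 2 * R * (size e)⁻¹ := by
      rw [← div_eq_mul_inv, le_div_iff₀ h3]
      linarith
    have h5 := le_mul_of_one_le_left (mul_nonneg hM0 hI) h4
    calc |b e| ≤ _ := h1
      _ ≤ _ := h5
      _ = _ := by ring
  have hsub := 𝓣.interior_union_inflow_subset ζ
  have hsum : ∑ e ∈ 𝓣.interiorEdges ∪ 𝓣.inflowEdges ζ, b e
      = ∑ e ∈ 𝓣.edges, if e ∈ 𝓣.interiorEdges ∪ 𝓣.inflowEdges ζ then b e else 0 := by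
    rw [Finset.sum_ite_mem, Finset.inter_eq_right.2 hsub]
  have hterm : -(R * M * 𝓣.jumpSq v) ≤ ∑ e ∈ 𝓣.edges, ((𝓣.adjacent e).card / 2 * b e
      - if e ∈ 𝓣.interiorEdges ∪ 𝓣.inflowEdges ζ then b e else 0) := by
    rw [jumpSq, Finset.mul_sum, ← Finset.sum_neg_distrib]
    refine Finset.sum_le_sum fun e he => ?_
    rcases 𝓣.adjacent_cases he with ⟨h1, -⟩ | ⟨h1, -⟩
    · have h2 := abs_le.1 (hbd e he h1)
      rw [h1, Nat.cast_one]
      split_ifs <;> linarith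
    · have h2 : e ∈ 𝓣.interiorEdges ∪ 𝓣.inflowEdges ζ :=
        Finset.mem_union_left _ (Finset.mem_filter.2 ⟨he, h1⟩)
      rcases hM0.eq_or_lt with hM0 | hM0
      · rw [if_pos h2, h1, ← hM0]
        norm_num
      · have hR0 : 0 ≤ R := by
          have h3 := 𝓣.size_le hR (𝓣.mem_adjacent.1 (𝓣.plus_mem_adjacent he)).1
          have h4 : 0 ≤ size (𝓣.plus e) := Metric.diam_nonneg
          linarith
        have h3 : 0 ≤ R * M * ((size e)⁻¹ * ∫ x, ‖𝓣.jump e v x‖ ^ 2 ∂(edgeMeasure e)) :=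
          mul_nonneg (mul_nonneg hR0 hM0.le) (mul_nonneg (inv_nonneg.2 Metric.diam_nonneg)
            (integral_nonneg fun x => by positivity))
        rw [if_pos h2, h1, Nat.cast_ofNat]
        linarith
  rw [Finset.sum_sub_distrib, ← hsum] at hterm
  rw [aAr]
  linarith

/-- Coercivity: the penalty dominates the jump terms of unknown sign. -/
theorem energy_le_aForm (h : 𝓣.IsPiecewiseAffine v g c) (hΩo : IsOpen Ω)
    (hΩ : interior (closure Ω) = Ω) (hζ : ∀ i : Fin 2, MemW1 ⊤ Ω (fun x => ζ x i))
    (hζc : ContinuousOn ζ (closure Ω)) (hγ : MemLp γ ⊤ (volume.restrict Ω))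
    (hpos : ∀ᵐ x ∂(volume.restrict Ω), 0 ≤ γ x - 1 / 2 * wdiv Ω ζ x) {R M K σ : ℝ}
    (hR : closure Ω ⊆ Metric.closedBall 0 R) (hM0 : 0 ≤ M) (hM : ∀ x ∈ closure Ω, ‖ζ x‖ ≤ M)
    (hK : 0 ≤ K) (hreg : 𝓣.ShapeRegular K) (hσ1 : 1 ≤ σ) (hσ : 2 * (18 * K + R * M) ≤ σ) :
    𝓣.energy σ v ≤ 4 * (1 + 18 * K) * 𝓣.aForm σ ζ γ v v := by
  have hG := 𝓣.gradSq_nonneg v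
  have hJ := 𝓣.jumpSq_nonneg v
  have hσ0 : 0 < σ := by linarith
  have h1 := h.le_aSip hK hreg σ
  have h2 := h.le_aAr hΩo hΩ hζ hζc hγ hpos hR hM0 hM
  have h3 := 𝓣.energy_le hσ0 v
  have h4 : σ⁻¹ * (2 * 𝓣.normalSq v) ≤ 18 * K * 𝓣.gradSq v := by
    have h5 := h.normalSq_le hK hreg
    have h6 : σ⁻¹ ≤ 1 := inv_le_one_of_one_le₀ hσ1
    have h7 := mul_le_of_le_one_left (mul_nonneg zero_le_two (𝓣.normalSq_nonneg v)) h6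
    linarith
  have h5 : 𝓣.gradSq v / 2 + σ / 2 * 𝓣.jumpSq v ≤ 𝓣.aForm σ ζ γ v v := by
    have := mul_le_mul_of_nonneg_right hσ hJ
    rw [aForm]
    linarith
  have h6 : 0 ≤ σ * 𝓣.jumpSq v := mul_nonneg hσ0.le hJ
  have h7 : 0 ≤ K * 𝓣.gradSq v := mul_nonneg hK hG
  have h8 : 0 ≤ K * (σ * 𝓣.jumpSq v) := mul_nonneg hK h6
  calc 𝓣.energy σ v ≤ 4 * (1 + 18 * K) * (𝓣.gradSq v / 2 + σ / 2 * 𝓣.jumpSq v) := by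
        nlinarith
    _ ≤ _ := mul_le_mul_of_nonneg_left h5 (by linarith)

end IsPiecewiseAffine

theorem ShapeRegular.mono {κ K : ℝ} (h : 𝓣.ShapeRegular κ) (hκ : κ ≤ K) : 𝓣.ShapeRegular K := by
  intro t ht
  obtain ⟨x, r, hr, hball, hsize⟩ := h t ht
  exact ⟨x, r, hr, hball, hsize.trans (mul_le_mul_of_nonneg_right hκ (by linarith))⟩

end Triangulation

end DG

end

theorem mainTheorem3 (Ω : Set DG.Plane) (hΩ : DG.IsPolygonalDomain Ω)
    (ζ : DG.Plane → DG.Plane) (γ : DG.Plane → ℝ)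
    (hζ : ∀ i : Fin 2, DG.MemW1 ⊤ Ω (fun x => ζ x i))
    -- the continuous representative of `ζ`, which gives `ζ` its values on the edges
    (hζc : ContinuousOn ζ (closure Ω))
    (hγ : DG.MemW1 ⊤ Ω γ) (hγ_nonneg : ∀ᵐ x ∂(volume.restrict Ω), 0 ≤ γ x)
    (κ : ℝ) :
    ∃ σ₀ C c : ℝ, 0 < σ₀ ∧ 0 < C ∧ 0 < c ∧
      ∀ σ : ℝ, σ₀ ≤ σ → ∀ 𝓣 : DG.Triangulation Ω, 𝓣.ShapeRegular κ →
        (∀ w v : DG.Plane → ℝ, 𝓣.MemSum ζ γ w → 𝓣.MemSum ζ γ v →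
          ENNReal.ofReal |𝓣.aForm σ ζ γ w v|
            ≤ ENNReal.ofReal C * (𝓣.energyNorm σ w * 𝓣.energyNorm σ v)) ∧
        ((∃ γ₀ : ℝ, 0 < γ₀ ∧
            ∀ᵐ x ∂(volume.restrict Ω), γ₀ ≤ γ x - 1 / 2 * DG.wdiv Ω ζ x) →
          ∀ v : DG.Plane → ℝ, 𝓣.MemVh v →
            𝓣.energyNorm σ v < ⊤ ∧
            ENNReal.ofReal c * 𝓣.energyNorm σ v ^ 2 ≤ ENNReal.ofReal (𝓣.aForm σ ζ γ v v)) := by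

  obtain ⟨hΩo, -, hΩb, hΩr, -⟩ := hΩ
  obtain ⟨R, hR0, hR⟩ : ∃ R, 0 < R ∧ closure Ω ⊆ Metric.closedBall 0 R := by
    obtain ⟨R, hR⟩ := hΩb.subset_closedBall 0
    exact ⟨max R 1, by positivity, closure_minimal
      (hR.trans (Metric.closedBall_subset_closedBall (le_max_left _ _))) Metric.isClosed_closedBall⟩
  -- a common bound of `ζ` and `γ`
  obtain ⟨M, hM0, hMζ, hMγ⟩ : ∃ M, 0 ≤ M ∧ (∀ x ∈ closure Ω, ‖ζ x‖ ≤ M) ∧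
      ∀ᵐ x ∂(volume.restrict Ω), |γ x| ≤ M := by
    obtain ⟨Z, hZ⟩ := hΩb.isCompact_closure.exists_bound_of_continuousOn hζc
    refine ⟨max Z (eLpNorm γ ⊤ (volume.restrict Ω)).toReal,
      le_max_of_le_right ENNReal.toReal_nonneg, fun x hx => (hZ x hx).trans (le_max_left _ _), ?_⟩
    filter_upwards [ae_le_eLpNormEssSup (f := γ) (μ := volume.restrict Ω)] with x hx
    refine le_max_of_le_right ?_
    rw [eLpNorm_exponent_top, ← Real.norm_eq_abs, ← toReal_enorm]
    exact ENNReal.toReal_mono (by simpa using hγ.1.2.ne) hx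
  -- the estimates use a shape constant which is at least one
  have hK1 : 1 ≤ max κ 1 := le_max_right _ _
  have hK0 : 0 ≤ max κ 1 := by linarith
  have hB := DG.Triangulation.one_le_poincareConst (max κ 1) R
  refine ⟨1 + 2 * (18 * max κ 1 + R * M), 4 + 3 * M * DG.Triangulation.poincareConst (max κ 1) R,
    (4 * (1 + 18 * max κ 1))⁻¹, by positivity, ?_, by positivity, fun σ hσ 𝓣 hreg =>
    ⟨fun w v hw hv => ?_, fun ⟨γ₀, hγ₀, hpos⟩ v hv => ?_⟩⟩
  · have := mul_nonneg hM0 (zero_le_one.trans hB)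
    linarith
  · have hσ1 : 1 ≤ σ := by
      have := mul_nonneg hR0.le hM0
      linarith
    exact DG.Triangulation.ofReal_abs_aForm_le hΩr hσ1 hR0 hR hK1
      (hreg.mono (le_max_left _ _)) hM0 hMζ hMγ hw hv
  · have hσ1 : 1 ≤ σ := by
      have := mul_nonneg hR0.le hM0
      linarith
    obtain ⟨g, c, h⟩ := hv.exists_isPiecewiseAffine
    have hE := h.energy_le_aForm hΩo hΩr hζ hζc hγ.1
      (hpos.mono fun x hx => hγ₀.le.trans hx) hR hM0 hMζ hK0
      (hreg.mono (le_max_left _ _)) hσ1 (by linarith)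
    have hn := h.regular.energyNorm_eq (zero_lt_one.trans_le hσ1)
    refine ⟨hn ▸ ENNReal.ofReal_lt_top, ?_⟩
    rw [hn, ← ENNReal.ofReal_pow (Real.sqrt_nonneg _), ← ENNReal.ofReal_mul (by positivity)]
    refine ENNReal.ofReal_le_ofReal ?_
    rw [inv_mul_le_iff₀ (by positivity), Real.sq_sqrt']
    have h0 : 0 ≤ 𝓣.energy σ v := le_trans (by
      have := 𝓣.gradSq_nonneg v
      have := 𝓣.jumpSq_nonneg v
      have := 𝓣.normalSq_nonneg v
      have : 0 < σ := by linarith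
      positivity) (𝓣.le_energy (zero_lt_one.trans_le hσ1) v)
    rw [max_eq_left h0]
    exact hE
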